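/- Let $G=\mathrm{SU}(2)$, let $D\subset\mathbb R^2$ and $B\subset\mathbb R^3$ be the closed unit balls with their standard orientations, and let $S^2=\partial B$ carry the boundary orientation. Let $G^D=C^\infty(D;G)$ with pointwise product, and let $G^D_{S^1}$ be the subgroup of those $g\in G^D$ with $g=1$ on $\partial D=S^1$. For $g,h\in G^D$ put $$C(g,h)=\frac1{8\pi^2}\int_D \mathrm{tr}\,(g^{-1}dg\wedge dh\,h^{-1})\in\mathbb R ,$$ and for a smooth map $\bar g:B\to G$ put $$\Lambda(\bar g)=-\frac1{24\pi^2}\int_B \mathrm{tr}\,(\bar g^{-1}d\bar g)^{\wedge 3}\in\mathbb R .$$ Call a smooth, orientation-preserving embedding $q$ of the open disk $\mathring D$ onto an open subset of $S^2$ a collapse if for every $g\in G^D_{S^1}$ the map $\tilde g:S^2\to G$ with $\tilde g(q(x))=g(x)$ for $x\in\mathring D$ and $\tilde g=1$ on $S^2\setminus q(\mathring D)$ is smooth. (If $S^2\setminus q(\mathring D)$ is one point, $q$ is an identification of $D/\partial D$ with $S^2$.) Collapses exist. For every collapse $q$, each $\tilde g$ with $g\in G^D_{S^1}$ extends to a smooth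 map $\bar g:B\to G$, and $\Lambda(\bar g)\bmod\mathbb Z$ does not depend on the extension; so there is a well-defined map $\Lambda:G^D_{S^1}\to\mathbb R/\mathbb Z$, $\Lambda(g)=\Lambda(\bar g)\bmod\mathbb Z$. With $\delta\Lambda(g,h)=\Lambda(h)-\Lambda(gh)+\Lambda(g)$, all $g,h\in G^D_{S^1}$ satisfy $$-\delta\Lambda(g,h)=C(g,h)\bmod\mathbb Z .$$ -/

import Mathlib

open scoped ContDiff

namespace Mickelsson

noncomputable section

/-- Euclidean `n`-space with its standard inner product and standard basis. -/
abbrev E (n : ℕ) : Type := EuclideanSpace ℝ (Fin n)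

/-- The complex `2 × 2` matrices. -/
abbrev M : Type := Matrix (Fin 2) (Fin 2) ℂ

/-- The compact Lie group `SU(2)`. -/
abbrev SU2 : Type := Matrix.specialUnitaryGroup (Fin 2) ℂ

/-- The closed unit disk `D` (for `n = 2`) and the closed unit ball `B` (for `n = 3`). -/
abbrev Ball (n : ℕ) : Set (E n) := Metric.closedBall 0 1

/-- The unit sphere `S²` in `ℝ³`. -/
abbrev S2 : Set (E 3) := Metric.sphere 0 1

-- `M` is a finite-dimensional real vector space, so that smoothness and derivatives do not depend
-- on the norm that is chosen here.
attribute [local instance] Matrix.linftyOpNormedRing Matrix.linftyOpNormedAlgebra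

lemma contDiff_conjTranspose : ContDiff ℝ ∞ (fun A : M => A.conjTranspose) := by
  let L : M →ₗ[ℝ] M :=
    { toFun := fun A => A.conjTranspose
      map_add' := fun A B => Matrix.conjTranspose_add A B
      map_smul' := fun c A => by
        ext i j
        simp }
  exact (LinearMap.toContinuousLinearMap L).contDiff

/-- The group `C^∞(S; SU(2))` with pointwise product. A map on a closed subset `S` of `ℝⁿ` (here a
closed ball or a sphere) is smooth if it is the restriction of a smooth map on `ℝⁿ`. Smoothness
into `SU(2)` is the same as smoothness into the ambient space of matrices. -/
def smoothMaps {n : ℕ} (S : Set (E n)) : Subgroup (S → SU2) where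
  carrier := {g | ∃ F : E n → M, ContDiff ℝ ∞ F ∧ ∀ x : S, F x = (g x : M)}
  mul_mem' := by
    rintro a b ⟨F, hF, hFa⟩ ⟨F', hF', hFb⟩
    exact ⟨fun x => F x * F' x, hF.mul hF', fun x => by simp [hFa, hFb]⟩
  one_mem' := ⟨fun _ => 1, contDiff_const, fun x => by simp⟩
  inv_mem' := by
    rintro a ⟨F, hF, hFa⟩
    refine ⟨fun x => (F x).conjTranspose, contDiff_conjTranspose.comp hF, fun x => ?_⟩
    simp only [hFa, Pi.inv_apply]
    rfl

/-- `G^D = C^∞(D; SU(2))`. -/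
abbrev GD : Subgroup (Ball 2 → SU2) := smoothMaps (Ball 2)

/-- `C^∞(B; SU(2))`. -/
abbrev GB : Subgroup (Ball 3 → SU2) := smoothMaps (Ball 3)

/-- `G^D_{S¹}`, the maps in `G^D` that are `1` on the boundary circle. -/
def GDS1 : Subgroup GD where
  carrier := {g | ∀ x : Ball 2, ‖(x : E 2)‖ = 1 → (g : Ball 2 → SU2) x = 1}
  mul_mem' := by
    intro a b ha hb x hx
    simp [ha x hx, hb x hx]
  one_mem' := fun x _ => by simp
  inv_mem' := by
    intro a ha x hx
    simp [ha x hx]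

open Classical in
/-- A map `S → SU(2)` as a matrix-valued function on `ℝⁿ`, with the value `0` off `S`. -/
def extendZero {n : ℕ} {S : Set (E n)} (g : S → SU2) (x : E n) : M :=
  if h : x ∈ S then (g ⟨x, h⟩ : M) else 0

/-- The differential `dg` at `x`, applied to the tangent vector `v` (for `S` a closed ball). -/
def diff {n : ℕ} {S : Set (E n)} (g : S → SU2) (x v : E n) : M :=
  fderivWithin ℝ (extendZero g) S x v

/-- The matrix-valued 1-form `g⁻¹ dg`. -/
def leftForm {n : ℕ} {S : Set (E n)} (g : S → SU2) (x v : E n) : M :=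
  extendZero g⁻¹ x * diff g x v

/-- The matrix-valued 1-form `dg g⁻¹`. -/
def rightForm {n : ℕ} {S : Set (E n)} (g : S → SU2) (x v : E n) : M :=
  diff g x v * extendZero g⁻¹ x

/-- The value `tr(η₁ ∧ ⋯ ∧ ηₙ)(e₁, …, eₙ)` on the standard basis of `ℝⁿ` at the point `x`, for
matrix-valued 1-forms `η₁, …, ηₙ`, with the wedge product
`(η₁ ∧ ⋯ ∧ ηₙ)(v₁, …, vₙ) = ∑_σ sgn(σ) η₁(v_{σ 1}) ⋯ ηₙ(v_{σ n})`. -/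
def traceWedge {n : ℕ} (η : Fin n → E n → E n → M) (x : E n) : ℂ :=
  ∑ σ : Equiv.Perm (Fin n), ((Equiv.Perm.sign σ : ℤ) : ℂ) *
    Matrix.trace (List.ofFn fun i => η i x (EuclideanSpace.basisFun (Fin n) ℝ (σ i))).prod

/-- `∫ tr(η₁ ∧ ⋯ ∧ ηₙ)` over the closed unit ball of `ℝⁿ` with its standard orientation. For the
forms below, `n` is `2` or `3` and the `ηᵢ` are skew-Hermitian, so that the `n`-form is real. -/
def integralTrace {n : ℕ} (η : Fin n → E n → E n → M) : ℝ :=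
  ∫ x in Ball n, (traceWedge η x).re

/-- `C(g, h) = (1 / 8π²) ∫_D tr(g⁻¹ dg ∧ dh h⁻¹)`. -/
def cocycle (g h : GD) : ℝ :=
  1 / (8 * Real.pi ^ 2) * integralTrace ![leftForm (g : Ball 2 → SU2), rightForm (h : Ball 2 → SU2)]

/-- `Λ(ḡ) = -(1 / 24π²) ∫_B tr((ḡ⁻¹ dḡ)^{∧ 3})` for a smooth map `ḡ : B → SU(2)`. -/
def ballIntegral (G : GB) : ℝ :=
  -(1 / (24 * Real.pi ^ 2)) * integralTrace fun _ : Fin 3 => leftForm (G : Ball 3 → SU2)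

/-- `u : S² → SU(2)` is the map that `g` induces on the sphere when the open disk is put into the
sphere by `q` and the rest of the sphere is collapsed to the boundary: `u (q x) = g x` for `x` in
the open disk, and `u = 1` off the image of the open disk. -/
def Induces (q : E 2 → E 3) (g : GDS1) (u : S2 → SU2) : Prop :=
  ∀ y : S2,
    (∀ x : Ball 2, ‖(x : E 2)‖ < 1 → q x = y → u y = ((g : GD) : Ball 2 → SU2) x) ∧
    ((y : E 3) ∉ q '' Metric.ball 0 1 → u y = 1)

/-- A collapse of the sphere onto `D/∂D`: an orientation-preserving smooth embedding `q` of the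
open disk as an open subset of `S²` (the sphere is oriented as the boundary of `B`, outward normal
first), through which every `g` in `G^D_{S¹}` induces a smooth map on `S²`. If the image of `q` is
`S²` without one point, `q` is an identification of `D/∂D` with `S²`. -/
structure IsCollapse (q : E 2 → E 3) : Prop where
  smooth : ContDiffOn ℝ ∞ q (Metric.ball 0 1)
  mapsTo : Set.MapsTo q (Metric.ball 0 1) S2
  injOn : Set.InjOn q (Metric.ball 0 1)
  oriented : ∀ x ∈ Metric.ball (0 : E 2) 1,
    0 < Matrix.det (Matrix.of ![(q x).ofLp,
      (fderiv ℝ q x (EuclideanSpace.basisFun (Fin 2) ℝ 0)).ofLp,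
      (fderiv ℝ q x (EuclideanSpace.basisFun (Fin 2) ℝ 1)).ofLp])
  smooth_induced : ∀ g : GDS1, ∃ u ∈ smoothMaps S2, Induces q g u

/-- `ḡ : B → SU(2)` restricts on `S² = ∂B` to the map that is induced by `g`. -/
def IsFilling (q : E 2 → E 3) (g : GDS1) (G : GB) : Prop :=
  Induces q g fun y => (G : Ball 3 → SU2) ⟨y, Metric.sphere_subset_closedBall y.2⟩

open Classical in
/-- The 1-cochain `Λ : G^D_{S¹} → ℝ/ℤ`, `Λ(g) = Λ(ḡ) mod ℤ` for a filling `ḡ` of `g`. -/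
def wzCochain (q : E 2 → E 3) (g : GDS1) : AddCircle (1 : ℝ) :=
  if h : ∃ G : GB, IsFilling q g G then ((ballIntegral h.choose : ℝ) : AddCircle (1 : ℝ)) else 0

/-- The group coboundary of a 1-cochain with coefficients in a trivial module. -/
def coboundary {Γ A : Type*} [Group Γ] [AddCommGroup A] (c : Γ → A) (g h : Γ) : A :=
  c h - c (g * h) + c g

end

end Mickelsson

open scoped ContDiff

namespace Mickelsson

noncomputable section

attribute [local instance] Matrix.linftyOpNormedRing Matrix.linftyOpNormedAlgebra

open MeasureTheory Matrix Topology

/-! Write ω₃(g) = tr (g⁻¹dg)³ and ω₂(g, h) = tr (g⁻¹dg ∧ dh h⁻¹). The Polyakov–Wiegmann identity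
ω₃(gh) = ω₃(g) + ω₃(h) − 3 dω₂(g, h) (`wz_mul`) makes Λ additive up to a boundary term, and 24/3 = 8
turns the constant of Λ into that of C. What remains is that Λ is well defined modulo ℤ, that
fillings exist, and that the boundary term can be computed for an arbitrary collapse.

Integrality. Two fillings of the same map differ by a left factor H that is 1 on the sphere, and the
identity reduces their difference to the integral of ω₃(H). So one needs ∫ ω₃(H) ∈ 24π²ℤ for every H
: ℝ³ → SU(2) that is 1 outside a compact set (`exists_int_integral_wz`). The functional f ↦ ∫ f(H)
ω₃(H) is invariant under left and right translations of SU(2), because differentiating along an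
invariant vector field gives an exact integrand. As in the uniqueness proof for Haar measure, any
two such functionals are proportional (`integral_mul_wz_proportional`). Comparison with an explicit
map of total integral 24π² (`integral_wz_model`), tested on a bump near a regular value, makes the
ratio a signed count of preimages (`exists_local_degree`).

Fillings. For dimension reasons a smooth map of the disk misses some point −c of SU(2)
(`exists_center`). The complement of −c contracts to 1 with 1 fixed, and running this contraction
along the radius fills the induced map (`exists_radial_filling`). A product of such fillings of g
and h fills gh.

Boundary term. Polar coordinates r·q(x) replace the ball by a cylinder over the disk; the rays that
miss the image of q contribute nothing, as the filling is 1 there (`setIntegral_ball_wz`). By Stokes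
on the cylinder only the face r = 1 survives, and it gives C(g, h) (`setIntegral_cyl_wz_mul`).

Throughout, `flat` maps ℝⁿ smoothly onto the closed ball, restricts to a diffeomorphism from a
smaller ball `core` onto the open ball, and sends the rest to the sphere. Composition with it makes
maps SU(2)-valued on all of ℝⁿ and turns boundary conditions into constancy off `core`. It also
yields a collapse: the graph of a polar cap over `core`. -/

/-! ### Trace forms and change of variables. -/

/-- The left form `F⁻¹ dF` of a matrix-valued function, with the adjoint for the inverse. -/
def lform {n : ℕ} (F : E n → M) (x v : E n) : M := (F x)ᴴ * fderiv ℝ F x v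

/-- The right form `dF F⁻¹` of a matrix-valued function, with the adjoint for the inverse. -/
def rform {n : ℕ} (F : E n → M) (x v : E n) : M := fderiv ℝ F x v * (F x)ᴴ

/-- The standard basis vector. -/
abbrev ee {n : ℕ} (i : Fin n) : E n := EuclideanSpace.basisFun (Fin n) ℝ i

/-- The multilinear map `tr(η₁(v₁) ⋯ ηₙ(vₙ))`. -/
def traceMultilinear {n : ℕ} (L : Fin n → E n →ₗ[ℝ] M) :
    MultilinearMap ℝ (fun _ : Fin n => E n) ℂ :=
  ((Matrix.traceLinearMap (Fin 2) ℝ ℂ).compMultilinearMap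
    (MultilinearMap.mkPiAlgebraFin ℝ n M)).compLinearMap L

lemma traceWedge_eq_alternatization {n : ℕ} (η : Fin n → E n → E n → M) (x : E n)
    (L : Fin n → E n →ₗ[ℝ] M) (hL : ∀ i v, η i x v = L i v) :
    traceWedge η x = MultilinearMap.alternatization (traceMultilinear L) (fun i => ee i) := by
  simp only [traceWedge, MultilinearMap.alternatization_apply, traceMultilinear]
  refine Finset.sum_congr rfl fun σ _ => ?_
  simp [hL, MultilinearMap.mkPiAlgebraFin_apply, Units.smul_def]

/-- A top-degree alternating form is a multiple of the determinant, so pulling it back along `A`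
multiplies it by `A.det`. The real part makes the form real-valued. -/
lemma traceWedge_comp_linear {n : ℕ} (η ζ : Fin n → E n → E n → M) (x y : E n)
    (A : E n →L[ℝ] E n) (L : Fin n → E n →ₗ[ℝ] M) (hL : ∀ i v, η i y v = L i v)
    (hζ : ∀ i v, ζ i x v = η i y (A v)) :
    (traceWedge ζ x).re = A.det * (traceWedge η y).re := by
  rw [traceWedge_eq_alternatization η y L hL,
    traceWedge_eq_alternatization ζ x (fun i => (L i).comp (A : E n →ₗ[ℝ] E n))
      (fun i v => by simp [hζ, hL])]
  let f : E n [⋀^Fin n]→ₗ[ℝ] ℝ :=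
    Complex.reLm.compAlternatingMap (MultilinearMap.alternatization (traceMultilinear L))
  let b := (EuclideanSpace.basisFun (Fin n) ℝ).toBasis
  have h1 : (MultilinearMap.alternatization
      (traceMultilinear fun i => (L i).comp (A : E n →ₗ[ℝ] E n)) (fun i => ee i)).re
      = f (fun i => A (b i)) := by
    simp [f, b, MultilinearMap.alternatization_apply, traceMultilinear, Units.smul_def]
  have h2 : (MultilinearMap.alternatization (traceMultilinear L) (fun i => ee i)).re = f b := by
    simp only [f, b, LinearMap.compAlternatingMap_apply, Complex.reLm_coe]
    congr 3
  rw [h1, h2]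
  have h3 := congrArg (fun φ => φ (fun i => A (b i))) (f.eq_smul_basis_det b)
  simp only [AlternatingMap.smul_apply, smul_eq_mul] at h3
  rw [h3, mul_comm]
  congr 1
  have := b.det_comp (A : E n →ₗ[ℝ] E n) b
  rw [b.det_self, mul_one] at this
  exact this

lemma extendZero_of_mem {n : ℕ} {S : Set (E n)} (g : S → SU2) {x : E n} (hx : x ∈ S) :
    extendZero g x = (g ⟨x, hx⟩ : M) := by
  simp [extendZero, hx]

lemma diff_eq_fderiv {n : ℕ} {g : Ball n → SU2} {F : E n → M}
    (hg : ∀ x : Ball n, F x = (g x : M)) {x : E n} (hx : x ∈ Metric.ball (0 : E n) 1) (v : E n) :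
    diff g x v = fderiv ℝ F x v := by
  have hB : Ball n ∈ nhds x := Filter.mem_of_superset (Metric.isOpen_ball.mem_nhds hx)
    Metric.ball_subset_closedBall
  rw [diff, fderivWithin_of_mem_nhds hB]
  congr 1
  apply Filter.EventuallyEq.fderiv_eq
  filter_upwards [hB] with y hy
  rw [extendZero_of_mem g hy, hg ⟨y, hy⟩]

lemma extendZero_inv {n : ℕ} {g : Ball n → SU2} {F : E n → M}
    (hg : ∀ x : Ball n, F x = (g x : M)) {x : E n} (hx : x ∈ Metric.ball (0 : E n) 1) :
    extendZero g⁻¹ x = (F x)ᴴ := by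
  rw [extendZero_of_mem _ (Metric.ball_subset_closedBall hx)]
  rw [hg ⟨x, Metric.ball_subset_closedBall hx⟩]
  rfl

lemma leftForm_eq {n : ℕ} {g : Ball n → SU2} {F : E n → M}
    (hg : ∀ x : Ball n, F x = (g x : M)) {x : E n} (hx : x ∈ Metric.ball (0 : E n) 1) (v : E n) :
    leftForm g x v = lform F x v := by
  rw [leftForm, lform, diff_eq_fderiv hg hx, extendZero_inv hg hx]

lemma rightForm_eq {n : ℕ} {g : Ball n → SU2} {F : E n → M}
    (hg : ∀ x : Ball n, F x = (g x : M)) {x : E n} (hx : x ∈ Metric.ball (0 : E n) 1) (v : E n) :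
    rightForm g x v = rform F x v := by
  rw [rightForm, rform, diff_eq_fderiv hg hx, extendZero_inv hg hx]

/-- The boundary sphere is a null set, so derivatives within the closed ball may be replaced by
ordinary derivatives in its interior. -/
lemma integralTrace_eq {n : ℕ} (hn : 0 < n) (η ζ : Fin n → E n → E n → M)
    (h : ∀ i, ∀ x ∈ Metric.ball (0 : E n) 1, ∀ v, η i x v = ζ i x v) :
    integralTrace η = ∫ x in Metric.ball (0 : E n) 1, (traceWedge ζ x).re := by
  have : Nonempty (Fin n) := ⟨⟨0, hn⟩⟩
  have : Nontrivial (E n) := by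
    refine ⟨ee ⟨0, hn⟩, 0, fun h => ?_⟩
    have := congrArg norm h
    simp at this
  have hs : Ball n =ᵐ[volume] Metric.ball (0 : E n) 1 := by
    have h0 : volume (Metric.sphere (0 : E n) 1) = 0 := Measure.addHaar_sphere _ _ _
    rw [Ball, ← Metric.ball_union_sphere]
    exact union_ae_eq_left_of_ae_eq_empty (ae_eq_empty.2 h0)
  rw [integralTrace, setIntegral_congr_set hs]
  refine setIntegral_congr_fun Metric.isOpen_ball.measurableSet fun x hx => ?_
  simp only [traceWedge]
  simp only [h _ x hx]

lemma traceWedge_two (η : Fin 2 → E 2 → E 2 → M) (x : E 2) :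
    traceWedge η x = trace (η 0 x (ee 0) * η 1 x (ee 1) - η 0 x (ee 1) * η 1 x (ee 0)) := by
  have h : (Finset.univ : Finset (Equiv.Perm (Fin 2))) = {1, Equiv.swap 0 1} := by decide
  rw [traceWedge, h, Finset.sum_pair (by decide)]
  simp [sub_eq_add_neg]

/-- Cyclicity of the trace groups the six permutations into two classes of three. -/
lemma traceWedge_three (η : Fin 3 → E 3 → E 3 → M) (ζ : E 3 → E 3 → M) (x : E 3)
    (h : ∀ i v, η i x v = ζ x v) :
    traceWedge η x = 3 * trace (ζ x (ee 0) * (ζ x (ee 1) * ζ x (ee 2) - ζ x (ee 2) * ζ x (ee 1))) := by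
  have hu : (Finset.univ : Finset (Equiv.Perm (Fin 3))) = {1, Equiv.swap 0 1, Equiv.swap 0 2,
    Equiv.swap 1 2, Equiv.swap 0 1 * Equiv.swap 1 2, Equiv.swap 1 2 * Equiv.swap 0 1} := by decide
  have s2 : Equiv.swap (0 : Fin 3) 1 2 = 2 := by decide
  have s1 : Equiv.swap (0 : Fin 3) 2 1 = 1 := by decide
  have s0 : Equiv.swap (1 : Fin 3) 2 0 = 0 := by decide
  simp only [traceWedge, h]
  rw [hu]
  repeat rw [Finset.sum_insert (by decide)]
  rw [Finset.sum_singleton]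
  simp only [List.ofFn_succ, List.ofFn_zero, List.prod_cons, List.prod_nil, mul_one]
  simp only [Fin.succ_zero_eq_one, Fin.succ_one_eq_two, Equiv.Perm.coe_mul, Function.comp_apply,
    Equiv.swap_apply_left, Equiv.swap_apply_right, s0, s1, s2, Equiv.Perm.coe_one, id_eq]
  simp [trace_fin_two, mul_apply, Fin.sum_univ_two]
  ring

/-- Change of variables for `tr(η₁ ∧ ⋯ ∧ ηₙ)` under an orientation-preserving injective map. -/
lemma setIntegral_traceWedge_image {n : ℕ} (η ζ : Fin n → E n → E n → M) {U : Set (E n)}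
    (hU : MeasurableSet U) (φ : E n → E n) (φ' : E n → E n →L[ℝ] E n)
    (hφ : ∀ x ∈ U, HasFDerivAt φ (φ' x) x) (hinj : Set.InjOn φ U)
    (hdet : ∀ x ∈ U, 0 < (φ' x).det) (L : E n → Fin n → E n →ₗ[ℝ] M)
    (hL : ∀ x ∈ U, ∀ i v, η i (φ x) v = L x i v)
    (hζ : ∀ x ∈ U, ∀ i v, ζ i x v = η i (φ x) (φ' x v)) :
    ∫ y in φ '' U, (traceWedge η y).re = ∫ x in U, (traceWedge ζ x).re := by
  rw [integral_image_eq_integral_abs_det_fderiv_smul volume hU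
    (fun x hx => (hφ x hx).hasFDerivWithinAt) hinj]
  refine setIntegral_congr_fun hU fun x hx => ?_
  rw [traceWedge_comp_linear η ζ x (φ x) (φ' x) (L x) (hL x hx) (hζ x hx),
    abs_of_pos (hdet x hx), smul_eq_mul]

lemma lform_comp {n m : ℕ} {F : E m → M} {K : E n → M} {φ : E n → E m} {A : E n →L[ℝ] E m} {x : E n}
    (hF : DifferentiableAt ℝ F (φ x)) (hφ : HasFDerivAt φ A x)
    (hK : K =ᶠ[nhds x] F ∘ φ) (v : E n) : lform K x v = lform F (φ x) (A v) := by
  have h : HasFDerivAt K ((fderiv ℝ F (φ x)).comp A) x :=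
    (hF.hasFDerivAt.comp x hφ).congr_of_eventuallyEq hK
  rw [lform, lform, h.fderiv, hK.eq_of_nhds]
  rfl

lemma rform_comp {n m : ℕ} {F : E m → M} {K : E n → M} {φ : E n → E m} {A : E n →L[ℝ] E m} {x : E n}
    (hF : DifferentiableAt ℝ F (φ x)) (hφ : HasFDerivAt φ A x)
    (hK : K =ᶠ[nhds x] F ∘ φ) (v : E n) : rform K x v = rform F (φ x) (A v) := by
  have h : HasFDerivAt K ((fderiv ℝ F (φ x)).comp A) x :=
    (hF.hasFDerivAt.comp x hφ).congr_of_eventuallyEq hK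
  rw [rform, rform, h.fderiv, hK.eq_of_nhds]
  rfl

/-- The left form as a linear map in the tangent vector. -/
def lformLin {n : ℕ} (F : E n → M) (x : E n) : E n →ₗ[ℝ] M :=
  (LinearMap.mulLeft ℝ (F x)ᴴ).comp (fderiv ℝ F x : E n →ₗ[ℝ] M)

/-- The right form as a linear map in the tangent vector. -/
def rformLin {n : ℕ} (F : E n → M) (x : E n) : E n →ₗ[ℝ] M :=
  (LinearMap.mulRight ℝ (F x)ᴴ).comp (fderiv ℝ F x : E n →ₗ[ℝ] M)

/-- The coefficient of the real 3-form `tr (F⁻¹dF)³`. -/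
def wz (F : E 3 → M) (x : E 3) : ℝ := (traceWedge (fun _ => lform F) x).re

/-- The coefficient of the real 2-form `tr (F⁻¹dF ∧ dK K⁻¹)`. -/
def pairing (F K : E 2 → M) (x : E 2) : ℝ := (traceWedge ![lform F, rform K] x).re

lemma setIntegral_wz_image {F K : E 3 → M} {U : Set (E 3)} (hU : IsOpen U) {φ : E 3 → E 3}
    {φ' : E 3 → E 3 →L[ℝ] E 3} (hφ : ∀ x ∈ U, HasFDerivAt φ (φ' x) x) (hinj : Set.InjOn φ U)
    (hdet : ∀ x ∈ U, 0 < (φ' x).det) (hF : Differentiable ℝ F) (hK : ∀ x ∈ U, K x = F (φ x)) :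
    ∫ y in φ '' U, wz F y = ∫ x in U, wz K x := by
  refine setIntegral_traceWedge_image (fun _ => lform F) (fun _ => lform K) hU.measurableSet φ φ'
    hφ hinj hdet (fun x _ => lformLin F (φ x)) (fun x _ _ v => rfl) fun x hx _ v => ?_
  refine lform_comp (hF _) (hφ x hx) ?_ v
  filter_upwards [hU.mem_nhds hx] with y hy using hK y hy

lemma setIntegral_pairing_image {F₁ F₂ K₁ K₂ : E 2 → M} {U : Set (E 2)} (hU : IsOpen U)
    {φ : E 2 → E 2} {φ' : E 2 → E 2 →L[ℝ] E 2} (hφ : ∀ x ∈ U, HasFDerivAt φ (φ' x) x)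
    (hinj : Set.InjOn φ U) (hdet : ∀ x ∈ U, 0 < (φ' x).det) (hF₁ : Differentiable ℝ F₁)
    (hF₂ : Differentiable ℝ F₂) (hK₁ : ∀ x ∈ U, K₁ x = F₁ (φ x))
    (hK₂ : ∀ x ∈ U, K₂ x = F₂ (φ x)) :
    ∫ y in φ '' U, pairing F₁ F₂ y = ∫ x in U, pairing K₁ K₂ x := by
  refine setIntegral_traceWedge_image ![lform F₁, rform F₂] ![lform K₁, rform K₂] hU.measurableSet
    φ φ' hφ hinj hdet (fun x => ![lformLin F₁ (φ x), rformLin F₂ (φ x)]) (fun x _ i v => ?_)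
    fun x hx i v => ?_
  · fin_cases i <;> rfl
  · have e1 : K₁ =ᶠ[nhds x] F₁ ∘ φ := by
      filter_upwards [hU.mem_nhds hx] with y hy using hK₁ y hy
    have e2 : K₂ =ᶠ[nhds x] F₂ ∘ φ := by
      filter_upwards [hU.mem_nhds hx] with y hy using hK₂ y hy
    fin_cases i
    · exact lform_comp (hF₁ _) (hφ x hx) e1 v
    · exact rform_comp (hF₂ _) (hφ x hx) e2 v

lemma ballIntegral_eq (G : GB) {F : E 3 → M} (hF : ∀ x : Ball 3, F x = ((G : Ball 3 → SU2) x : M)) :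
    ballIntegral G = -(1 / (24 * Real.pi ^ 2)) * ∫ x in Metric.ball (0 : E 3) 1, wz F x := by
  rw [ballIntegral, integralTrace_eq (by norm_num) _ (fun _ => lform F)
    fun _ x hx v => leftForm_eq hF hx v]
  rfl

lemma cocycle_eq (g h : GD) {F K : E 2 → M} (hF : ∀ x : Ball 2, F x = ((g : Ball 2 → SU2) x : M))
    (hK : ∀ x : Ball 2, K x = ((h : Ball 2 → SU2) x : M)) :
    cocycle g h = 1 / (8 * Real.pi ^ 2) * ∫ x in Metric.ball (0 : E 2) 1, pairing F K x := by
  rw [cocycle, integralTrace_eq (by norm_num) _ ![lform F, rform K] fun i x hx v => ?_]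
  · rfl
  · fin_cases i
    · exact leftForm_eq hF hx v
    · exact rightForm_eq hK hx v

/-! ### Partial derivatives of matrix-valued functions. -/

/-- The partial derivative in the direction of a standard basis vector. -/
def pd {n : ℕ} {V : Type*} [NormedAddCommGroup V] [NormedSpace ℝ V] (i : Fin n) (F : E n → V)
    (x : E n) : V :=
  fderiv ℝ F x (ee i)

/-- A smooth map from `ℝⁿ` to `SU(2)`, as a matrix-valued function. -/
structure IsGauge {n : ℕ} (G : E n → M) : Prop where
  smooth : ContDiff ℝ ∞ G
  mem : ∀ x, G x ∈ specialUnitaryGroup (Fin 2) ℂ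

section pd

variable {n : ℕ} {V : Type*} [NormedAddCommGroup V] [NormedSpace ℝ V]

lemma contDiff_pd {F : E n → V} (hF : ContDiff ℝ ∞ F) (i : Fin n) : ContDiff ℝ ∞ (pd i F) :=
  (hF.fderiv_right (m := ∞) (by norm_cast)).clm_apply contDiff_const

lemma pd_comm {F : E n → V} (hF : ContDiff ℝ ∞ F) (i j : Fin n) (x : E n) :
    pd i (pd j F) x = pd j (pd i F) x := by
  have hd : DifferentiableAt ℝ (fderiv ℝ F) x :=
    ((hF.fderiv_right (m := ∞) (by norm_cast)).differentiable (by simp)) x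
  have h : ∀ k l : Fin n, pd k (pd l F) x = fderiv ℝ (fderiv ℝ F) x (ee k) (ee l) := by
    intro k l
    have : HasFDerivAt (pd l F) ((fderiv ℝ (fderiv ℝ F) x).flip (ee l)) x :=
      hd.hasFDerivAt.clm_apply (hasFDerivAt_const (ee l) x) |>.congr_fderiv (by ext; simp)
    rw [pd, this.fderiv]
    rfl
  rw [h, h]
  have := (hF.contDiffAt (x := x)).isSymmSndFDerivAt
    (by simp only [minSmoothness_of_isRCLikeNormedField]; exact WithTop.coe_le_coe.2 le_top)
  exact this (ee i) (ee j)

lemma pd_mul {A B : E n → M} {x : E n} (hA : DifferentiableAt ℝ A x) (hB : DifferentiableAt ℝ B x)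
    (i : Fin n) : pd i (fun y => A y * B y) x = pd i A x * B x + A x * pd i B x := by
  have h := hA.hasFDerivAt.mul' hB.hasFDerivAt
  exact (congrArg (fun L => L (ee i)) h.fderiv).trans (add_comm (A x * pd i B x) (pd i A x * B x))

/-- Taking adjoints, as a real linear map. -/
def conjTransposeCLM : M →L[ℝ] M :=
  LinearMap.toContinuousLinearMap
    { toFun := fun A => Aᴴ
      map_add' := fun A B => Matrix.conjTranspose_add A B
      map_smul' := fun c A => by ext i j; simp }

lemma pd_conjTranspose {A : E n → M} {x : E n} (hA : DifferentiableAt ℝ A x) (i : Fin n) :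
    pd i (fun y => (A y)ᴴ) x = (pd i A x)ᴴ := by
  exact congrArg (fun L => L (ee i)) (conjTransposeCLM.hasFDerivAt.comp x hA.hasFDerivAt).fderiv

/-- The real part of the trace, as a real linear map. -/
def reTraceCLM : M →L[ℝ] ℝ :=
  LinearMap.toContinuousLinearMap (Complex.reLm ∘ₗ traceLinearMap (Fin 2) ℝ ℂ)

lemma pd_reTrace {A : E n → M} {x : E n} (hA : DifferentiableAt ℝ A x) (i : Fin n) :
    pd i (fun y => (trace (A y)).re) x = (trace (pd i A x)).re := by
  exact congrArg (fun L => L (ee i)) (reTraceCLM.hasFDerivAt.comp x hA.hasFDerivAt).fderiv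

lemma pd_sub {A B : E n → V} {x : E n} (hA : DifferentiableAt ℝ A x) (hB : DifferentiableAt ℝ B x)
    (i : Fin n) : pd i (fun y => A y - B y) x = pd i A x - pd i B x := by
  rw [pd, fderiv_fun_sub hA hB]
  rfl

lemma integral_pd_eq_zero {f : E n → ℝ} (hf : ContDiff ℝ 1 f) (hc : HasCompactSupport f)
    (i : Fin n) : ∫ x, pd i f x = 0 := by
  have h1 : Continuous (fun x => fderiv ℝ f x (ee i)) :=
    (hf.continuous_fderiv (by simp)).clm_apply continuous_const
  have h2 : HasCompactSupport (fun x => fderiv ℝ f x (ee i)) := by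
    refine (hc.fderiv (𝕜 := ℝ)).mono fun x hx => ?_
    simp only [Function.mem_support] at hx ⊢
    exact fun h => hx (by rw [h]; rfl)
  -- Integration by parts against the constant function 1.
  have := integral_mul_fderiv_eq_neg_fderiv_mul_of_integrable (μ := volume) (𝕜 := ℝ)
    (f := fun _ : E n => (1 : ℝ)) (g := f) (v := ee i) (by simp)
    (by simpa using h1.integrable_of_hasCompactSupport h2)
    (by simpa using hf.continuous.integrable_of_hasCompactSupport hc)
    (fun x _ => differentiableAt_const _) (fun x _ => (hf.differentiable (by simp)) x)
  simpa [pd] using this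

end pd

/-! ### Maurer–Cartan equations and the Polyakov–Wiegmann identity. -/

section forms

variable {n : ℕ}

lemma conjTranspose_mul_self_of_mem {A : M} (h : A ∈ specialUnitaryGroup (Fin 2) ℂ) : Aᴴ * A = 1 :=
  h.1.1

lemma mul_conjTranspose_self_of_mem {A : M} (h : A ∈ specialUnitaryGroup (Fin 2) ℂ) : A * Aᴴ = 1 :=
  h.1.2

lemma conjTranspose_mem {A : M} (h : A ∈ specialUnitaryGroup (Fin 2) ℂ) :
    Aᴴ ∈ specialUnitaryGroup (Fin 2) ℂ := (star (⟨A, h⟩ : SU2)).2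

namespace IsGauge

variable {G H : E n → M}

lemma mul (hG : IsGauge G) (hH : IsGauge H) : IsGauge fun x => G x * H x :=
  ⟨hG.smooth.mul hH.smooth, fun x => mul_mem (hG.mem x) (hH.mem x)⟩

lemma conjTranspose (hG : IsGauge G) : IsGauge fun x => (G x)ᴴ :=
  ⟨contDiff_conjTranspose.comp hG.smooth, fun x => conjTranspose_mem (hG.mem x)⟩

lemma differentiable (hG : IsGauge G) : Differentiable ℝ G := hG.smooth.differentiable (by simp)

lemma conjTranspose_mul_self (hG : IsGauge G) (x : E n) : (G x)ᴴ * G x = 1 :=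
  conjTranspose_mul_self_of_mem (hG.mem x)

lemma mul_conjTranspose_self (hG : IsGauge G) (x : E n) : G x * (G x)ᴴ = 1 :=
  mul_conjTranspose_self_of_mem (hG.mem x)

lemma differentiable_conjTranspose (hG : IsGauge G) : Differentiable ℝ fun x => (G x)ᴴ :=
  hG.conjTranspose.differentiable

lemma conjTranspose_pd (hG : IsGauge G) (i : Fin n) (x : E n) :
    (pd i G x)ᴴ = - ((G x)ᴴ * pd i G x * (G x)ᴴ) := by
  have h := pd_mul (hG.differentiable_conjTranspose x) (hG.differentiable x) i
  have h0 : (fun y => (G y)ᴴ * G y) = fun _ => 1 := funext hG.conjTranspose_mul_self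
  rw [h0, pd_conjTranspose (hG.differentiable x)] at h
  have h1 : pd i (fun _ : E n => (1 : M)) x = 0 := by simp [pd]
  rw [h1] at h
  have h2 : (pd i G x)ᴴ * G x = - ((G x)ᴴ * pd i G x) := by
    rw [eq_neg_iff_add_eq_zero, ← h]
  calc (pd i G x)ᴴ = (pd i G x)ᴴ * G x * (G x)ᴴ := by
        rw [Matrix.mul_assoc, hG.mul_conjTranspose_self, Matrix.mul_one]
    _ = _ := by rw [h2, Matrix.neg_mul]

lemma contDiff_lform (hG : IsGauge G) (i : Fin n) : ContDiff ℝ ∞ fun x => lform G x (ee i) :=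
  hG.conjTranspose.smooth.mul (contDiff_pd hG.smooth i)

lemma contDiff_rform (hG : IsGauge G) (i : Fin n) : ContDiff ℝ ∞ fun x => rform G x (ee i) :=
  (contDiff_pd hG.smooth i).mul hG.conjTranspose.smooth

/-- Antisymmetrized in `i` and `j`, the second derivative cancels and this is the Maurer–Cartan
equation da = −a ∧ a for a = G⁻¹dG. In the same way `pd_rform` gives db = b ∧ b for b = dG G⁻¹. -/
lemma pd_lform (hG : IsGauge G) (i j : Fin n) (x : E n) :
    pd i (fun y => lform G y (ee j)) x =
      (G x)ᴴ * pd i (pd j G) x - lform G x (ee i) * lform G x (ee j) := by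
  change pd i (fun y => (G y)ᴴ * pd j G y) x = _
  rw [pd_mul (hG.differentiable_conjTranspose x)
    ((contDiff_pd hG.smooth j).differentiable (by simp) x), pd_conjTranspose (hG.differentiable x),
    hG.conjTranspose_pd]
  change _ = _ - (G x)ᴴ * pd i G x * ((G x)ᴴ * pd j G x)
  noncomm_ring

lemma pd_rform (hG : IsGauge G) (i j : Fin n) (x : E n) :
    pd i (fun y => rform G y (ee j)) x =
      pd i (pd j G) x * (G x)ᴴ - rform G x (ee j) * rform G x (ee i) := by
  change pd i (fun y => pd j G y * (G y)ᴴ) x = _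
  rw [pd_mul ((contDiff_pd hG.smooth j).differentiable (by simp) x)
    (hG.differentiable_conjTranspose x), pd_conjTranspose (hG.differentiable x),
    hG.conjTranspose_pd]
  change _ = _ - pd j G x * (G x)ᴴ * (pd i G x * (G x)ᴴ)
  noncomm_ring

lemma lform_mul (hG : IsGauge G) (hH : IsGauge H) (i : Fin n) (x : E n) :
    lform (fun y => G y * H y) x (ee i) =
      (H x)ᴴ * (lform G x (ee i) + rform H x (ee i)) * H x := by
  change (G x * H x)ᴴ * pd i (fun y => G y * H y) x =
    (H x)ᴴ * ((G x)ᴴ * pd i G x + pd i H x * (H x)ᴴ) * H x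
  rw [pd_mul (hG.differentiable x) (hH.differentiable x), conjTranspose_mul]
  have h1 := hH.conjTranspose_mul_self x
  have h2 := hG.conjTranspose_mul_self x
  calc (H x)ᴴ * (G x)ᴴ * (pd i G x * H x + G x * pd i H x)
      = (H x)ᴴ * (G x)ᴴ * pd i G x * H x + (H x)ᴴ * ((G x)ᴴ * G x) * pd i H x := by noncomm_ring
    _ = (H x)ᴴ * (G x)ᴴ * pd i G x * H x + (H x)ᴴ * pd i H x * ((H x)ᴴ * H x) := by
        rw [h1, h2]; noncomm_ring
    _ = _ := by noncomm_ring

lemma rform_eq (hG : IsGauge G) (i : Fin n) (x : E n) :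
    rform G x (ee i) = G x * lform G x (ee i) * (G x)ᴴ := by
  change pd i G x * (G x)ᴴ = G x * ((G x)ᴴ * pd i G x) * (G x)ᴴ
  rw [← Matrix.mul_assoc, hG.mul_conjTranspose_self, Matrix.one_mul]

end IsGauge

/-- The cubic form `Re tr (A [B, C])`. -/
def triple (A B C : M) : ℝ := (trace (A * (B * C - C * B))).re

lemma triple_conj {U A B C : M} (hU : U * Uᴴ = 1) :
    triple (Uᴴ * A * U) (Uᴴ * B * U) (Uᴴ * C * U) = triple A B C := by
  have : Uᴴ * A * U * (Uᴴ * B * U * (Uᴴ * C * U) - Uᴴ * C * U * (Uᴴ * B * U)) =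
      Uᴴ * (A * (B * C - C * B)) * U := by
    calc _ = Uᴴ * A * (U * Uᴴ) * B * (U * Uᴴ) * C * U - Uᴴ * A * (U * Uᴴ) * C * (U * Uᴴ) * B * U := by
          noncomm_ring
      _ = _ := by rw [hU]; noncomm_ring
  rw [triple, this, trace_mul_comm, ← Matrix.mul_assoc, hU, Matrix.one_mul, triple]

lemma wz_eq_triple (F : E 3 → M) (x : E 3) :
    wz F x = 3 * triple (lform F x (ee 0)) (lform F x (ee 1)) (lform F x (ee 2)) := by
  rw [wz, traceWedge_three (fun _ => lform F) (lform F) x (fun _ _ => rfl), triple]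
  simp

lemma IsGauge.wz_eq_triple_rform {G : E 3 → M} (hG : IsGauge G) (x : E 3) :
    wz G x = 3 * triple (rform G x (ee 0)) (rform G x (ee 1)) (rform G x (ee 2)) := by
  rw [wz_eq_triple]
  simp only [hG.rform_eq]
  have := triple_conj (U := (G x)ᴴ) (A := lform G x (ee 0)) (B := lform G x (ee 1))
    (C := lform G x (ee 2)) (by simpa using hG.conjTranspose_mul_self x)
  simp only [conjTranspose_conjTranspose] at this
  rw [this]

/-- Inversion turns the left form into minus the right form, and the form is cubic. -/
lemma IsGauge.wz_conjTranspose {G : E 3 → M} (hG : IsGauge G) (x : E 3) :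
    wz (fun y => (G y)ᴴ) x = - wz G x := by
  have h : ∀ i, lform (fun y => (G y)ᴴ) x (ee i) = - rform G x (ee i) := by
    intro i
    change (G x)ᴴᴴ * pd i (fun y => (G y)ᴴ) x = - (pd i G x * (G x)ᴴ)
    rw [pd_conjTranspose (hG.differentiable x), hG.conjTranspose_pd, conjTranspose_conjTranspose]
    calc _ = - (G x * (G x)ᴴ * (pd i G x * (G x)ᴴ)) := by noncomm_ring
      _ = _ := by rw [hG.mul_conjTranspose_self, Matrix.one_mul]
  rw [wz_eq_triple, hG.wz_eq_triple_rform]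
  simp only [h, triple, neg_mul, trace_neg, Complex.neg_re, mul_neg, neg_neg]

/-- The coefficients of the 2-form `Re tr (G⁻¹dG ∧ dH H⁻¹)`. -/
def omega {n : ℕ} (G H : E n → M) (i j : Fin n) (x : E n) : ℝ :=
  (trace (lform G x (ee i) * rform H x (ee j) - lform G x (ee j) * rform H x (ee i))).re

lemma pairing_eq_omega (F K : E 2 → M) (x : E 2) : pairing F K x = omega F K 0 1 x := by
  rw [pairing, traceWedge_two]
  rfl

lemma contDiff_omega {G H : E n → M} (hG : IsGauge G) (hH : IsGauge H) (i j : Fin n) :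
    ContDiff ℝ ∞ (omega G H i j) :=
  reTraceCLM.contDiff.comp
    (((hG.contDiff_lform i).mul (hH.contDiff_rform j)).sub
      ((hG.contDiff_lform j).mul (hH.contDiff_rform i)))

lemma pd_omega {G H : E n → M} (hG : IsGauge G) (hH : IsGauge H) (k i j : Fin n) (x : E n) :
    pd k (omega G H i j) x = (trace (
      pd k (fun y => lform G y (ee i)) x * rform H x (ee j) +
      lform G x (ee i) * pd k (fun y => rform H y (ee j)) x -
      (pd k (fun y => lform G y (ee j)) x * rform H x (ee i) +
      lform G x (ee j) * pd k (fun y => rform H y (ee i)) x))).re := by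
  have dl : ∀ i, DifferentiableAt ℝ (fun y => lform G y (ee i)) x := fun i =>
    (hG.contDiff_lform i).differentiable (by simp) x
  have dr : ∀ i, DifferentiableAt ℝ (fun y => rform H y (ee i)) x := fun i =>
    (hH.contDiff_rform i).differentiable (by simp) x
  change pd k (fun y => (trace (lform G y (ee i) * rform H y (ee j) -
    lform G y (ee j) * rform H y (ee i))).re) x = _
  have h1 := (dl i).fun_mul (dr j)
  have h2 := (dl j).fun_mul (dr i)
  rw [pd_reTrace (h1.fun_sub h2), pd_sub h1 h2, pd_mul (dl i) (dr j), pd_mul (dl j) (dr i)]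

/-- The Polyakov–Wiegmann identity. -/
lemma wz_mul {G H : E 3 → M} (hG : IsGauge G) (hH : IsGauge H) (x : E 3) :
    wz (fun y => G y * H y) x = wz G x + wz H x -
      3 * (pd 0 (omega G H 1 2) x + pd 1 (omega G H 2 0) x + pd 2 (omega G H 0 1) x) := by
  rw [wz_eq_triple]
  simp only [hG.lform_mul hH]
  -- The left form of GH is conjugate by H to a + b, with a = G⁻¹dG and b = dH H⁻¹. So tr (a + b)³
  -- has to be compared with tr a³ + tr b³ − 3 d tr(a ∧ b); the mixed terms match because d tr(a ∧
  -- b) = −tr(a²b) − tr(ab²).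
  rw [triple_conj (hH.mul_conjTranspose_self x), wz_eq_triple, hH.wz_eq_triple_rform]
  simp only [pd_omega hG hH, hG.pd_lform, hH.pd_rform]
  rw [pd_comm hG.smooth 1 0, pd_comm hG.smooth 2 0, pd_comm hG.smooth 2 1,
    pd_comm hH.smooth 1 0, pd_comm hH.smooth 2 0, pd_comm hH.smooth 2 1]
  simp only [triple]
  -- Once mixed partials are put in a common order, the claim is a polynomial identity in twelve
  -- arbitrary matrices.
  generalize (G x)ᴴ * pd 0 (pd 1 G) x = g01
  generalize (G x)ᴴ * pd 0 (pd 2 G) x = g02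
  generalize (G x)ᴴ * pd 1 (pd 2 G) x = g12
  generalize pd 0 (pd 1 H) x * (H x)ᴴ = h01
  generalize pd 0 (pd 2 H) x * (H x)ᴴ = h02
  generalize pd 1 (pd 2 H) x * (H x)ᴴ = h12
  generalize lform G x (ee 0) = a0
  generalize lform G x (ee 1) = a1
  generalize lform G x (ee 2) = a2
  generalize rform H x (ee 0) = b0
  generalize rform H x (ee 1) = b1
  generalize rform H x (ee 2) = b2
  simp only [← Complex.add_re, ← mul_add]
  rw [← mul_sub, ← Complex.sub_re]
  congr 2
  simp only [trace_fin_two, mul_apply, Fin.sum_univ_two, Matrix.sub_apply, Matrix.add_apply]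
  ring

end forms

/-! ### The flattening map onto the closed ball. -/

/-- A smooth function with `0 < t + e t` for `0 ≤ t` where `e t > 0` exactly for `t < 1/2`. -/
def flatDenom (t : ℝ) : ℝ := t + expNegInvGlue (1 / 2 - t)

lemma flatDenom_pos {t : ℝ} (ht : 0 ≤ t) : 0 < flatDenom t := by
  rcases ht.eq_or_lt with rfl | h
  · simpa [flatDenom] using expNegInvGlue.pos_of_pos (by norm_num : (0 : ℝ) < 2⁻¹)
  · exact add_pos_of_pos_of_nonneg h (expNegInvGlue.nonneg _)

lemma contDiff_flatDenom : ContDiff ℝ ∞ flatDenom :=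
  contDiff_id.add (expNegInvGlue.contDiff.comp (contDiff_const.sub contDiff_id))

lemma deriv_flatDenom_le (t : ℝ) : deriv flatDenom t ≤ 1 := by
  have hd : DifferentiableAt ℝ flatDenom t := contDiff_flatDenom.differentiable (by simp) t
  have h : Monotone fun s => s - flatDenom s := by
    intro s s' h
    have := expNegInvGlue.monotone (by linarith : 1 / 2 - s' ≤ 1 / 2 - s)
    simp only [flatDenom]
    linarith
  have h2 : deriv (fun s => s - flatDenom s) t = 1 - deriv flatDenom t :=
    ((hasDerivAt_id t).sub hd.hasDerivAt).deriv
  have := h.deriv_nonneg (x := t)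
  linarith

/-- The scaling factor of the flattening map. -/
def flatScale (t : ℝ) : ℝ := (Real.sqrt (flatDenom t))⁻¹

lemma flatScale_pos {t : ℝ} (ht : 0 ≤ t) : 0 < flatScale t :=
  inv_pos.2 (Real.sqrt_pos.2 (flatDenom_pos ht))

lemma contDiffAt_flatScale {t : ℝ} (ht : 0 ≤ t) : ContDiffAt ℝ ∞ flatScale t :=
  (contDiff_flatDenom.contDiffAt.sqrt (flatDenom_pos ht).ne').inv
    (Real.sqrt_pos.2 (flatDenom_pos ht)).ne'

lemma flatScale_sq {t : ℝ} (ht : 0 ≤ t) : flatScale t ^ 2 = (flatDenom t)⁻¹ := by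
  rw [flatScale, inv_pow, Real.sq_sqrt (flatDenom_pos ht).le]

/-- With t = r², this is the derivative of the radial profile r ↦ r·`flatScale` (r²). As `deriv
flatDenom` is at most 1, the numerator `flatDenom t - t * deriv flatDenom t` is at least the glue
term, which is positive for t < 1/2. -/
lemma flatScale_radial_pos {t : ℝ} (h0 : 0 ≤ t) (h1 : t < 1 / 2) :
    0 < flatScale t + 2 * t * deriv flatScale t := by
  have hk := flatScale_pos h0
  have hd := flatDenom_pos h0
  have hD : HasDerivAt flatDenom (deriv flatDenom t) t :=
    (contDiff_flatDenom.differentiable (by simp) t).hasDerivAt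
  have h : HasDerivAt flatScale
      (-(deriv flatDenom t / (2 * Real.sqrt (flatDenom t))) / Real.sqrt (flatDenom t) ^ 2) t :=
    (hD.sqrt hd.ne').inv (Real.sqrt_pos.2 hd).ne'
  rw [h.deriv, flatScale]
  set s := Real.sqrt (flatDenom t) with hs
  have hs0 : 0 < s := Real.sqrt_pos.2 hd
  have hs2 : s ^ 2 = flatDenom t := Real.sq_sqrt hd.le
  have e : s⁻¹ + 2 * t * (-(deriv flatDenom t / (2 * s)) / s ^ 2) =
      (flatDenom t - t * deriv flatDenom t) / s ^ 3 := by
    rw [← hs2]; field_simp; ring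
  rw [e]
  refine div_pos ?_ (by positivity)
  have h3 : t * deriv flatDenom t ≤ t * 1 := mul_le_mul_of_nonneg_left (deriv_flatDenom_le t) h0
  have h4 := expNegInvGlue.pos_of_pos (by linarith : (0 : ℝ) < 1 / 2 - t)
  rw [flatDenom] at *
  linarith

variable {n : ℕ}

/-- A smooth map of `ℝⁿ` onto the closed unit ball. It maps `{‖x‖² < 1/2}` diffeomorphically onto
the open unit ball and everything else to the unit sphere. -/
def flat (x : E n) : E n := flatScale (‖x‖ ^ 2) • x

/-- The open ball that `flat` maps diffeomorphically onto the open unit ball. -/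
def core (n : ℕ) : Set (E n) := {x | ‖x‖ ^ 2 < 1 / 2}

lemma isOpen_core : IsOpen (core n) := isOpen_lt (by fun_prop) (by fun_prop)

lemma contDiff_flat : ContDiff ℝ ∞ (flat : E n → E n) := by
  suffices h : ContDiff ℝ ∞ fun x : E n => flatScale (‖x‖ ^ 2) from h.smul contDiff_id
  rw [contDiff_iff_contDiffAt]
  intro x
  exact ContDiffAt.comp x (g := flatScale) (f := fun x : E n => ‖x‖ ^ 2)
    (contDiffAt_flatScale (sq_nonneg _)) (contDiff_norm_sq ℝ).contDiffAt

lemma norm_flat_sq (x : E n) : ‖flat x‖ ^ 2 = ‖x‖ ^ 2 / flatDenom (‖x‖ ^ 2) := by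
  rw [flat, norm_smul, mul_pow, Real.norm_eq_abs, sq_abs, flatScale_sq (sq_nonneg _)]
  ring

lemma norm_flat_le (x : E n) : ‖flat x‖ ≤ 1 := by
  have h := norm_flat_sq x
  have : ‖x‖ ^ 2 / flatDenom (‖x‖ ^ 2) ≤ 1 := by
    rw [div_le_one (flatDenom_pos (sq_nonneg _)), flatDenom]
    linarith [expNegInvGlue.nonneg (1 / 2 - ‖x‖ ^ 2)]
  nlinarith [norm_nonneg (flat x)]

lemma flat_mem_ball_iff {x : E n} : ‖flat x‖ < 1 ↔ x ∈ core n := by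
  rw [← sq_lt_one_iff₀ (norm_nonneg _), norm_flat_sq, div_lt_one (flatDenom_pos (sq_nonneg _)),
    flatDenom]
  constructor
  · intro h
    by_contra h'
    rw [expNegInvGlue.zero_of_nonpos (by simp only [core, Set.mem_ofPred_eq] at h'; linarith)] at h
    linarith
  · intro h
    have := expNegInvGlue.pos_of_pos (sub_pos.2 h)
    linarith

lemma norm_flat_eq_one {x : E n} (hx : x ∉ core n) : ‖flat x‖ = 1 :=
  le_antisymm (norm_flat_le x) (not_lt.1 fun h => hx (flat_mem_ball_iff.1 h))

lemma flatRatio_strictMonoOn : StrictMonoOn (fun t => t / flatDenom t) (Set.Ico 0 (1 / 2)) := by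
  intro s hs t ht h
  have h1 := flatDenom_pos hs.1
  have h2 := flatDenom_pos ht.1
  simp only
  rw [div_lt_div_iff₀ h1 h2, flatDenom, flatDenom]
  have h3 := expNegInvGlue.monotone (by linarith : 1 / 2 - t ≤ 1 / 2 - s)
  have h4 := expNegInvGlue.pos_of_pos (by linarith [hs.2] : (0 : ℝ) < 1 / 2 - s)
  have := mul_le_mul_of_nonneg_left h3 hs.1
  nlinarith

lemma injOn_flat : Set.InjOn (flat : E n → E n) (core n) := by
  intro x hx y hy h
  have h1 : ‖x‖ ^ 2 = ‖y‖ ^ 2 := by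
    refine flatRatio_strictMonoOn.injOn ⟨sq_nonneg _, hx⟩ ⟨sq_nonneg _, hy⟩ ?_
    rw [← norm_flat_sq, ← norm_flat_sq, h]
  rw [flat, flat, h1] at h
  exact smul_right_injective _ (flatScale_pos (sq_nonneg _)).ne' h

lemma image_flat : flat '' core n = Metric.ball (0 : E n) 1 := by
  ext y
  rw [mem_ball_zero_iff]
  constructor
  · rintro ⟨x, hx, rfl⟩
    exact flat_mem_ball_iff.2 hx
  · intro hy
    have hc : ContinuousOn (fun t => t / flatDenom t) (Set.Icc 0 (1 / 2)) :=
      continuousOn_id.div contDiff_flatDenom.continuous.continuousOn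
        fun t ht => (flatDenom_pos ht.1).ne'
    have h1 : ‖y‖ ^ 2 < 1 := (sq_lt_one_iff₀ (norm_nonneg _)).2 hy
    have h2 : flatDenom (1 / 2) = 1 / 2 := by simp [flatDenom]
    have := intermediate_value_Icc (by norm_num) hc (show ‖y‖ ^ 2 ∈ _ by
      simp only [h2, zero_div]; exact ⟨sq_nonneg _, by norm_num; linarith⟩)
    obtain ⟨t, ht, hty⟩ := this
    have hk := flatScale_pos ht.1
    have hx : ‖(flatScale t)⁻¹ • y‖ ^ 2 = t := by
      rw [norm_smul, mul_pow, ← hty, Real.norm_eq_abs, sq_abs, inv_pow, flatScale_sq ht.1, inv_inv,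
        mul_div_cancel₀ _ (flatDenom_pos ht.1).ne']
    have hf : flat ((flatScale t)⁻¹ • y) = y := by
      rw [flat, hx, smul_smul, mul_inv_cancel₀ hk.ne', one_smul]
    exact ⟨_, flat_mem_ball_iff.1 (by rw [hf]; exact hy), hf⟩

/-- The derivative of `flat`. -/
def flatDeriv (x : E n) : E n →L[ℝ] E n :=
  flatScale (‖x‖ ^ 2) • ContinuousLinearMap.id ℝ (E n) +
    ((deriv flatScale (‖x‖ ^ 2) * 2) • innerSL ℝ x).smulRight x

lemma hasFDerivAt_flat (x : E n) : HasFDerivAt flat (flatDeriv x) x := by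
  have h1 : HasFDerivAt (fun y : E n => ‖y‖ ^ 2) (2 • innerSL ℝ x) x :=
    (hasStrictFDerivAt_norm_sq x).hasFDerivAt
  have h2 : HasDerivAt flatScale (deriv flatScale (‖x‖ ^ 2)) (‖x‖ ^ 2) :=
    ((contDiffAt_flatScale (sq_nonneg _)).differentiableAt (by simp)).hasDerivAt
  have h3 := (h2.comp_hasFDerivAt x h1).smul (hasFDerivAt_id x)
  refine h3.congr_fderiv ?_
  ext v
  simp [flatDeriv, mul_assoc, two_mul]

lemma det_eq_toLin (A : E n →L[ℝ] E n) :
    A.det = Matrix.det (Matrix.of fun i j => A (ee j) i) := by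
  rw [ContinuousLinearMap.det, ← LinearMap.det_toMatrix (EuclideanSpace.basisFun (Fin n) ℝ).toBasis]
  congr 1
  ext i j
  simp [LinearMap.toMatrix_apply]

lemma det_flatDeriv_two {x : E 2} (hx : x ∈ core 2) : 0 < (flatDeriv x).det := by
  have h1 := flatScale_pos (sq_nonneg ‖x‖)
  -- The derivative k·id + 2k′ x⊗x has eigenvalue k across the ray and k + 2‖x‖²k′ along it; in
  -- dimension three k occurs twice.
  have h2 := mul_pos h1 (flatScale_radial_pos (sq_nonneg ‖x‖) hx)
  refine h2.trans_eq ?_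
  rw [det_eq_toLin, Matrix.det_fin_two]
  simp only [flatDeriv]
  generalize flatScale (‖x‖ ^ 2) = k
  generalize deriv flatScale (‖x‖ ^ 2) = k'
  rw [EuclideanSpace.norm_sq_eq]
  simp [Fin.sum_univ_two, EuclideanSpace.inner_single_right]
  ring

lemma det_flatDeriv_three {x : E 3} (hx : x ∈ core 3) : 0 < (flatDeriv x).det := by
  have h1 := flatScale_pos (sq_nonneg ‖x‖)
  have h2 := mul_pos (pow_pos h1 2) (flatScale_radial_pos (sq_nonneg ‖x‖) hx)
  refine h2.trans_eq ?_
  rw [det_eq_toLin, Matrix.det_fin_three]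
  simp only [flatDeriv]
  generalize flatScale (‖x‖ ^ 2) = k
  generalize deriv flatScale (‖x‖ ^ 2) = k'
  rw [EuclideanSpace.norm_sq_eq]
  simp [Fin.sum_univ_three, EuclideanSpace.inner_single_right]
  ring

/-- A smooth extension `F` of `g` is SU(2)-valued only on the ball; since `flat` takes values in the
ball, the composite is SU(2)-valued everywhere. -/
lemma isGauge_comp_flat {g : Ball n → SU2} {F : E n → M} (hF : ContDiff ℝ ∞ F)
    (hg : ∀ x : Ball n, F x = (g x : M)) : IsGauge fun x => F (flat x) :=
  ⟨hF.comp contDiff_flat, fun x => by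
    rw [hg ⟨flat x, by simpa using norm_flat_le x⟩]; exact (g _).2⟩

lemma setIntegral_wz_flat {F : E 3 → M} (hF : Differentiable ℝ F) :
    ∫ x in Metric.ball (0 : E 3) 1, wz F x = ∫ x in core 3, wz (fun y => F (flat y)) x := by
  rw [← image_flat]
  exact setIntegral_wz_image isOpen_core (fun x _ => hasFDerivAt_flat x) injOn_flat
    (fun x hx => det_flatDeriv_three hx) hF fun x _ => rfl

lemma setIntegral_pairing_flat {F K : E 2 → M} (hF : Differentiable ℝ F) (hK : Differentiable ℝ K) :
    ∫ x in Metric.ball (0 : E 2) 1, pairing F K x =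
      ∫ x in core 2, pairing (fun y => F (flat y)) (fun y => K (flat y)) x := by
  rw [← image_flat]
  exact setIntegral_pairing_image isOpen_core (fun x _ => hasFDerivAt_flat x) injOn_flat
    (fun x hx => det_flatDeriv_two hx) hF hK (fun x _ => rfl) fun x _ => rfl

/-! ### SU(2) as the unit quaternions. -/

/-- The matrix of the quaternion `a + b i + c j + d k`. -/
def qm (a b c d : ℝ) : M := !![⟨a, b⟩, ⟨-c, d⟩; ⟨c, d⟩, ⟨a, -b⟩]

/-- A matrix is quaternionic if it is of the form `qm a b c d`. -/
def IsQuat (A : M) : Prop := A 0 1 = -star (A 1 0) ∧ A 1 1 = star (A 0 0)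

lemma isQuat_qm (a b c d : ℝ) : IsQuat (qm a b c d) := by
  constructor <;> apply Complex.ext <;> simp [qm]

lemma IsQuat.eq_qm {A : M} (h : IsQuat A) :
    A = qm (A 0 0).re (A 0 0).im (A 1 0).re (A 1 0).im := by
  ext i j
  fin_cases i <;> fin_cases j
  · simp [qm]
  · simp only [Fin.zero_eta, Fin.mk_one, h.1]; apply Complex.ext <;> simp [qm]
  · simp [qm]
  · simp only [Fin.mk_one, h.2]; apply Complex.ext <;> simp [qm]

/-- For a unitary matrix of determinant 1 the adjoint and the adjugate are both the inverse;
comparing entries gives the quaternionic form. -/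
lemma isQuat_of_mem {A : M} (h : A ∈ specialUnitaryGroup (Fin 2) ℂ) : IsQuat A := by
  have h1 : Aᴴ * A = 1 := h.1.1
  have h2 : A.det = 1 := h.2
  have h3 : Aᴴ = A.adjugate := by
    calc Aᴴ = Aᴴ * (A * A.adjugate) := by rw [mul_adjugate, h2]; simp
      _ = A.adjugate := by rw [← Matrix.mul_assoc, h1, Matrix.one_mul]
  have e1 := congrFun (congrFun h3 0) 1
  have e2 := congrFun (congrFun h3 0) 0
  rw [adjugate_fin_two] at e1 e2
  simp only [conjTranspose_apply, of_apply, cons_val_zero, cons_val_one, cons_val_fin_one] at e1 e2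
  exact ⟨by rw [e1, neg_neg], e2.symm⟩

lemma qm_mem_iff {a b c d : ℝ} :
    qm a b c d ∈ specialUnitaryGroup (Fin 2) ℂ ↔ a ^ 2 + b ^ 2 + c ^ 2 + d ^ 2 = 1 := by
  have hdet : (qm a b c d).det = ((a ^ 2 + b ^ 2 + c ^ 2 + d ^ 2 : ℝ) : ℂ) := by
    rw [det_fin_two]
    apply Complex.ext
    · simp only [Complex.ofReal_re]; simp [qm]; ring
    · simp only [Complex.ofReal_im]; simp [qm]; ring
  have hadj : (qm a b c d)ᴴ = (qm a b c d).adjugate := by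
    rw [adjugate_fin_two]
    ext i j
    fin_cases i <;> fin_cases j <;> apply Complex.ext <;> simp [qm]
  constructor
  · intro h
    have := h.2
    rw [SetLike.mem_coe, MonoidHom.mem_mker, coe_detMonoidHom, hdet] at this
    exact_mod_cast this
  · intro h
    have h2 : (qm a b c d).det = 1 := by rw [hdet, h]; simp
    refine ⟨⟨?_, ?_⟩, h2⟩
    · rw [star_eq_conjTranspose, hadj, adjugate_mul, h2, one_smul]
    · rw [star_eq_conjTranspose, hadj, mul_adjugate, h2, one_smul]

lemma conjTranspose_qm (a b c d : ℝ) : (qm a b c d)ᴴ = qm a (-b) (-c) (-d) := by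
  ext i j
  fin_cases i <;> fin_cases j <;> apply Complex.ext <;> simp [qm]

lemma qm_mul (a b c d a' b' c' d' : ℝ) : qm a b c d * qm a' b' c' d' =
    qm (a * a' - b * b' - c * c' - d * d') (a * b' + b * a' - c * d' + d * c')
      (a * c' + b * d' + c * a' - d * b') (a * d' - b * c' + c * b' + d * a') := by
  ext i j
  fin_cases i <;> fin_cases j <;> apply Complex.ext <;>
    simp [qm, mul_apply, Fin.sum_univ_two] <;> ring

lemma triple_qm (p q r p' q' r' p'' q'' r'' : ℝ) :
    triple (qm 0 p q r) (qm 0 p' q' r') (qm 0 p'' q'' r'') =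
      4 * det !![p, q, r; p', q', r'; p'', q'', r''] := by
  simp [triple, trace_fin_two, qm, det_fin_three]
  ring

/-- `su(2)`, in terms of quaternions. -/
def IsSu (A : M) : Prop := ∃ p q r : ℝ, A = qm 0 p q r

/-- Cramer's rule: su(2) is three-dimensional and `triple` is a multiple of its determinant form. -/
lemma IsSu.cramer {X A B C : M} (hX : IsSu X) (hA : IsSu A) (hB : IsSu B) (hC : IsSu C) :
    triple X B C • A + triple X C A • B + triple X A B • C = triple A B C • X := by
  obtain ⟨p, q, r, rfl⟩ := hX
  obtain ⟨p0, q0, r0, rfl⟩ := hA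
  obtain ⟨p1, q1, r1, rfl⟩ := hB
  obtain ⟨p2, q2, r2, rfl⟩ := hC
  simp only [triple_qm, det_fin_three]
  ext i j
  fin_cases i <;> fin_cases j <;> apply Complex.ext <;> simp [qm] <;> ring

/-- The entries that define quaternionic matrices, as a real linear map. -/
def quatDefect : M →L[ℝ] ℂ × ℂ :=
  LinearMap.toContinuousLinearMap
    { toFun := fun A => (A 0 1 + star (A 1 0), A 1 1 - star (A 0 0))
      map_add' := fun A B => by ext1 <;> simp <;> ring
      map_smul' := fun c A => by ext1 <;> simp [mul_sub] }

lemma isQuat_iff {A : M} : IsQuat A ↔ quatDefect A = 0 := by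
  change _ ↔ (A 0 1 + star (A 1 0), A 1 1 - star (A 0 0)) = (0 : ℂ × ℂ)
  rw [Prod.mk_eq_zero, sub_eq_zero, ← eq_neg_iff_add_eq_zero]
  rfl

variable {n : ℕ}

/-- The quaternionic matrices are the kernel of the real linear map `quatDefect`, so they contain
the derivatives of quaternion-valued maps. -/
lemma isQuat_fderiv {G : E n → M} (hd : Differentiable ℝ G) (hG : ∀ x, IsQuat (G x)) (x v : E n) :
    IsQuat (fderiv ℝ G x v) := by
  rw [isQuat_iff]
  have h := quatDefect.hasFDerivAt.comp x (hd x).hasFDerivAt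
  have h0 : quatDefect ∘ G = fun _ => 0 := funext fun y => isQuat_iff.1 (hG y)
  rw [h0] at h
  exact congrArg (fun L => L v) (h.unique (hasFDerivAt_const 0 x))

lemma IsQuat.mul {A B : M} (hA : IsQuat A) (hB : IsQuat B) : IsQuat (A * B) := by
  rw [hA.eq_qm, hB.eq_qm, qm_mul]
  exact isQuat_qm _ _ _ _

lemma IsQuat.conjTranspose {A : M} (hA : IsQuat A) : IsQuat Aᴴ := by
  rw [hA.eq_qm, conjTranspose_qm]
  exact isQuat_qm _ _ _ _

lemma IsQuat.isSu {A : M} (hA : IsQuat A) (h : Aᴴ = -A) : IsSu A := by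
  have h0 := congrArg Complex.re (congrFun (congrFun h 0) 0)
  simp at h0
  have h1 : (A 0 0).re = 0 := by linarith
  exact ⟨_, _, _, by rw [← h1]; exact hA.eq_qm⟩

lemma IsGauge.isQuat {G : E n → M} (hG : IsGauge G) (x : E n) : IsQuat (G x) :=
  isQuat_of_mem (hG.mem x)

lemma IsGauge.isSu_lform {G : E n → M} (hG : IsGauge G) (i : Fin n) (x : E n) :
    IsSu (lform G x (ee i)) := by
  refine IsQuat.isSu ((hG.isQuat x).conjTranspose.mul
    (isQuat_fderiv hG.differentiable hG.isQuat x _)) ?_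
  have h : lform G x (ee i) = (G x)ᴴ * pd i G x := rfl
  rw [h, conjTranspose_mul, conjTranspose_conjTranspose, hG.conjTranspose_pd, Matrix.neg_mul,
    Matrix.mul_assoc, hG.conjTranspose_mul_self, Matrix.mul_one]

lemma IsGauge.pd_eq {G : E n → M} (hG : IsGauge G) (i : Fin n) (x : E n) :
    pd i G x = G x * lform G x (ee i) := by
  change _ = G x * ((G x)ᴴ * pd i G x)
  rw [← Matrix.mul_assoc, hG.mul_conjTranspose_self, Matrix.one_mul]

/-! ### Translation invariance of integration against tr (H⁻¹dH)³. -/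

lemma hasCompactSupport_pd_const {V : Type*} [NormedAddCommGroup V] [NormedSpace ℝ V] {F : E n → V}
    (h : HasCompactSupport (fderiv ℝ F)) (i : Fin n) : HasCompactSupport (pd i F) :=
  h.mono fun x hx => by
    simp only [Function.mem_support, pd] at hx ⊢
    exact fun h => hx (by rw [h]; rfl)

lemma hasCompactSupport_lform {G : E n → M} (h : HasCompactSupport (fderiv ℝ G)) (i : Fin n) :
    HasCompactSupport fun x => lform G x (ee i) :=
  (hasCompactSupport_pd_const h i).mul_left (f := fun x => (G x)ᴴ)

lemma continuous_wz {G : E 3 → M} (hG : IsGauge G) : Continuous (wz G) := by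
  have : wz G = fun x => 3 * reTraceCLM (lform G x (ee 0) *
      (lform G x (ee 1) * lform G x (ee 2) - lform G x (ee 2) * lform G x (ee 1))) :=
    funext fun x => wz_eq_triple G x
  rw [this]
  have h := fun i => (hG.contDiff_lform i).continuous
  exact continuous_const.mul (reTraceCLM.continuous.comp
    ((h 0).mul (((h 1).mul (h 2)).sub ((h 2).mul (h 1)))))

lemma hasCompactSupport_wz {G : E 3 → M} (h : HasCompactSupport (fderiv ℝ G)) :
    HasCompactSupport (wz G) :=
  (hasCompactSupport_lform h 0).mono fun x hx => by
    simp only [Function.mem_support] at hx ⊢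
    intro h
    apply hx
    rw [wz_eq_triple, h, triple]
    simp

lemma wz_mul_const {G : E 3 → M} (hG : IsGauge G) {A : M}
    (hA : A ∈ specialUnitaryGroup (Fin 2) ℂ) (x : E 3) : wz (fun y => G y * A) x = wz G x := by
  have hc : IsGauge fun _ : E 3 => A := ⟨contDiff_const, fun _ => hA⟩
  rw [wz_eq_triple, wz_eq_triple]
  have hr : ∀ i, rform (fun _ : E 3 => A) x (ee i) = 0 := fun i => by simp [rform]
  simp only [hG.lform_mul hc, hr, add_zero]
  rw [triple_conj (hc.mul_conjTranspose_self x)]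

/-- The integral of a derivative along a left-invariant vector field against `tr (H⁻¹dH)³`
vanishes. -/
lemma integral_invariant_deriv_mul_wz {H : E 3 → M} (hH : IsGauge H)
    (hc : HasCompactSupport (fderiv ℝ H)) {F : M → ℝ} (hF : ContDiff ℝ ∞ F) {X : M} (hX : IsSu X) :
    ∫ x, fderiv ℝ F (H x) (H x * X) * wz H x = 0 := by
  let a := fun (i : Fin 3) (x : E 3) => lform H x (ee i)
  have ha : ∀ i, ContDiff ℝ ∞ (a i) := hH.contDiff_lform
  -- γ is the pullback by `H` of the left-invariant 1-form dual to `X`, and β below holds the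
  -- coefficients of dγ.
  let γ := fun (i : Fin 3) (x : E 3) => (trace (X * a i x)).re
  have hγ : ∀ i, ContDiff ℝ ∞ (γ i) := fun i => reTraceCLM.contDiff.comp (contDiff_const.mul (ha i))
  let Φ := fun x => F (H x)
  have hΦ : ContDiff ℝ ∞ Φ := hF.comp hH.smooth
  let β := fun (i j : Fin 3) (x : E 3) => pd i (γ j) x - pd j (γ i) x
  have hβ : ∀ i j, ContDiff ℝ ∞ (β i j) := fun i j => (contDiff_pd (hγ j) i).sub (contDiff_pd (hγ i) j)
  have hγc : ∀ i, HasCompactSupport (γ i) := fun i =>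
    (hasCompactSupport_lform hc i).mono fun x hx => by
      simp only [Function.mem_support, γ, a] at hx ⊢
      exact fun h => hx (by rw [h, Matrix.mul_zero, trace_zero, Complex.zero_re])
  have hβc : ∀ i j, HasCompactSupport (β i j) := fun i j =>
    (hasCompactSupport_pd_const ((hγc j).fderiv (𝕜 := ℝ)) i).sub
      (hasCompactSupport_pd_const ((hγc i).fderiv (𝕜 := ℝ)) j)
  have hpdγ : ∀ i j x, pd i (γ j) x = (trace (X * pd i (a j) x)).re := by
    intro i j x
    have hd : DifferentiableAt ℝ (a j) x := (ha j).differentiable (by simp) x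
    rw [pd_reTrace ((differentiableAt_const X).fun_mul hd),
      pd_mul (A := fun _ => X) (differentiableAt_const X) hd]
    simp [pd]
  -- Maurer–Cartan: dγ is, up to sign, the contraction of the invariant volume form with X.
  have htr : ∀ i j x, triple X (a i x) (a j x) = - β i j x := by
    intro i j x
    simp only [β, hpdγ, a, hH.pd_lform]
    rw [pd_comm hH.smooth j i, ← Complex.sub_re, ← trace_sub, ← Complex.neg_re, ← trace_neg, triple]
    congr 2
    noncomm_ring
  have hpdΦ : ∀ i x, pd i Φ x = fderiv ℝ F (H x) (H x * a i x) := by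
    intro i x
    have h1 : DifferentiableAt ℝ F (H x) := hF.differentiable (by simp) _
    have := (h1.hasFDerivAt.comp x (hH.differentiable x).hasFDerivAt).fderiv
    rw [← hH.pd_eq i x]
    exact congrArg (fun L => L (ee i)) this
  -- By Cramer's rule the derivative of Φ along X times the volume form is a multiple of dΦ ∧ dγ =
  -- d(Φ dγ), an exact form. Φ itself need not have compact support, since dγ does.
  have key : ∀ x, fderiv ℝ F (H x) (H x * X) * wz H x =
      -3 * (pd 0 (fun y => Φ y * β 1 2 y) x + pd 1 (fun y => Φ y * β 2 0 y) x +
        pd 2 (fun y => Φ y * β 0 1 y) x) := by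
    intro x
    have dΦ : DifferentiableAt ℝ Φ x := hΦ.differentiable (by simp) x
    have hmul : ∀ i j k, pd i (fun y => Φ y * β j k y) x =
        pd i Φ x * β j k x + Φ x * (pd i (pd j (γ k)) x - pd i (pd k (γ j)) x) := by
      intro i j k
      have dβ : DifferentiableAt ℝ (β j k) x := (hβ j k).differentiable (by simp) x
      rw [← pd_sub ((contDiff_pd (hγ k) j).differentiable (by simp) x)
        ((contDiff_pd (hγ j) k).differentiable (by simp) x), pd, fderiv_fun_mul dΦ dβ]
      change Φ x * pd i (β j k) x + β j k x * pd i Φ x = pd i Φ x * β j k x + Φ x * pd i (β j k) x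
      ring
    have hcr := congrArg (fun A => fderiv ℝ F (H x) (H x * A))
      (hX.cramer (hH.isSu_lform 0 x) (hH.isSu_lform 1 x) (hH.isSu_lform 2 x))
    simp only [mul_add, mul_smul_comm, map_add, map_smul, smul_eq_mul] at hcr
    rw [wz_eq_triple, hmul, hmul, hmul, pd_comm (hγ 0) 2 1, pd_comm (hγ 1) 2 0, pd_comm (hγ 2) 1 0,
      hpdΦ, hpdΦ, hpdΦ]
    have e1 := htr 1 2 x
    have e2 := htr 2 0 x
    have e3 := htr 0 1 x
    simp only [a] at e1 e2 e3 ⊢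
    rw [e1, e2, e3] at hcr
    linear_combination -3 * hcr
  simp only [key]
  have hi : ∀ i j k, Integrable (pd i fun y => Φ y * β j k y) := fun i j k =>
    (contDiff_pd (hΦ.mul (hβ j k)) i).continuous.integrable_of_hasCompactSupport
      (hasCompactSupport_pd_const (((hβc j k).mul_left (f := Φ)).fderiv (𝕜 := ℝ)) i)
  have hz : ∀ i j k, ∫ x, pd i (fun y => Φ y * β j k y) x = 0 := fun i j k =>
    integral_pd_eq_zero ((hΦ.mul (hβ j k)).of_le (by simp)) ((hβc j k).mul_left (f := Φ)) i
  rw [integral_const_mul, integral_add ((hi 0 1 2).fun_add (hi 1 2 0)) (hi 2 0 1),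
    integral_add (hi 0 1 2) (hi 1 2 0), hz, hz, hz]
  simp

lemma smul_one_add_smul_qm (u v p q r : ℝ) :
    u • (1 : M) + v • qm 0 p q r = qm u (v * p) (v * q) (v * r) := by
  ext i j
  fin_cases i <;> fin_cases j <;> apply Complex.ext <;> simp [qm]

/-- A unit quaternion is cos θ plus sin θ times a unit imaginary quaternion; this puts it on a
one-parameter subgroup. -/
lemma exists_rotation {A : M} (hA : A ∈ specialUnitaryGroup (Fin 2) ℂ) :
    ∃ θ p q r : ℝ, p ^ 2 + q ^ 2 + r ^ 2 = 1 ∧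
      A = Real.cos θ • (1 : M) + Real.sin θ • qm 0 p q r := by
  have hq := (isQuat_of_mem hA).eq_qm
  obtain ⟨a, b, c, d, rfl⟩ : ∃ a b c d, A = qm a b c d := ⟨_, _, _, _, hq⟩
  have h := qm_mem_iff.1 hA
  have ha : a ^ 2 ≤ 1 := by nlinarith [sq_nonneg b, sq_nonneg c, sq_nonneg d]
  have ha' := abs_le.1 (abs_le_one_iff_mul_self_le_one.2 (by nlinarith : a * a ≤ 1))
  have hcos : Real.cos (Real.arccos a) = a := Real.cos_arccos ha'.1 ha'.2
  have hsin : Real.sin (Real.arccos a) ^ 2 = b ^ 2 + c ^ 2 + d ^ 2 := by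
    have := Real.sin_sq_add_cos_sq (Real.arccos a)
    rw [hcos] at this
    linarith
  set s := Real.sin (Real.arccos a) with hs
  have hmat : ∀ p q r : ℝ, s * p = b → s * q = c → s * r = d →
      qm a b c d = Real.cos (Real.arccos a) • (1 : M) + s • qm 0 p q r := by
    rintro p q r rfl rfl rfl
    rw [hcos, smul_one_add_smul_qm]
  rcases eq_or_ne s 0 with h0 | h0
  · rw [h0] at hsin
    have hb : b = 0 := by nlinarith [sq_nonneg b, sq_nonneg c, sq_nonneg d]
    have hc : c = 0 := by nlinarith [sq_nonneg b, sq_nonneg c, sq_nonneg d]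
    have hd : d = 0 := by nlinarith [sq_nonneg b, sq_nonneg c, sq_nonneg d]
    -- The matrix is ±1 here, and any axis serves.
    exact ⟨Real.arccos a, 1, 0, 0, by norm_num, hmat 1 0 0 (by rw [h0, hb]; ring)
      (by rw [hc]; ring) (by rw [hd]; ring)⟩
  · refine ⟨Real.arccos a, b / s, c / s, d / s, ?_, hmat _ _ _ (mul_div_cancel₀ _ h0)
      (mul_div_cancel₀ _ h0) (mul_div_cancel₀ _ h0)⟩
    rw [div_pow, div_pow, div_pow, ← add_div, ← add_div, ← hsin, div_self (pow_ne_zero 2 h0)]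

lemma integral_intervalIntegral_swap_of_compact {X : Type*} [TopologicalSpace X] [MeasurableSpace X]
    [OpensMeasurableSpace X] [T2Space X] [SecondCountableTopology X] {μ : Measure X} [SFinite μ]
    [IsFiniteMeasureOnCompacts μ]
    {g : X → ℝ → ℝ} (hg : Continuous (Function.uncurry g)) {w : X → ℝ} (hw : Continuous w)
    (hc : HasCompactSupport w) :
    ∫ x, (∫ s in (0 : ℝ)..1, g x s) * w x ∂μ = ∫ s in (0 : ℝ)..1, ∫ x, g x s * w x ∂μ := by
  have hInt : Integrable (Function.uncurry fun x s => g x s * w x)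
      (μ.prod (volume.restrict (Set.Ioc (0 : ℝ) 1))) := by
    have hcont : Continuous (Function.uncurry fun x s => g x s * w x) :=
      hg.mul (hw.comp continuous_fst)
    have h1 : IntegrableOn (Function.uncurry fun x s => g x s * w x)
        (tsupport w ×ˢ Set.Icc (0 : ℝ) 1) (μ.prod volume) :=
      hcont.continuousOn.integrableOn_compact (hc.isCompact.prod isCompact_Icc)
    have h2 : IntegrableOn (Function.uncurry fun x s => g x s * w x)
        (Set.univ ×ˢ Set.Ioc (0 : ℝ) 1) (μ.prod volume) := by
      refine (h1.mono_set (Set.prod_mono_right Set.Ioc_subset_Icc_self)).of_forall_sdiff_eq_zero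
        (MeasurableSet.univ.prod measurableSet_Ioc) ?_
      rintro ⟨x, s⟩ ⟨⟨-, hs⟩, hx⟩
      have : x ∉ tsupport w := fun h => hx ⟨h, hs⟩
      simp [Function.uncurry, image_eq_zero_of_notMem_tsupport this]
    rwa [IntegrableOn, ← Measure.prod_restrict, Measure.restrict_univ] at h2
  simp only [intervalIntegral.integral_of_le zero_le_one]
  rw [← integral_integral_swap hInt]
  simp only [integral_mul_const]

/-- Right translations do not change the integral against `tr (H⁻¹dH)³`. -/
lemma integral_comp_mul_const_mul_wz {H : E 3 → M} (hH : IsGauge H)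
    (hc : HasCompactSupport (fderiv ℝ H)) {F : M → ℝ} (hF : ContDiff ℝ ∞ F) {A : M}
    (hA : A ∈ specialUnitaryGroup (Fin 2) ℂ) :
    ∫ x, F (H x * A) * wz H x = ∫ x, F (H x) * wz H x := by
  obtain ⟨θ, p, q, r, hpqr, rfl⟩ := exists_rotation hA
  set N := qm 0 p q r with hN
  have hNN : N * N = -1 := by
    rw [hN, qm_mul]
    have : (1 : M) = qm 1 0 0 0 := by
      ext i j; fin_cases i <;> fin_cases j <;> apply Complex.ext <;> simp [qm]
    rw [this]
    ext i j
    fin_cases i <;> fin_cases j <;> apply Complex.ext <;> simp [qm] <;> nlinarith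
  -- As N² = −1, this is the one-parameter subgroup s ↦ exp(sθN), which joins 1 to the given
  -- element.
  let P : ℝ → M := fun s => Real.cos (s * θ) • (1 : M) + Real.sin (s * θ) • N
  have hP : ∀ s, P s ∈ specialUnitaryGroup (Fin 2) ℂ := by
    intro s
    have : P s = qm (Real.cos (s * θ)) (Real.sin (s * θ) * p) (Real.sin (s * θ) * q)
        (Real.sin (s * θ) * r) := smul_one_add_smul_qm _ _ _ _ _
    rw [this, qm_mem_iff]
    linear_combination Real.sin (s * θ) ^ 2 * hpqr + Real.sin_sq_add_cos_sq (s * θ)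
  have hPd : ∀ s, HasDerivAt P (P s * (θ • N)) s := by
    intro s
    have hm : HasDerivAt (fun s : ℝ => s * θ) θ s := by simpa using (hasDerivAt_id s).mul_const θ
    have h1 := ((Real.hasDerivAt_cos (s * θ)).comp s hm).smul_const (1 : M)
    have h2 := ((Real.hasDerivAt_sin (s * θ)).comp s hm).smul_const N
    refine (h1.add h2).congr_deriv ?_
    simp only [P, add_mul, smul_mul_assoc, mul_smul_comm, one_mul, hNN, smul_neg]
    module
  have hPc : Continuous P := continuous_iff_continuousAt.2 fun s => (hPd s).continuousAt
  have hX : IsSu (θ • N) := ⟨θ * p, θ * q, θ * r, by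
    ext i j
    fin_cases i <;> fin_cases j <;> apply Complex.ext <;> simp [hN, qm]⟩
  let g : E 3 → ℝ → ℝ := fun x s => fderiv ℝ F (H x * P s) (H x * P s * (θ • N))
  have hHP : Continuous fun z : E 3 × ℝ => H z.1 * P z.2 :=
    (hH.smooth.continuous.comp continuous_fst).mul (hPc.comp continuous_snd)
  have hg : Continuous (Function.uncurry g) :=
    ((hF.continuous_fderiv (by simp)).comp hHP).clm_apply (hHP.mul continuous_const)
  have hftc : ∀ x, ∫ s in (0 : ℝ)..1, g x s = F (H x * P 1) - F (H x * P 0) := by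
    intro x
    refine intervalIntegral.integral_eq_sub_of_hasDerivAt (f := fun s => F (H x * P s))
      (fun s _ => ?_) ?_
    · have h1 : DifferentiableAt ℝ F (H x * P s) := hF.differentiable (by simp) _
      have h2 : HasDerivAt (fun s => H x * P s) (H x * P s * (θ • N)) s := by
        rw [mul_assoc]
        exact (hPd s).const_mul (H x)
      exact h1.hasFDerivAt.comp_hasDerivAt s h2
    · exact (hg.comp (Continuous.prodMk_right x)).intervalIntegrable _ _
  have hwc := continuous_wz hH
  have hws := hasCompactSupport_wz hc
  have hswap := integral_intervalIntegral_swap_of_compact (μ := (volume : Measure (E 3))) hg hwc hws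
  -- The s-derivative of the integral of F(H P_s) is an integral of the kind that vanishes for the
  -- map H P_s, whose 3-form equals that of H.
  have hzero : ∀ s, ∫ x, g x s * wz H x = 0 := by
    intro s
    have hc' : HasCompactSupport (fderiv ℝ fun x => H x * P s) := by
      refine hc.mono fun x hx => ?_
      simp only [Function.mem_support] at hx ⊢
      intro h
      apply hx
      have hd : HasFDerivAt H 0 x := h ▸ (hH.differentiable x).hasFDerivAt
      exact (hd.mul_const' (P s)).fderiv.trans
        (ContinuousLinearMap.ext fun v => Matrix.zero_mul (P s))
    have := integral_invariant_deriv_mul_wz (hH.mul ⟨contDiff_const, fun _ => hP s⟩) hc' hF hX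
    simpa only [wz_mul_const hH (hP s)] using this
  simp only [hftc, hzero, intervalIntegral.integral_zero] at hswap
  have hInt : ∀ s, Integrable fun x => F (H x * P s) * wz H x := fun s =>
    ((hF.continuous.comp (hH.smooth.continuous.mul continuous_const)).mul
      hwc).integrable_of_hasCompactSupport hws.mul_left
  simp only [sub_mul] at hswap
  rw [integral_sub (hInt 1) (hInt 0), sub_eq_zero] at hswap
  have h1 : P 1 = Real.cos θ • (1 : M) + Real.sin θ • N := by simp [P]
  have h0 : P 0 = 1 := by simp [P]
  rw [h1, h0] at hswap
  simpa using hswap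

lemma hasCompactSupport_fderiv_conjTranspose {n : ℕ} {H : E n → M} (hH : IsGauge H)
    (hc : HasCompactSupport (fderiv ℝ H)) : HasCompactSupport (fderiv ℝ fun x => (H x)ᴴ) := by
  refine hc.mono fun x hx => ?_
  simp only [Function.mem_support] at hx ⊢
  intro h
  apply hx
  have hd : HasFDerivAt H 0 x := h ▸ (hH.differentiable x).hasFDerivAt
  have := (conjTransposeCLM.hasFDerivAt.comp x hd).fderiv
  exact this.trans (ContinuousLinearMap.ext fun v => map_zero conjTransposeCLM)

/-- Left translations do not change the integral against `tr (H⁻¹dH)³`. -/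
lemma integral_comp_const_mul_mul_wz {H : E 3 → M} (hH : IsGauge H)
    (hc : HasCompactSupport (fderiv ℝ H)) {F : M → ℝ} (hF : ContDiff ℝ ∞ F) {A : M}
    (hA : A ∈ specialUnitaryGroup (Fin 2) ℂ) :
    ∫ x, F (A * H x) * wz H x = ∫ x, F (H x) * wz H x := by
  -- Taking adjoints exchanges left and right translations and changes only the sign of the 3-form.
  have := integral_comp_mul_const_mul_wz hH.conjTranspose
    (hasCompactSupport_fderiv_conjTranspose hH hc) (hF.comp contDiff_conjTranspose)
    (conjTranspose_mem hA)
  simp only [hH.wz_conjTranspose, Function.comp_apply, conjTranspose_mul,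
    conjTranspose_conjTranspose, mul_neg, integral_neg, neg_inj] at this
  exact this

/-- The integrals against `tr (H⁻¹dH)³` and `tr (K⁻¹dK)³` are proportional. -/
lemma integral_mul_wz_proportional {H K : E 3 → M} (hH : IsGauge H) (hK : IsGauge K)
    (hHc : HasCompactSupport (fderiv ℝ H)) (hKc : HasCompactSupport (fderiv ℝ K)) {F : M → ℝ}
    (hF : ContDiff ℝ ∞ F) :
    (∫ x, F (H x) * wz H x) * ∫ x, wz K x = (∫ x, F (K x) * wz K x) * ∫ x, wz H x := by
  have hHw := continuous_wz hH
  have hKw := continuous_wz hK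
  have hcont : Continuous (Function.uncurry fun x y => F (H x * K y) * wz H x * wz K y) :=
    ((hF.continuous.comp ((hH.smooth.continuous.comp continuous_fst).mul
      (hK.smooth.continuous.comp continuous_snd))).mul (hHw.comp continuous_fst)).mul
      (hKw.comp continuous_snd)
  have hcs : HasCompactSupport (Function.uncurry fun x y => F (H x * K y) * wz H x * wz K y) := by
    refine HasCompactSupport.intro
      ((hasCompactSupport_wz hHc).isCompact.prod (hasCompactSupport_wz hKc).isCompact) ?_
    rintro ⟨x, y⟩ hxy
    simp only [Function.uncurry]
    by_cases hx : x ∈ tsupport (wz H)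
    · rw [image_eq_zero_of_notMem_tsupport (fun h => hxy ⟨hx, h⟩ : y ∉ tsupport (wz K)), mul_zero]
    · rw [image_eq_zero_of_notMem_tsupport hx, mul_zero, zero_mul]
  -- As in the uniqueness proof for Haar measure, the double integral of F(H(x) K(y)) is computed in
  -- both orders, with left invariance in one and right invariance in the other.
  have hswap := integral_integral_swap_of_hasCompactSupport (μ := (volume : Measure (E 3)))
    (ν := (volume : Measure (E 3))) hcont hcs
  have e1 : ∀ x, ∫ y, F (H x * K y) * wz H x * wz K y = (∫ y, F (K y) * wz K y) * wz H x := by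
    intro x
    rw [← integral_comp_const_mul_mul_wz hK hKc hF (hH.mem x), ← integral_mul_const]
    congr 1
    ext y
    ring
  have e2 : ∀ y, ∫ x, F (H x * K y) * wz H x * wz K y = (∫ x, F (H x) * wz H x) * wz K y := by
    intro y
    rw [← integral_comp_mul_const_mul_wz hH hHc hF (hK.mem y), ← integral_mul_const]
  simp only [e1, e2, integral_const_mul] at hswap
  exact hswap.symm

/-! ### The local degree at a regular value. -/

section degree

variable {n : ℕ}

/-- The inverse function theorem, on a neighbourhood that is cut down so that the Jacobian keeps its
sign; `s` is this sign. -/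
lemma exists_nhd_injOn_det_sign {h : E n → E n} (hh : ContDiff ℝ 1 h) {x : E n}
    (hx : (fderiv ℝ h x).det ≠ 0) :
    ∃ U : Set (E n), IsOpen U ∧ x ∈ U ∧ Set.InjOn h U ∧ (∀ V ∈ 𝓝 x, h '' V ∈ 𝓝 (h x)) ∧
      ∃ s : ℤ, ∀ y ∈ U, (fderiv ℝ h y).det = s * |(fderiv ℝ h y).det| := by
  let e := (fderiv ℝ h x).toContinuousLinearEquivOfDetNeZero hx
  have hs : HasStrictFDerivAt h (e : E n →L[ℝ] E n) x :=
    (hh.contDiffAt.hasStrictFDerivAt (by simp)).congr_fderiv (by ext v; simp [e])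
  have hc : Continuous fun y => (fderiv ℝ h y).det :=
    ContinuousLinearMap.continuous_det.comp (hh.continuous_fderiv (by simp))
  have himg : ∀ V ∈ 𝓝 x, h '' V ∈ 𝓝 (h x) := fun V hV => by
    rw [← hs.map_nhds_eq_of_equiv]
    exact Filter.image_mem_map hV
  let U₀ := (hs.toOpenPartialHomeomorph h).source
  have hU₀ : IsOpen U₀ := (hs.toOpenPartialHomeomorph h).open_source
  have hxU : x ∈ U₀ := hs.mem_toOpenPartialHomeomorph_source
  have hinj : Set.InjOn h U₀ := (hs.toOpenPartialHomeomorph h).injOn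
  rcases lt_or_gt_of_ne hx with hneg | hpos
  · refine ⟨U₀ ∩ {y | (fderiv ℝ h y).det < 0}, hU₀.inter (isOpen_lt hc continuous_const),
      ⟨hxU, hneg⟩, hinj.mono Set.inter_subset_left, himg, -1, fun y hy => ?_⟩
    rw [abs_of_neg hy.2]
    simp
  · refine ⟨U₀ ∩ {y | 0 < (fderiv ℝ h y).det}, hU₀.inter (isOpen_lt continuous_const hc),
      ⟨hxU, hpos⟩, hinj.mono Set.inter_subset_left, himg, 1, fun y hy => ?_⟩
    rw [abs_of_pos hy.2]
    simp

/-- Near a regular value, the integral of a pulled back density is an integer multiple of the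
integral of the density. -/
lemma exists_local_degree {h : E n → E n} (hh : ContDiff ℝ 1 h) {W K : Set (E n)} (hW : IsOpen W)
    (hK : IsCompact K) (hKW : K ⊆ W) {v : E n}
    (hv : ∀ x ∈ W, h x = v → (fderiv ℝ h x).det ≠ 0) {ε₀ : ℝ} (hε₀ : 0 < ε₀)
    (hproper : ∀ x ∈ W, h x ∈ Metric.ball v ε₀ → x ∈ K) :
    ∃ N : ℤ, ∃ ε > 0, ∀ η : E n → ℝ, Continuous η → Function.support η ⊆ Metric.ball v ε →
      ∫ x in W, η (h x) * (fderiv ℝ h x).det = N * ∫ y, η y := by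
  classical
  have hhc := hh.continuous
  let P := {x | x ∈ K ∧ h x = v}
  have hPc : IsCompact P := hK.inter_right (isClosed_eq hhc continuous_const)
  have hloc : ∀ x : E n, ∃ U : Set (E n), x ∈ P → (IsOpen U ∧ x ∈ U ∧ Set.InjOn h U ∧
      (∀ V ∈ 𝓝 x, h '' V ∈ 𝓝 v) ∧
      ∃ s : ℤ, ∀ y ∈ U, (fderiv ℝ h y).det = s * |(fderiv ℝ h y).det|) := by
    intro x
    by_cases hx : x ∈ P
    · obtain ⟨U, hU⟩ := exists_nhd_injOn_det_sign hh (hv x (hKW hx.1) hx.2)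
      rw [hx.2] at hU
      exact ⟨U, fun _ => hU⟩
    · exact ⟨∅, fun h => absurd h hx⟩
  choose U hU using hloc
  -- The fibre over `v` is compact, and each neighbourhood of injectivity contains only one of its
  -- points.
  have hPfin : P.Finite := by
    obtain ⟨t, ht, htP⟩ := hPc.elim_nhds_subcover U
      fun x hx => (hU x hx).1.mem_nhds (hU x hx).2.1
    refine t.finite_toSet.subset fun x hx => ?_
    obtain ⟨y, hy, hxy⟩ := Set.mem_iUnion₂.1 (htP hx)
    have := (hU y (ht y hy)).2.2.1 hxy (hU y (ht y hy)).2.1 (hx.2.trans (ht y hy).2.symm)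
    rw [this]
    exact hy
  obtain ⟨D, hD, hdisj⟩ := hPfin.t2_separation
  let V := fun x => U x ∩ D x ∩ W
  have hVo : ∀ x ∈ P, IsOpen (V x) := fun x hx => ((hU x hx).1.inter (hD x).2).inter hW
  have hVx : ∀ x ∈ P, x ∈ V x := fun x hx => ⟨⟨(hU x hx).2.1, (hD x).1⟩, hKW hx.1⟩
  choose! s hs using fun x (hx : x ∈ P) => (hU x hx).2.2.2.2
  let T := hPfin.toFinset
  have hT : ∀ x, x ∈ T ↔ x ∈ P := fun x => hPfin.mem_toFinset
  -- a common radius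
  have h1 : ∃ ε₁ > 0, ∀ x ∈ K, h x ∈ Metric.ball v ε₁ → x ∈ ⋃ p ∈ T, V p := by
    let C := K \ ⋃ p ∈ T, V p
    have hC : IsCompact C := hK.diff (isOpen_biUnion fun p hp => hVo p ((hT p).1 hp))
    have hCv : v ∉ h '' C := by
      rintro ⟨x, hx, hxv⟩
      exact hx.2 (Set.mem_biUnion ((hT x).2 ⟨hx.1, hxv⟩) (hVx x ⟨hx.1, hxv⟩))
    have hcl := (hC.image hhc).isClosed.isOpen_compl
    obtain ⟨ε₁, hε₁, hb⟩ := Metric.isOpen_iff.1 hcl v hCv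
    refine ⟨ε₁, hε₁, fun x hx hxb => ?_⟩
    by_contra hx'
    exact hb hxb ⟨x, ⟨hx, hx'⟩, rfl⟩
  have h2 : ∃ ε₂ > 0, ∀ p ∈ T, Metric.ball v ε₂ ⊆ h '' V p := by
    have : ⋂ p ∈ T, h '' V p ∈ 𝓝 v := by
      rw [Filter.biInter_finset_mem]
      intro p hp
      exact (hU p ((hT p).1 hp)).2.2.2.1 _ ((hVo p ((hT p).1 hp)).mem_nhds (hVx p ((hT p).1 hp)))
    obtain ⟨ε₂, hε₂, hb⟩ := Metric.mem_nhds_iff.1 this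
    exact ⟨ε₂, hε₂, fun p hp => hb.trans (Set.biInter_subset_of_mem hp)⟩
  obtain ⟨ε₁, hε₁, h1⟩ := h1
  obtain ⟨ε₂, hε₂, h2⟩ := h2
  -- The degree is the signed count of the fibre. Within this radius preimages in `W` lie in `K`,
  -- then in the sets `V p`, and each `V p` covers the whole ball of radius ε₂.
  refine ⟨∑ p ∈ T, s p, min ε₀ (min ε₁ ε₂), by positivity, fun η hη hsupp => ?_⟩
  have hsub : ∀ {r : ℝ}, min ε₀ (min ε₁ ε₂) ≤ r → ∀ y, η y ≠ 0 → y ∈ Metric.ball v r :=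
    fun hr y hy => Metric.ball_subset_ball hr (hsupp hy)
  have hVm : ∀ p ∈ T, MeasurableSet (V p) := fun p hp => (hVo p ((hT p).1 hp)).measurableSet
  have hunion : ∫ x in W, η (h x) * (fderiv ℝ h x).det =
      ∫ x in ⋃ p ∈ T, V p, η (h x) * (fderiv ℝ h x).det := by
    refine setIntegral_eq_of_subset_of_forall_sdiff_eq_zero hW.measurableSet
      (Set.iUnion₂_subset fun p _ => Set.inter_subset_right) fun x hx => ?_
    by_contra hne
    have hne' : η (h x) ≠ 0 := left_ne_zero_of_mul hne
    exact hx.2 (h1 x (hproper x hx.1 (hsub (min_le_left _ _) _ hne'))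
      (hsub ((min_le_right _ _).trans (min_le_left _ _)) _ hne'))
  have hpiece : ∀ p ∈ T, ∫ x in V p, η (h x) * (fderiv ℝ h x).det = s p * ∫ y, η y := by
    intro p hp
    have hpP := (hT p).1 hp
    have hinj : Set.InjOn h (V p) :=
      (hU p hpP).2.2.1.mono (Set.inter_subset_left.trans Set.inter_subset_left)
    have hcv := integral_image_eq_integral_abs_det_fderiv_smul volume (hVm p hp)
      (fun x _ => ((hh.differentiable (by simp)) x).hasFDerivAt.hasFDerivWithinAt) hinj η
    have himg : ∫ y in h '' V p, η y = ∫ y, η y := by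
      refine setIntegral_eq_integral_of_forall_compl_eq_zero fun y hy => ?_
      by_contra hne
      exact hy (h2 p hp (hsub ((min_le_right _ _).trans (min_le_right _ _)) _ hne))
    rw [← himg, hcv, ← integral_const_mul]
    refine setIntegral_congr_fun (hVm p hp) fun x hx => ?_
    simp only [smul_eq_mul]
    linear_combination η (h x) * hs p hpP x hx.1.1
  rw [hunion, integral_biUnion_finset T hVm]
  · rw [Finset.sum_congr rfl hpiece, ← Finset.sum_mul]
    push_cast
    rfl
  · intro p hp q hq hpq
    exact (hdisj ((hT p).1 hp) ((hT q).1 hq) hpq).mono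
      (Set.inter_subset_left.trans Set.inter_subset_right)
      (Set.inter_subset_left.trans Set.inter_subset_right)
  · intro p hp
    have hc : Continuous fun x => η (h x) * (fderiv ℝ h x).det := (hη.comp hhc).mul
      (ContinuousLinearMap.continuous_det.comp (hh.continuous_fderiv (by simp)))
    refine ((hc.continuousOn.integrableOn_compact hK).mono_set
      (Set.inter_subset_right (s := V p))).of_forall_sdiff_eq_zero (hVm p hp) fun x hx => ?_
    by_contra hne
    exact hx.2 ⟨hx.1, hproper x hx.1.2 (hsub (min_le_left _ _) _ (left_ne_zero_of_mul hne))⟩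

end degree

/-! ### The volume form of SU(2) in the coordinates of the vector part. -/

/-- The vector part of a quaternionic matrix. -/
def vecPart : M →L[ℝ] E 3 :=
  LinearMap.toContinuousLinearMap
    { toFun := fun A => !₂[(A 0 0).im, (A 1 0).re, (A 1 0).im]
      map_add' := fun A B => by ext i; fin_cases i <;> simp
      map_smul' := fun c A => by ext i; fin_cases i <;> simp }

lemma vecPart_apply (A : M) : vecPart A = !₂[(A 0 0).im, (A 1 0).re, (A 1 0).im] := rfl

/-- The real part of a quaternionic matrix. -/
def scalPart : M →L[ℝ] ℝ :=
  LinearMap.toContinuousLinearMap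
    { toFun := fun A => (A 0 0).re
      map_add' := fun A B => by simp
      map_smul' := fun c A => by simp }

lemma scalPart_apply (A : M) : scalPart A = (A 0 0).re := rfl

lemma scalPart_sq_add {A : M} (hA : A ∈ specialUnitaryGroup (Fin 2) ℂ) :
    scalPart A ^ 2 + ‖vecPart A‖ ^ 2 = 1 := by
  have h := (isQuat_of_mem hA).eq_qm
  rw [h, qm_mem_iff] at hA
  rw [EuclideanSpace.norm_sq_eq, vecPart_apply, scalPart_apply, ← hA]
  simp [Fin.sum_univ_three]
  ring

/-- On the unit 3-sphere, the invariant volume form at (a, b, c, d) is the Euclidean one of the last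
three coordinates divided by a. The rows on the left are tangent vectors translated to the identity;
the first three hypotheses say that they are tangent. -/
lemma det_quat_mul {a b c d s₀ p₀ q₀ r₀ s₁ p₁ q₁ r₁ s₂ p₂ q₂ r₂ : ℝ}
    (h₀ : a * s₀ + b * p₀ + c * q₀ + d * r₀ = 0) (h₁ : a * s₁ + b * p₁ + c * q₁ + d * r₁ = 0)
    (h₂ : a * s₂ + b * p₂ + c * q₂ + d * r₂ = 0) (hn : a ^ 2 + b ^ 2 + c ^ 2 + d ^ 2 = 1)
    (ha : a ≠ 0) :
    a * det !![a * p₀ - b * s₀ + c * r₀ - d * q₀, a * q₀ - b * r₀ - c * s₀ + d * p₀,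
        a * r₀ + b * q₀ - c * p₀ - d * s₀;
      a * p₁ - b * s₁ + c * r₁ - d * q₁, a * q₁ - b * r₁ - c * s₁ + d * p₁,
        a * r₁ + b * q₁ - c * p₁ - d * s₁;
      a * p₂ - b * s₂ + c * r₂ - d * q₂, a * q₂ - b * r₂ - c * s₂ + d * p₂,
        a * r₂ + b * q₂ - c * p₂ - d * s₂] = det !![p₀, p₁, p₂; q₀, q₁, q₂; r₀, r₁, r₂] := by
  have e1 : ∀ {s p q r : ℝ}, a * s + b * p + c * q + d * r = 0 →
      a * (a * p - b * s + c * r - d * q) =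
        a ^ 2 * p + b * (b * p + c * q + d * r) + a * (c * r - d * q) :=
    fun h => by linear_combination -b * h
  have e2 : ∀ {s p q r : ℝ}, a * s + b * p + c * q + d * r = 0 →
      a * (a * q - b * r - c * s + d * p) =
        a ^ 2 * q + c * (b * p + c * q + d * r) + a * (d * p - b * r) :=
    fun h => by linear_combination -c * h
  have e3 : ∀ {s p q r : ℝ}, a * s + b * p + c * q + d * r = 0 →
      a * (a * r + b * q - c * p - d * s) =
        a ^ 2 * r + d * (b * p + c * q + d * r) + a * (b * q - c * p) :=
    fun h => by linear_combination -d * h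
  have hdet : ∀ x₀ y₀ z₀ x₁ y₁ z₁ x₂ y₂ z₂ : ℝ,
      a ^ 2 * (a * det !![x₀, y₀, z₀; x₁, y₁, z₁; x₂, y₂, z₂]) =
        det !![a * x₀, a * y₀, a * z₀; a * x₁, a * y₁, a * z₁; a * x₂, a * y₂, a * z₂] := by
    intros
    simp [det_fin_three]
    ring
  -- The factor a² supplies one a to each row, and tangency then eliminates the scalar components
  -- s₀, s₁, s₂.
  apply mul_left_cancel₀ (pow_ne_zero 2 ha)
  rw [hdet, e1 h₀, e2 h₀, e3 h₀, e1 h₁, e2 h₁, e3 h₁, e1 h₂, e2 h₂, e3 h₂]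
  have hn2 : a ^ 2 * det !![p₀, p₁, p₂; q₀, q₁, q₂; r₀, r₁, r₂] =
      a ^ 2 * (a ^ 2 + b ^ 2 + c ^ 2 + d ^ 2) ^ 2 * det !![p₀, p₁, p₂; q₀, q₁, q₂; r₀, r₁, r₂] := by
    rw [hn]; ring
  rw [hn2]
  simp [det_fin_three]
  ring

/-- In terms of the vector part `h` of a map to the unit quaternions, `tr (H⁻¹dH)³` is
`12 dh₁dh₂dh₃` over the real part. -/
lemma IsGauge.scalPart_mul_wz {H : E 3 → M} (hH : IsGauge H) {x : E 3} (hx : scalPart (H x) ≠ 0) :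
    scalPart (H x) * wz H x = 12 * (fderiv ℝ (fun y => vecPart (H y)) x).det := by
  have hq : ∀ i, IsQuat (pd i H x) := fun i => isQuat_fderiv hH.differentiable hH.isQuat x _
  have hfd : ∀ i, fderiv ℝ (fun y => vecPart (H y)) x (ee i) = vecPart (pd i H x) := fun i =>
    congrArg (fun L => L (ee i)) (vecPart.hasFDerivAt.comp x (hH.differentiable x).hasFDerivAt).fderiv
  have hdet : (fderiv ℝ (fun y => vecPart (H y)) x).det =
      det (Matrix.of fun i j => vecPart (pd j H x) i) := by
    rw [det_eq_toLin]; simp only [hfd]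
  have hl : ∀ i, lform H x (ee i) = (H x)ᴴ * pd i H x := fun i => rfl
  have hsu := fun i => hH.isSu_lform i x
  rw [hdet, wz_eq_triple, hl, hl, hl]
  simp only [hl] at hsu
  have hHx := hH.mem x
  rw [scalPart_apply] at hx ⊢
  rw [(hH.isQuat x).eq_qm, qm_mem_iff] at hHx
  have hH' := (hH.isQuat x).eq_qm
  generalize (H x 0 0).re = a at *
  generalize (H x 0 0).im = b at *
  generalize (H x 1 0).re = c at *
  generalize (H x 1 0).im = d at *
  have hpd : ∀ i, ∃ s p q r, pd i H x = qm s p q r := fun i => ⟨_, _, _, _, (hq i).eq_qm⟩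
  choose s p q r hpd using hpd
  have hprod : ∀ i, (H x)ᴴ * pd i H x = qm 0 (a * p i - b * s i + c * r i - d * q i)
      (a * q i - b * r i - c * s i + d * p i) (a * r i + b * q i - c * p i - d * s i) ∧
      a * s i + b * p i + c * q i + d * r i = 0 := by
    intro i
    have h0 : a * s i + b * p i + c * q i + d * r i = 0 := by
      obtain ⟨p', q', r', h⟩ := hsu i
      rw [hH', conjTranspose_qm, hpd, qm_mul] at h
      have := congrArg Complex.re (congrFun (congrFun h 0) 0)
      simp [qm] at this
      linarith
    refine ⟨?_, h0⟩
    rw [hH', conjTranspose_qm, hpd, qm_mul]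
    congr 1 <;> linarith
  rw [(hprod 0).1, (hprod 1).1, (hprod 2).1, triple_qm]
  have := det_quat_mul (hprod 0).2 (hprod 1).2 (hprod 2).2 hHx hx
  have hm : (Matrix.of fun i j => vecPart (pd j H x) i) =
      !![p 0, p 1, p 2; q 0, q 1, q 2; r 0, r 1, r 2] := by
    ext i j
    fin_cases i <;> fin_cases j <;> simp [vecPart_apply, hpd, qm]
  rw [hm, ← this]
  ring

/-- A function on `SU(2)` that is concentrated where the real part is negative. -/
def lowerBump (η : E 3 → ℝ) (δ : ℝ) (A : M) : ℝ :=
  scalPart A * Real.smoothTransition (-scalPart A / δ) * η (vecPart A)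

lemma contDiff_lowerBump {η : E 3 → ℝ} (hη : ContDiff ℝ ∞ η) (δ : ℝ) :
    ContDiff ℝ ∞ (lowerBump η δ) :=
  (scalPart.contDiff.mul (Real.smoothTransition.contDiff.comp
    (scalPart.contDiff.neg.div_const δ))).mul (hη.comp vecPart.contDiff)

/-- The open set where a map to the unit quaternions has negative real part. -/
def lowerSet (H : E 3 → M) : Set (E 3) := {x | scalPart (H x) < 0}

lemma isOpen_lowerSet {H : E 3 → M} (hH : IsGauge H) : IsOpen (lowerSet H) :=
  isOpen_lt (scalPart.continuous.comp hH.smooth.continuous) continuous_const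

/-- The factor `scalPart` in `lowerBump` cancels the denominator of the volume form. By `hη`,
wherever η is nonzero on the lower half the real part is at most −δ, so the smooth cutoff is 1
there. -/
lemma integral_lowerBump_mul_wz {H : E 3 → M} (hH : IsGauge H) {η : E 3 → ℝ} {δ : ℝ} (hδ : 0 < δ)
    (hη : ∀ y, η y ≠ 0 → δ ^ 2 ≤ 1 - ‖y‖ ^ 2) :
    ∫ x, lowerBump η δ (H x) * wz H x = 12 * ∫ x in lowerSet H,
      η (vecPart (H x)) * (fderiv ℝ (fun y => vecPart (H y)) x).det := by
  rw [← integral_const_mul, ← setIntegral_eq_integral_of_forall_compl_eq_zero (s := lowerSet H)]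
  · refine setIntegral_congr_fun (isOpen_lowerSet hH).measurableSet fun x hx => ?_
    have hx' : scalPart (H x) < 0 := hx
    have h := hH.scalPart_mul_wz hx'.ne
    simp only [lowerBump]
    rcases eq_or_ne (η (vecPart (H x))) 0 with h0 | h0
    · rw [h0]; ring
    · have h1 := hη _ h0
      have h2 := scalPart_sq_add (hH.mem x)
      have h3 : δ ≤ -scalPart (H x) := by nlinarith
      rw [Real.smoothTransition.one_of_one_le ((one_le_div hδ).2 h3)]
      linear_combination η (vecPart (H x)) * h
  · intro x hx
    have hx' : 0 ≤ scalPart (H x) := not_lt.1 hx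
    rw [lowerBump, Real.smoothTransition.zero_of_nonpos]
    · simp
    · exact div_nonpos_of_nonpos_of_nonneg (by linarith) hδ.le

/-! ### The model map of degree one. -/

lemma smoothTransition_strictMonoOn : StrictMonoOn Real.smoothTransition (Set.Icc 0 1) := by
  intro x hx y hy hxy
  have hpos : ∀ z, 0 < expNegInvGlue z + expNegInvGlue (1 - z) := Real.smoothTransition.pos_denom
  simp only [Real.smoothTransition]
  rw [div_lt_div_iff₀ (hpos x) (hpos y)]
  have h1 : expNegInvGlue x < expNegInvGlue y := by
    rcases hx.1.eq_or_lt with rfl | h0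
    · rw [expNegInvGlue.zero]; exact expNegInvGlue.pos_of_pos hxy
    · rw [expNegInvGlue, expNegInvGlue, if_neg (not_le.2 h0), if_neg (not_le.2 (h0.trans hxy))]
      apply Real.exp_lt_exp.2
      exact neg_lt_neg (inv_strictAnti₀ h0 hxy)
  have h2 := expNegInvGlue.monotone (by linarith : 1 - y ≤ 1 - x)
  have h3 := expNegInvGlue.pos_of_pos (by linarith [hy.2] : 0 < 1 - x)
  have h4 := expNegInvGlue.nonneg x
  nlinarith

/-- The angle, as a function of the squared radius, in the model map of degree one. -/
def angle (t : ℝ) : ℝ := Real.pi * Real.smoothTransition (t - 1)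

lemma contDiff_angle : ContDiff ℝ ∞ angle :=
  contDiff_const.mul (Real.smoothTransition.contDiff.comp (contDiff_id.sub contDiff_const))

lemma hasDerivAt_angle (t : ℝ) : HasDerivAt angle (deriv angle t) t :=
  (contDiff_angle.differentiable (by simp) t).hasDerivAt

lemma angle_of_le {t : ℝ} (ht : t ≤ 1) : angle t = 0 := by
  rw [angle, Real.smoothTransition.zero_of_nonpos (by linarith), mul_zero]

lemma angle_of_ge {t : ℝ} (ht : 2 ≤ t) : angle t = Real.pi := by
  rw [angle, Real.smoothTransition.one_of_one_le (by linarith), mul_one]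

lemma angle_mono : Monotone angle := fun s t h =>
  mul_le_mul_of_nonneg_left (Real.smoothTransition.monotone (by linarith)) Real.pi_pos.le

lemma angle_strictMonoOn : StrictMonoOn angle (Set.Icc 1 2) := fun s hs t ht h =>
  mul_lt_mul_of_pos_left (smoothTransition_strictMonoOn ⟨by linarith [hs.1], by linarith [hs.2]⟩
    ⟨by linarith [ht.1], by linarith [ht.2]⟩ (by linarith)) Real.pi_pos

/-- The radial factor of the vector part of the model map. -/
def sincAngle (t : ℝ) : ℝ := Real.sin (angle t) / Real.sqrt t

lemma contDiff_sincAngle : ContDiff ℝ ∞ sincAngle := by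
  rw [contDiff_iff_contDiffAt]
  intro t
  rcases lt_or_ge t 1 with h | h
  · refine (contDiffAt_const (c := (0 : ℝ))).congr_of_eventuallyEq ?_
    filter_upwards [Iio_mem_nhds h] with s hs
    rw [sincAngle, angle_of_le (le_of_lt hs)]
    simp
  · have h0 : t ≠ 0 := by linarith
    exact (Real.contDiff_sin.comp contDiff_angle).contDiffAt.div (contDiffAt_id.sqrt h0)
      (Real.sqrt_ne_zero'.2 (by linarith))

lemma cos_sq_add_sincAngle (t : ℝ) : Real.cos (angle t) ^ 2 + t * sincAngle t ^ 2 = 1 := by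
  rcases le_or_gt t 0 with h | h
  · rw [sincAngle, angle_of_le (by linarith)]
    simp
  · rw [sincAngle, div_pow, Real.sq_sqrt h.le, mul_div_cancel₀ _ h.ne']
    linarith [Real.sin_sq_add_cos_sq (angle t)]

lemma hasDerivAt_cos_angle (t : ℝ) :
    HasDerivAt (fun s => Real.cos (angle s)) (-Real.sin (angle t) * deriv angle t) t :=
  (Real.hasDerivAt_cos _).comp t (hasDerivAt_angle t)

lemma hasDerivAt_sincAngle (t : ℝ) : HasDerivAt sincAngle (deriv sincAngle t) t :=
  (contDiff_sincAngle.differentiable (by simp) t).hasDerivAt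

lemma deriv_constraint (t : ℝ) :
    2 * Real.cos (angle t) * (-Real.sin (angle t) * deriv angle t) + sincAngle t ^ 2 +
      2 * t * sincAngle t * deriv sincAngle t = 0 := by
  have h := ((hasDerivAt_cos_angle t).pow 2).add
    ((hasDerivAt_id t).mul ((hasDerivAt_sincAngle t).pow 2))
  have h0 : ((fun s => Real.cos (angle s)) ^ 2 + id * sincAngle ^ 2) = fun _ => (1 : ℝ) :=
    funext cos_sq_add_sincAngle
  rw [h0] at h
  have := h.unique (hasDerivAt_const t 1)
  simp at this
  linear_combination this

lemma qm_eq_sum (a b c d : ℝ) :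
    qm a b c d = a • qm 1 0 0 0 + b • qm 0 1 0 0 + c • qm 0 0 1 0 + d • qm 0 0 0 1 := by
  ext i j
  fin_cases i <;> fin_cases j <;> apply Complex.ext <;> simp [qm]

/-- The model map of degree one to the unit quaternions, constant near the origin and near
infinity. -/
def model (x : E 3) : M :=
  qm (Real.cos (angle (‖x‖ ^ 2))) (sincAngle (‖x‖ ^ 2) * x 0) (sincAngle (‖x‖ ^ 2) * x 1)
    (sincAngle (‖x‖ ^ 2) * x 2)

lemma norm_sq_three (x : E 3) : ‖x‖ ^ 2 = x 0 ^ 2 + x 1 ^ 2 + x 2 ^ 2 := by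
  rw [EuclideanSpace.norm_sq_eq]
  simp [Fin.sum_univ_three]

lemma isGauge_model : IsGauge model := by
  constructor
  · have h1 : ContDiff ℝ ∞ fun x : E 3 => ‖x‖ ^ 2 := contDiff_norm_sq ℝ
    have h2 : ContDiff ℝ ∞ fun x : E 3 => Real.cos (angle (‖x‖ ^ 2)) :=
      Real.contDiff_cos.comp (contDiff_angle.comp h1)
    have h3 : ∀ i, ContDiff ℝ ∞ fun x : E 3 => sincAngle (‖x‖ ^ 2) * x i := fun i =>
      (contDiff_sincAngle.comp h1).mul (contDiff_piLp_apply (p := 2))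
    have : model = fun x => Real.cos (angle (‖x‖ ^ 2)) • qm 1 0 0 0 +
        (sincAngle (‖x‖ ^ 2) * x 0) • qm 0 1 0 0 + (sincAngle (‖x‖ ^ 2) * x 1) • qm 0 0 1 0 +
        (sincAngle (‖x‖ ^ 2) * x 2) • qm 0 0 0 1 := funext fun x => qm_eq_sum _ _ _ _
    rw [this]
    exact (((h2.smul contDiff_const).add ((h3 0).smul contDiff_const)).add
      ((h3 1).smul contDiff_const)).add ((h3 2).smul contDiff_const)
  · intro x
    rw [model, qm_mem_iff]
    have := cos_sq_add_sincAngle (‖x‖ ^ 2)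
    rw [← this]
    nth_rw 6 [norm_sq_three x]
    ring

lemma hasCompactSupport_fderiv_model : HasCompactSupport (fderiv ℝ model) := by
  refine HasCompactSupport.intro (isCompact_closedBall (0 : E 3) 2) fun x hx => ?_
  have h : model =ᶠ[𝓝 x] fun _ => qm (-1) 0 0 0 := by
    have hx' : 2 < ‖x‖ := by simpa using hx
    filter_upwards [(isOpen_lt continuous_const continuous_norm).mem_nhds hx'] with y hy
    have hy' : (2 : ℝ) < ‖y‖ := hy
    have : angle (‖y‖ ^ 2) = Real.pi := angle_of_ge (by nlinarith)
    rw [model, sincAngle, this]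
    simp
  rw [h.fderiv_eq]
  simp

lemma pd_model (i : Fin 3) (x : E 3) : pd i model x =
    qm (2 * x i * (-Real.sin (angle (‖x‖ ^ 2)) * deriv angle (‖x‖ ^ 2)))
      (2 * x i * deriv sincAngle (‖x‖ ^ 2) * x 0 + sincAngle (‖x‖ ^ 2) * (ee i : E 3) 0)
      (2 * x i * deriv sincAngle (‖x‖ ^ 2) * x 1 + sincAngle (‖x‖ ^ 2) * (ee i : E 3) 1)
      (2 * x i * deriv sincAngle (‖x‖ ^ 2) * x 2 + sincAngle (‖x‖ ^ 2) * (ee i : E 3) 2) := by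
  have h1 : HasFDerivAt (fun y : E 3 => ‖y‖ ^ 2) (2 • innerSL ℝ x) x :=
    (hasStrictFDerivAt_norm_sq x).hasFDerivAt
  have h2 := (hasDerivAt_cos_angle (‖x‖ ^ 2)).comp_hasFDerivAt x h1
  have hp : ∀ j, HasFDerivAt (fun y : E 3 => y j) (EuclideanSpace.proj j : E 3 →L[ℝ] ℝ) x :=
    fun j => (EuclideanSpace.proj j : E 3 →L[ℝ] ℝ).hasFDerivAt
  have h3 := fun j => ((hasDerivAt_sincAngle (‖x‖ ^ 2)).comp_hasFDerivAt x h1).mul (hp j)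
  have h4 := (((h2.smul_const (qm 1 0 0 0)).add ((h3 0).smul_const (qm 0 1 0 0))).add
    ((h3 1).smul_const (qm 0 0 1 0))).add ((h3 2).smul_const (qm 0 0 0 1))
  have h5 := h4.congr_of_eventuallyEq (f₁ := model)
    (Filter.Eventually.of_forall fun y => qm_eq_sum _ _ _ _)
  have hin : inner ℝ x (ee i) = x i := by simp [EuclideanSpace.inner_single_right]
  rw [pd, h5.fderiv, qm_eq_sum (2 * x i * _)]
  have hproj : ∀ j, (EuclideanSpace.proj j : E 3 →L[ℝ] ℝ) (ee i) = (ee i : E 3) j := fun _ => rfl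
  simp only [_root_.add_apply, ContinuousLinearMap.smulRight_apply, _root_.smul_apply,
    innerSL_apply_apply, hin, smul_eq_mul, hproj, Function.comp_apply, nsmul_eq_mul, Nat.cast_ofNat]
  refine congrArg₂ _ (congrArg₂ _ (congrArg₂ _ ?_ ?_) ?_) ?_ <;>
    exact congrArg (· • _) (by ring)

lemma wz_model (x : E 3) : wz model x =
    24 * (sincAngle (‖x‖ ^ 2) * Real.sin (angle (‖x‖ ^ 2)) * deriv angle (‖x‖ ^ 2)) := by
  have hl : ∀ i, lform model x (ee i) = (model x)ᴴ * pd i model x := fun i => rfl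
  rw [wz_eq_triple, hl, hl, hl, pd_model, pd_model, pd_model, model, conjTranspose_qm]
  have c1 := cos_sq_add_sincAngle (‖x‖ ^ 2)
  have c2 := deriv_constraint (‖x‖ ^ 2)
  rw [neg_mul] at c2 ⊢
  rw [mul_assoc (sincAngle _)]
  generalize sincAngle (‖x‖ ^ 2) = β at *
  generalize deriv sincAngle (‖x‖ ^ 2) = β' at *
  generalize Real.cos (angle (‖x‖ ^ 2)) = α at *
  generalize Real.sin (angle (‖x‖ ^ 2)) * deriv angle (‖x‖ ^ 2) = α' at *
  rw [norm_sq_three] at c1 c2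
  have e0 : ∀ i j : Fin 3, (ee i : E 3) j = if j = i then 1 else 0 := fun i j => by simp
  have hr : ∀ i : Fin 3, qm α (-(β * x 0)) (-(β * x 1)) (-(β * x 2)) *
      qm (2 * x i * -α') (2 * x i * β' * x 0 + β * (ee i : E 3) 0)
        (2 * x i * β' * x 1 + β * (ee i : E 3) 1) (2 * x i * β' * x 2 + β * (ee i : E 3) 2) =
      qm 0 (2 * x i * (α * β' + β * α') * x 0 + α * β * (ee i : E 3) 0 +
          β ^ 2 * (x 1 * (ee i : E 3) 2 - x 2 * (ee i : E 3) 1))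
        (2 * x i * (α * β' + β * α') * x 1 + α * β * (ee i : E 3) 1 +
          β ^ 2 * (x 2 * (ee i : E 3) 0 - x 0 * (ee i : E 3) 2))
        (2 * x i * (α * β' + β * α') * x 2 + α * β * (ee i : E 3) 2 +
          β ^ 2 * (x 0 * (ee i : E 3) 1 - x 1 * (ee i : E 3) 0)) := by
    intro i
    rw [qm_mul]
    congr 1
    · fin_cases i
      · simp; linear_combination x 0 * c2
      · simp; linear_combination x 1 * c2
      · simp; linear_combination x 2 * c2
    all_goals ring
  rw [hr, hr, hr, triple_qm]
  simp only [e0, det_fin_three]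
  simp
  generalize x.ofLp 0 = u at *
  generalize x.ofLp 1 = v at *
  generalize x.ofLp 2 = w at *
  -- The matrix is a multiple of x⊗x plus αβ·id plus β² times the cross product with x. The first
  -- factors are its determinant on the plane orthogonal to x, the last is its eigenvalue along x.
  -- Here α′ stands for minus the derivative of α.
  have hdet : β ^ 2 * (α ^ 2 + (u ^ 2 + v ^ 2 + w ^ 2) * β ^ 2) *
      (α * β + 2 * (u ^ 2 + v ^ 2 + w ^ 2) * (α * β' + α' * β)) = 2 * β * α' := by
    rw [c1]
    linear_combination α * β * c2 + 2 * β * α' * c1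
  linear_combination 12 * hdet

lemma scalPart_model (x : E 3) : scalPart (model x) = Real.cos (angle (‖x‖ ^ 2)) := by
  simp [scalPart_apply, model, qm]

lemma vecPart_model (x : E 3) : vecPart (model x) = sincAngle (‖x‖ ^ 2) • x := by
  ext i
  fin_cases i <;> simp [vecPart_apply, model, qm]

lemma angle_nonneg (t : ℝ) : 0 ≤ angle t :=
  mul_nonneg Real.pi_pos.le (Real.smoothTransition.nonneg _)

lemma angle_le (t : ℝ) : angle t ≤ Real.pi :=
  mul_le_of_le_one_right Real.pi_pos.le (Real.smoothTransition.le_one _)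

lemma deriv_angle_nonneg (t : ℝ) : 0 ≤ deriv angle t := angle_mono.deriv_nonneg

lemma integral_wz_model : ∫ x, wz model x = 24 * Real.pi ^ 2 := by
  let f : ℝ → ℝ := fun y =>
    24 * (sincAngle (y ^ 2) * Real.sin (angle (y ^ 2)) * deriv angle (y ^ 2))
  have h1 : ∫ x, wz model x = ∫ x : E 3, f ‖x‖ := by simp only [wz_model, f]
  rw [h1, integral_fun_norm_addHaar]
  have hfr : Module.finrank ℝ (E 3) = 3 := by simp
  rw [hfr]
  -- With θ = angle(y²), this is 12 times the antiderivative of sin²θ dθ. It runs from 0 to 6π, and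
  -- polar coordinates contribute the factor 3·(4π/3).
  let Q : ℝ → ℝ := fun y => 12 * (angle (y ^ 2) / 2 - Real.sin (2 * angle (y ^ 2)) / 4)
  have hsq : ∀ y : ℝ, HasDerivAt (fun y : ℝ => y ^ 2) (2 * y) y := fun y => by
    simpa using hasDerivAt_pow 2 y
  have ha : ∀ y, HasDerivAt (fun y : ℝ => angle (y ^ 2)) (deriv angle (y ^ 2) * (2 * y)) y :=
    fun y => HasDerivAt.comp (h₂ := angle) (h := fun y : ℝ => y ^ 2) y (hasDerivAt_angle (y ^ 2))
      (hsq y)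
  have hQ' : ∀ y, HasDerivAt Q (24 * (y * Real.sin (angle (y ^ 2)) ^ 2 * deriv angle (y ^ 2))) y := by
    intro y
    have hs := ((ha y).const_mul 2).sin
    refine ((((ha y).div_const 2).sub (hs.div_const 4)).const_mul 12).congr_deriv ?_
    have : Real.cos (2 * angle (y ^ 2)) = 1 - 2 * Real.sin (angle (y ^ 2)) ^ 2 := by
      rw [Real.cos_two_mul, Real.cos_sq']; ring
    rw [this]
    ring
  have hfQ : ∀ y ∈ Set.Ioi (0 : ℝ), y ^ (3 - 1) • f y =
      24 * (y * Real.sin (angle (y ^ 2)) ^ 2 * deriv angle (y ^ 2)) := by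
    intro y hy
    have hy0 : (0 : ℝ) < y := hy
    simp only [f, sincAngle, Real.sqrt_sq hy0.le, smul_eq_mul]
    field_simp
  have hcont : Continuous fun y : ℝ =>
      24 * (y * Real.sin (angle (y ^ 2)) ^ 2 * deriv angle (y ^ 2)) := by
    have h1 := contDiff_angle.continuous
    have h2 : Continuous (deriv angle) := contDiff_angle.continuous_deriv (by simp)
    fun_prop
  have hsupp : HasCompactSupport fun y : ℝ =>
      24 * (y * Real.sin (angle (y ^ 2)) ^ 2 * deriv angle (y ^ 2)) := by
    refine HasCompactSupport.intro (isCompact_closedBall (0 : ℝ) 2) fun y hy => ?_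
    have hy' : 2 < |y| := by simpa using hy
    have : angle (y ^ 2) = Real.pi := angle_of_ge (by nlinarith [sq_abs y])
    simp [this]
  have hlim : Filter.Tendsto Q Filter.atTop (𝓝 (6 * Real.pi)) := by
    refine tendsto_const_nhds.congr' ?_
    filter_upwards [Filter.eventually_ge_atTop (2 : ℝ)] with y hy
    have : angle (y ^ 2) = Real.pi := angle_of_ge (by nlinarith)
    simp only [Q, this, Real.sin_two_pi]
    ring
  have hInt := integral_Ioi_of_hasDerivAt_of_tendsto (hQ' 0).continuousAt.continuousWithinAt
    (fun y _ => hQ' y) (hcont.integrable_of_hasCompactSupport hsupp).integrableOn hlim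
  have hQ0 : Q 0 = 0 := by simp [Q, angle_of_le]
  rw [setIntegral_congr_fun measurableSet_Ioi hfQ, hInt, hQ0]
  have hv : (volume : Measure (E 3)).real (Metric.ball 0 1) = Real.pi * 4 / 3 := by
    rw [Measure.real, EuclideanSpace.volume_ball_fin_three]
    simp
    positivity
  rw [hv]
  simp
  ring

/-- The vector part of the model map covers the punctured unit ball once where the real part is
negative. -/
lemma setIntegral_lowerSet_model {η : E 3 → ℝ} (h0 : η 0 = 0) (h1 : ∀ y, 1 ≤ ‖y‖ → η y = 0) :
    ∫ x in lowerSet model, η (vecPart (model x)) *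
      (fderiv ℝ (fun y => vecPart (model y)) x).det = -∫ y, η y := by
  -- For ‖x‖² ≥ 2 the model is constantly −1; that region maps to the vector part 0, where η
  -- vanishes.
  let W := lowerSet model ∩ {x | ‖x‖ ^ 2 < 2}
  have hWo : IsOpen W := (isOpen_lowerSet isGauge_model).inter
    (isOpen_lt (by fun_prop) continuous_const)
  have hW : ∀ x ∈ W, ‖x‖ ^ 2 ∈ Set.Ioo (1 : ℝ) 2 ∧
      angle (‖x‖ ^ 2) ∈ Set.Ioo (Real.pi / 2) Real.pi := by
    rintro x ⟨hx, hx2⟩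
    have hx2' : ‖x‖ ^ 2 < 2 := hx2
    have hc : Real.cos (angle (‖x‖ ^ 2)) < 0 := by rw [← scalPart_model]; exact hx
    have hgt : Real.pi / 2 < angle (‖x‖ ^ 2) := by
      by_contra h
      have := Real.cos_nonneg_of_mem_Icc
        (x := angle (‖x‖ ^ 2)) ⟨by linarith [angle_nonneg (‖x‖ ^ 2), Real.pi_pos], not_lt.1 h⟩
      linarith
    have h1 : 1 < ‖x‖ ^ 2 := by
      by_contra h
      rw [angle_of_le (not_lt.1 h)] at hgt
      linarith [Real.pi_pos]
    refine ⟨⟨h1, hx2'⟩, hgt, ?_⟩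
    rw [← angle_of_ge le_rfl]
    exact angle_strictMonoOn ⟨h1.le, hx2'.le⟩ (by norm_num) hx2'
  have hsub : ∫ x in lowerSet model, η (vecPart (model x)) *
      (fderiv ℝ (fun y => vecPart (model y)) x).det = ∫ x in W, η (vecPart (model x)) *
      (fderiv ℝ (fun y => vecPart (model y)) x).det := by
    refine setIntegral_eq_of_subset_of_forall_sdiff_eq_zero
      (isOpen_lowerSet isGauge_model).measurableSet Set.inter_subset_left fun x hx => ?_
    have : 2 ≤ ‖x‖ ^ 2 := not_lt.1 fun h => hx.2 ⟨hx.1, h⟩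
    rw [vecPart_model, sincAngle, angle_of_ge this]
    simp [h0]
  -- The 3-form of the model is nonnegative and the real part is negative, so the vector part
  -- reverses orientation; hence the minus sign in the statement.
  have hneg : ∀ x ∈ W, (fderiv ℝ (fun y => vecPart (model y)) x).det ≤ 0 := by
    intro x hx
    have hx' : scalPart (model x) < 0 := hx.1
    have h := isGauge_model.scalPart_mul_wz hx'.ne
    have hw : 0 ≤ wz model x := by
      rw [wz_model, sincAngle]
      have := Real.sin_nonneg_of_nonneg_of_le_pi (angle_nonneg (‖x‖ ^ 2)) (angle_le _)
      have := deriv_angle_nonneg (‖x‖ ^ 2)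
      positivity
    nlinarith
  have hnorm : ∀ x ∈ W, ‖vecPart (model x)‖ = Real.sin (angle (‖x‖ ^ 2)) := by
    intro x hx
    have hx0 : 0 < ‖x‖ := by
      have := (hW x hx).1.1
      by_contra h
      have : ‖x‖ = 0 := le_antisymm (not_lt.1 h) (norm_nonneg _)
      simp_all
      linarith
    have hs := Real.sin_nonneg_of_nonneg_of_le_pi (angle_nonneg (‖x‖ ^ 2)) (angle_le _)
    rw [vecPart_model, norm_smul, sincAngle, Real.sqrt_sq hx0.le, Real.norm_eq_abs, abs_div,
      abs_of_nonneg hs, abs_of_pos hx0]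
    field_simp
  have hinj : Set.InjOn (fun y => vecPart (model y)) W := by
    intro x hx y hy hxy
    simp only at hxy
    have hn := congrArg norm hxy
    rw [hnorm x hx, hnorm y hy] at hn
    have ha : angle (‖x‖ ^ 2) = angle (‖y‖ ^ 2) := by
      have : Real.cos (angle (‖x‖ ^ 2) - Real.pi / 2) = Real.cos (angle (‖y‖ ^ 2) - Real.pi / 2) := by
        rw [Real.cos_sub_pi_div_two, Real.cos_sub_pi_div_two, hn]
      have hxa := (hW x hx).2
      have hya := (hW y hy).2
      have := Real.injOn_cos ⟨by linarith [hxa.1], by linarith [hxa.2, Real.pi_pos]⟩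
        ⟨by linarith [hya.1], by linarith [hya.2, Real.pi_pos]⟩ this
      linarith
    have ht := angle_strictMonoOn.injOn (Set.Ioo_subset_Icc_self (hW x hx).1)
      (Set.Ioo_subset_Icc_self (hW y hy).1) ha
    rw [vecPart_model, vecPart_model, ht] at hxy
    have hne : sincAngle (‖y‖ ^ 2) ≠ 0 := by
      rw [sincAngle]
      exact div_ne_zero (Real.sin_pos_of_pos_of_lt_pi (by linarith [(hW y hy).2.1, Real.pi_pos])
        (hW y hy).2.2).ne' (Real.sqrt_ne_zero'.2 (by linarith [(hW y hy).1.1]))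
    exact smul_right_injective _ hne hxy
  have hdiff : Differentiable ℝ fun y => vecPart (model y) :=
    (vecPart.contDiff.comp isGauge_model.smooth).differentiable (by simp)
  have hcv := integral_image_eq_integral_abs_det_fderiv_smul volume hWo.measurableSet
    (fun x _ => (hdiff x).hasFDerivAt.hasFDerivWithinAt) hinj η
  have himg : ∫ y in (fun y => vecPart (model y)) '' W, η y = ∫ y, η y := by
    refine setIntegral_eq_integral_of_forall_compl_eq_zero fun y hy => ?_
    by_contra hne
    apply hy
    have hy0 : 0 < ‖y‖ := norm_pos_iff.2 fun h => hne (h ▸ h0)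
    have hy1 : ‖y‖ < 1 := not_le.1 fun h => hne (h1 y h)
    have has0 : 0 < Real.arcsin ‖y‖ := Real.arcsin_pos.2 hy0
    have has1 : Real.arcsin ‖y‖ < Real.pi / 2 := Real.arcsin_lt_pi_div_two.2 hy1
    have hivt := intermediate_value_Ioo (by norm_num : (1 : ℝ) ≤ 2)
      contDiff_angle.continuous.continuousOn
    rw [angle_of_le le_rfl, angle_of_ge le_rfl] at hivt
    -- On the lower half the angle exceeds π/2, so the angle with sine ‖y‖ is π − arcsin ‖y‖.
    obtain ⟨t, ht, hta⟩ := hivt (show Real.pi - Real.arcsin ‖y‖ ∈ _ from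
      ⟨by linarith, by linarith⟩)
    have ht0 : 0 < t := by linarith [ht.1]
    have hst : 0 < Real.sqrt t := Real.sqrt_pos.2 ht0
    have hxn : ‖(Real.sqrt t / ‖y‖) • y‖ ^ 2 = t := by
      rw [norm_smul, Real.norm_eq_abs, abs_of_pos (div_pos hst hy0), div_mul_cancel₀ _ hy0.ne',
        Real.sq_sqrt ht0.le]
    refine ⟨(Real.sqrt t / ‖y‖) • y, ⟨?_, ?_⟩, ?_⟩
    · change scalPart _ < 0
      rw [scalPart_model, hxn, hta, Real.cos_pi_sub, Real.cos_arcsin]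
      have : 0 < Real.sqrt (1 - ‖y‖ ^ 2) := Real.sqrt_pos.2 (by nlinarith)
      linarith
    · change _ < (2 : ℝ)
      rw [hxn]; exact ht.2
    · simp only [vecPart_model]
      rw [hxn, sincAngle, hta, Real.sin_pi_sub, Real.sin_arcsin (by linarith) hy1.le, smul_smul]
      have : ‖y‖ / Real.sqrt t * (Real.sqrt t / ‖y‖) = 1 := by field_simp
      rw [this, one_smul]
  rw [hsub, ← himg, hcv, ← integral_neg]
  refine setIntegral_congr_fun hWo.measurableSet fun x hx => ?_
  rw [abs_of_nonpos (hneg x hx), smul_eq_mul]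
  ring

/-! ### Integrality of the degree. -/

/-- Sard's theorem in equal dimensions: the critical values form a null set. For h the vector part
of an SU(2)-valued map, `v ≠ 0` keeps away from the values ±1 and `‖v‖ < 1` from the equator where
the real part vanishes. -/
lemma exists_regular_value {h : E 3 → E 3} (hh : Differentiable ℝ h) :
    ∃ v : E 3, v ≠ 0 ∧ ‖v‖ < 1 ∧ ∀ x, h x = v → (fderiv ℝ h x).det ≠ 0 := by
  by_contra! hcon
  have hnull : volume (h '' {x | (fderiv ℝ h x).det = 0}) = 0 :=
    addHaar_image_eq_zero_of_det_fderivWithin_eq_zero volume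
      (fun x _ => (hh x).hasFDerivAt.hasFDerivWithinAt) fun x hx => hx
  have hsub : Metric.ball (0 : E 3) 1 ⊆ {0} ∪ h '' {x | (fderiv ℝ h x).det = 0} := by
    intro v hv
    by_cases hv0 : v = 0
    · exact Or.inl hv0
    · obtain ⟨x, hx, hd⟩ := hcon v hv0 (by simpa using hv)
      exact Or.inr ⟨x, hd, hx⟩
  have hpos : 0 < volume (Metric.ball (0 : E 3) 1) := Metric.measure_ball_pos _ _ one_pos
  have hle := (measure_mono (μ := volume) hsub).trans (measure_union_le _ _)
  rw [hnull, measure_singleton, zero_add] at hle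
  exact absurd hle (not_le.2 hpos)

/-- The degree of a map to `SU(2)` that is trivial near infinity is an integer. -/
theorem exists_int_integral_wz {H : E 3 → M} (hH : IsGauge H)
    (hc : HasCompactSupport fun x => H x - 1) :
    ∃ N : ℤ, ∫ x, wz H x = 24 * Real.pi ^ 2 * N := by
  have hdc : HasCompactSupport (fderiv ℝ H) := by
    refine (hc.fderiv (𝕜 := ℝ)).mono fun x hx h => hx ?_
    exact ((hH.differentiable x).hasFDerivAt.sub_const 1).fderiv.symm.trans h
  have hh : ContDiff ℝ ∞ fun x => vecPart (H x) := vecPart.contDiff.comp hH.smooth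
  obtain ⟨v, hv0, hv1, hreg⟩ := exists_regular_value (hh.differentiable (by simp))
  have hvp : 0 < ‖v‖ := norm_pos_iff.2 hv0
  -- The ball of this radius about `v` avoids 0 and stays within radius ρ < 1.
  set ε₀ := min ‖v‖ ((1 - ‖v‖) / 2) with hε₀
  have hε₀p : 0 < ε₀ := lt_min hvp (by linarith)
  set ρ := (1 + ‖v‖) / 2 with hρ
  have hball : ∀ y ∈ Metric.ball v ε₀, y ≠ 0 ∧ ‖y‖ ≤ ρ := by
    intro y hy
    have hy' : ‖y - v‖ < ε₀ := by simpa [dist_eq_norm] using hy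
    constructor
    · rintro rfl
      rw [zero_sub, norm_neg] at hy'
      exact absurd hy' (not_lt.2 (min_le_left _ _))
    · have h1 : ‖y‖ ≤ ‖y - v‖ + ‖v‖ := by simpa using norm_add_le (y - v) v
      have h2 : ε₀ ≤ (1 - ‖v‖) / 2 := min_le_right _ _
      rw [hρ]
      linarith
  -- A unit quaternion whose vector part has norm at most ρ has real part of absolute value at least
  -- δ.
  set δ := Real.sqrt (1 - ρ ^ 2) with hδdef
  have hρ2 : 0 < 1 - ρ ^ 2 := by rw [hρ]; nlinarith
  have hδ : 0 < δ := Real.sqrt_pos.2 hρ2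
  have hδ2 : δ ^ 2 = 1 - ρ ^ 2 := Real.sq_sqrt hρ2.le
  let K := tsupport (fun x => H x - 1) ∩ {x | scalPart (H x) ≤ -δ}
  have hK : IsCompact K := hc.isCompact.inter_right
    (isClosed_le (scalPart.continuous.comp hH.smooth.continuous) continuous_const)
  have hKW : K ⊆ lowerSet H := fun x hx => lt_of_le_of_lt hx.2 (neg_lt_zero.2 hδ)
  have hproper : ∀ x ∈ lowerSet H, vecPart (H x) ∈ Metric.ball v ε₀ → x ∈ K := by
    intro x hx hxb
    have hx' : scalPart (H x) < 0 := hx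
    obtain ⟨h1, h2⟩ := hball _ hxb
    refine ⟨subset_tsupport _ fun h => h1 ?_, ?_⟩
    · have h' : H x = 1 := sub_eq_zero.1 h
      rw [h', vecPart_apply]
      ext i
      fin_cases i <;> simp
    · change scalPart (H x) ≤ -δ
      have h3 := scalPart_sq_add (hH.mem x)
      have h4 := norm_nonneg (vecPart (H x))
      nlinarith
  obtain ⟨N, ε, hε, hN⟩ := exists_local_degree (hh.of_le (by simp)) (isOpen_lowerSet hH) hK hKW
    (fun x _ hx => hreg x hx) hε₀p hproper
  have hr : 0 < min ε ε₀ := lt_min hε hε₀p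
  let η : ContDiffBump v := ⟨min ε ε₀ / 2, min ε ε₀, by linarith, by linarith⟩
  have hηs : ∀ y, η y ≠ 0 → y ∈ Metric.ball v (min ε ε₀) := fun y hy => by
    have : y ∈ Function.support η := hy
    rwa [η.support_eq] at this
  have hηb : ∀ y, η y ≠ 0 → y ≠ 0 ∧ ‖y‖ ≤ ρ := fun y hy =>
    hball y (Metric.ball_subset_ball (min_le_right _ _) (hηs y hy))
  have hηδ : ∀ y, η y ≠ 0 → δ ^ 2 ≤ 1 - ‖y‖ ^ 2 := fun y hy => by
    have := (hηb y hy).2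
    rw [hδ2]
    nlinarith [norm_nonneg y]
  have hη0 : η 0 = 0 := by
    by_contra h
    exact (hηb 0 h).1 rfl
  have hη1 : ∀ y, 1 ≤ ‖y‖ → η y = 0 := fun y hy => by
    by_contra h
    have := (hηb y h).2
    rw [hρ] at this
    linarith
  have hηN := hN η η.continuous fun y hy =>
    Metric.ball_subset_ball (min_le_left _ _) (hηs y hy)
  -- Both maps are tested on the same bump on the lower half of SU(2): `H` gives N∫η and the model
  -- gives −∫η, each with the factor 12.
  have hprop := integral_mul_wz_proportional hH isGauge_model hdc hasCompactSupport_fderiv_model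
    (contDiff_lowerBump (η.contDiff (n := ⊤)) δ)
  rw [integral_lowerBump_mul_wz hH hδ hηδ, integral_lowerBump_mul_wz isGauge_model hδ hηδ,
    setIntegral_lowerSet_model hη0 hη1, hηN, integral_wz_model] at hprop
  have hpos : 0 < ∫ y, η y := η.integral_pos
  refine ⟨-N, mul_left_cancel₀ (mul_pos (by norm_num : (0 : ℝ) < 12) hpos).ne' ?_⟩
  push_cast
  linear_combination hprop

/-! ### Independence of the filling modulo ℤ. -/

lemma core_eq_ball (n : ℕ) : core n = Metric.ball (0 : E n) (Real.sqrt (1 / 2)) := by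
  ext x
  rw [mem_ball_zero_iff, Real.lt_sqrt (norm_nonneg x)]
  rfl

lemma isCompact_closure_core (n : ℕ) : IsCompact (closure (core n)) := by
  rw [core_eq_ball]
  exact Metric.isBounded_ball.isCompact_closure

lemma setIntegral_core {n : ℕ} [Nontrivial (E n)] {f : E n → ℝ}
    (hf : ∀ x ∉ closure (core n), f x = 0) : ∫ x in core n, f x = ∫ x, f x := by
  rw [← setIntegral_eq_integral_of_forall_compl_eq_zero (μ := volume) (f := f) hf]
  refine setIntegral_congr_set ?_
  have h0 : volume (Metric.sphere (0 : E n) (Real.sqrt (1 / 2))) = 0 := Measure.addHaar_sphere _ _ _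
  rw [core_eq_ball, closure_ball (0 : E n) (by positivity), ← Metric.ball_union_sphere]
  exact (union_ae_eq_left_of_ae_eq_empty (ae_eq_empty.2 h0)).symm

lemma hasCompactSupport_sub_one {n : ℕ} {H : E n → M} (h1 : ∀ x ∉ core n, H x = 1) :
    HasCompactSupport fun x => H x - 1 :=
  HasCompactSupport.intro (isCompact_closure_core n) fun x hx => by
    rw [h1 x fun h => hx (subset_closure h), sub_self]

lemma fderiv_eq_zero_of_core {n : ℕ} {H : E n → M} (h1 : ∀ x ∉ core n, H x = 1) {x : E n}
    (hx : x ∉ closure (core n)) : fderiv ℝ H x = 0 := by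
  have : H =ᶠ[𝓝 x] fun _ => 1 := by
    filter_upwards [isClosed_closure.isOpen_compl.mem_nhds hx] with y hy
    exact h1 y fun h => hy (subset_closure h)
  rw [this.fderiv_eq]
  simp

/-- Since `H` is constant off `core`, the exact term of the Polyakov–Wiegmann identity has compact
support and integrates to zero. -/
lemma setIntegral_core_wz_mul {H G : E 3 → M} (hH : IsGauge H) (hG : IsGauge G)
    (h1 : ∀ x ∉ core 3, H x = 1) :
    ∫ x in core 3, wz (fun y => H y * G y) x =
      (∫ x, wz H x) + ∫ x in core 3, wz G x := by
  have hω : ∀ i j, ∀ x ∉ closure (core 3), omega H G i j x = 0 := by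
    intro i j x hx
    simp [omega, lform, fderiv_eq_zero_of_core h1 hx]
  have hωc : ∀ i j, HasCompactSupport (omega H G i j) := fun i j =>
    HasCompactSupport.intro (isCompact_closure_core 3) (hω i j)
  have hωs := contDiff_omega hH hG
  have hpc : ∀ k i j, HasCompactSupport (pd k (omega H G i j)) := fun k i j =>
    hasCompactSupport_pd_const ((hωc i j).fderiv (𝕜 := ℝ)) k
  have hpi : ∀ k i j, Integrable (pd k (omega H G i j)) := fun k i j =>
    (contDiff_pd (hωs i j) k).continuous.integrable_of_hasCompactSupport (hpc k i j)
  have hp0 : ∀ k i j, ∀ x ∉ closure (core 3), pd k (omega H G i j) x = 0 := by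
    intro k i j x hx
    have : omega H G i j =ᶠ[𝓝 x] fun _ => 0 := by
      filter_upwards [isClosed_closure.isOpen_compl.mem_nhds hx] with y hy using hω i j y hy
    rw [pd, this.fderiv_eq]
    simp
  have hpz : ∀ k i j, ∫ x in core 3, pd k (omega H G i j) x = 0 := fun k i j => by
    rw [setIntegral_core (hp0 k i j),
      integral_pd_eq_zero ((hωs i j).of_le (by simp)) (hωc i j)]
  have hwH : Integrable (wz H) := (continuous_wz hH).integrable_of_hasCompactSupport
    (hasCompactSupport_wz (HasCompactSupport.intro (isCompact_closure_core 3)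
      fun x hx => fderiv_eq_zero_of_core h1 hx))
  have hwG : IntegrableOn (wz G) (core 3) :=
    ((continuous_wz hG).continuousOn.integrableOn_compact (isCompact_closure_core 3)).mono_set
      subset_closure
  have hw0 : ∀ x ∉ closure (core 3), wz H x = 0 := fun x hx => by
    rw [wz_eq_triple, triple]
    simp [lform, fderiv_eq_zero_of_core h1 hx]
  have hsum := ((hpi 0 1 2).integrableOn (s := core 3).fun_add (hpi 1 2 0).integrableOn).fun_add
    (hpi 2 0 1).integrableOn
  simp only [wz_mul hH hG]
  rw [integral_sub (hwH.integrableOn.fun_add hwG) (hsum.const_mul 3),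
    integral_add hwH.integrableOn hwG, integral_const_mul,
    integral_add ((hpi 0 1 2).integrableOn.fun_add (hpi 1 2 0).integrableOn)
      (hpi 2 0 1).integrableOn,
    integral_add (hpi 0 1 2).integrableOn (hpi 1 2 0).integrableOn, hpz, hpz, hpz,
    setIntegral_core hw0]
  ring

/-- Two maps on the ball that agree on the boundary sphere differ by an integer. -/
theorem exists_int_ballIntegral_sub {G₁ G₂ : GB}
    (h : ∀ x : Ball 3, ‖(x : E 3)‖ = 1 → (G₁ : Ball 3 → SU2) x = (G₂ : Ball 3 → SU2) x) :
    ∃ N : ℤ, ballIntegral G₁ - ballIntegral G₂ = N := by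
  obtain ⟨F₁, hF₁, hG₁⟩ := G₁.2
  obtain ⟨F₂, hF₂, hG₂⟩ := G₂.2
  have g₁ := isGauge_comp_flat hF₁ hG₁
  have g₂ := isGauge_comp_flat hF₂ hG₂
  have gH := g₁.mul g₂.conjTranspose
  -- The quotient of the two maps is 1 on the unit sphere, to which `flat` sends everything off
  -- `core`.
  have h1 : ∀ x ∉ core 3, F₁ (flat x) * (F₂ (flat x))ᴴ = 1 := by
    intro x hx
    have hn := norm_flat_eq_one hx
    have hb : flat x ∈ Ball 3 := by simpa using hn.le
    have e : F₁ (flat x) = F₂ (flat x) := by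
      rw [hG₁ ⟨_, hb⟩, hG₂ ⟨_, hb⟩, h ⟨_, hb⟩ hn]
    rw [e]
    exact g₂.mul_conjTranspose_self x
  obtain ⟨N, hN⟩ := exists_int_integral_wz gH (hasCompactSupport_sub_one h1)
  have key := setIntegral_core_wz_mul gH g₂ h1
  have e : (fun y => F₁ (flat y) * (F₂ (flat y))ᴴ * F₂ (flat y)) = fun y => F₁ (flat y) :=
    funext fun y => by
      rw [Matrix.mul_assoc, g₂.conjTranspose_mul_self y, Matrix.mul_one]
  rw [e, hN] at key
  refine ⟨-N, ?_⟩
  rw [ballIntegral_eq G₁ hG₁, ballIntegral_eq G₂ hG₂,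
    setIntegral_wz_flat (hF₁.differentiable (by simp)),
    setIntegral_wz_flat (hF₂.differentiable (by simp)), key]
  have := Real.pi_pos
  push_cast
  field_simp
  ring

lemma IsFilling.eq_on_sphere {q : E 2 → E 3} {g : GDS1} {G₁ G₂ : GB} (h₁ : IsFilling q g G₁)
    (h₂ : IsFilling q g G₂) (x : Ball 3) (hx : ‖(x : E 3)‖ = 1) :
    (G₁ : Ball 3 → SU2) x = (G₂ : Ball 3 → SU2) x := by
  have hy : (x : E 3) ∈ S2 := by simpa using hx
  obtain ⟨a₁, b₁⟩ := h₁ ⟨x, hy⟩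
  obtain ⟨a₂, b₂⟩ := h₂ ⟨x, hy⟩
  by_cases hq : (x : E 3) ∈ q '' Metric.ball 0 1
  · obtain ⟨z, hz, hzx⟩ := hq
    have hz' : ‖z‖ < 1 := by simpa using hz
    have hzb : z ∈ Ball 2 := Metric.ball_subset_closedBall hz
    exact (a₁ ⟨z, hzb⟩ hz' hzx).trans (a₂ ⟨z, hzb⟩ hz' hzx).symm
  · exact (b₁ hq).trans (b₂ hq).symm

lemma wzCochain_eq {q : E 2 → E 3} {g : GDS1} {G : GB} (hG : IsFilling q g G) :
    wzCochain q g = ((ballIntegral G : ℝ) : AddCircle (1 : ℝ)) := by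
  have h : ∃ G : GB, IsFilling q g G := ⟨G, hG⟩
  rw [wzCochain, dif_pos h]
  obtain ⟨N, hN⟩ := exists_int_ballIntegral_sub (h.choose_spec.eq_on_sphere hG)
  rw [← sub_eq_zero, ← AddCircle.coe_sub, hN, AddCircle.coe_eq_zero_iff]
  exact ⟨N, by simp⟩

/-! ### Contraction of a punctured SU(2) and radial fillings. -/

/-- The normalization of a nonzero quaternionic matrix. -/
def unitize (A : M) : M := (Real.sqrt A.det.re)⁻¹ • A

lemma det_re_qm (a b c d : ℝ) : (qm a b c d).det.re = a ^ 2 + b ^ 2 + c ^ 2 + d ^ 2 := by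
  rw [det_fin_two]
  simp [qm]
  ring

lemma smul_qm (s a b c d : ℝ) : s • qm a b c d = qm (s * a) (s * b) (s * c) (s * d) := by
  ext i j
  fin_cases i <;> fin_cases j <;> apply Complex.ext <;> simp [qm]

lemma unitize_mem {A : M} (hA : IsQuat A) (hd : 0 < A.det.re) :
    unitize A ∈ specialUnitaryGroup (Fin 2) ℂ := by
  obtain ⟨a, b, c, d, rfl⟩ : ∃ a b c d, A = qm a b c d := ⟨_, _, _, _, hA.eq_qm⟩
  rw [unitize, smul_qm, qm_mem_iff]
  rw [det_re_qm] at hd ⊢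
  have h : (Real.sqrt (a ^ 2 + b ^ 2 + c ^ 2 + d ^ 2))⁻¹ ^ 2 * (a ^ 2 + b ^ 2 + c ^ 2 + d ^ 2) = 1 := by
    rw [inv_pow, Real.sq_sqrt hd.le, inv_mul_cancel₀ hd.ne']
  linear_combination h

lemma unitize_of_mem {A : M} (hA : A ∈ specialUnitaryGroup (Fin 2) ℂ) : unitize A = A := by
  have h2 : A.det = 1 := hA.2
  simp [unitize, h2]

lemma contDiff_det_re : ContDiff ℝ ∞ fun A : M => A.det.re := by
  have h : ∀ i j, ContDiff ℝ ∞ fun A : M => A i j := fun i j =>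
    (LinearMap.toContinuousLinearMap
      { toFun := fun A : M => A i j
        map_add' := fun _ _ => rfl
        map_smul' := fun _ _ => rfl } : M →L[ℝ] ℂ).contDiff
  simp only [det_fin_two]
  exact Complex.reCLM.contDiff.comp (((h 0 0).mul (h 1 1)).sub ((h 0 1).mul (h 1 0)))

lemma contDiffAt_unitize {V : Type*} [NormedAddCommGroup V] [NormedSpace ℝ V] {A : V → M} {x : V}
    (hA : ContDiffAt ℝ ∞ A x) (hd : 0 < (A x).det.re) :
    ContDiffAt ℝ ∞ (fun y => unitize (A y)) x := by
  have h1 : ContDiffAt ℝ ∞ (fun y => (A y).det.re) x := contDiff_det_re.contDiffAt.comp x hA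
  exact ((h1.sqrt hd.ne').inv (Real.sqrt_pos.2 hd).ne').smul hA

/-- The segment from `c` to `w` in the quaternions. -/
def segmentTo (c : M) (s : ℝ) (w : M) : M := (1 - s) • c + s • w

lemma IsQuat.smul_add_smul {A B : M} (hA : IsQuat A) (hB : IsQuat B) (s t : ℝ) :
    IsQuat (s • A + t • B) := by
  rw [isQuat_iff] at *
  rw [map_add, map_smul, map_smul, hA, hB]
  simp

/-- If the line through two unit quaternions meets 0, comparing norms gives (1 − s)² = s², so s =
1/2 and the two are antipodal. -/
lemma det_re_segmentTo_pos {c w : M} (hc : c ∈ specialUnitaryGroup (Fin 2) ℂ)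
    (hw : w ∈ specialUnitaryGroup (Fin 2) ℂ) (hne : w ≠ -c) (s : ℝ) :
    0 < (segmentTo c s w).det.re := by
  have hq := (isQuat_of_mem hc).smul_add_smul (isQuat_of_mem hw) (1 - s) s
  obtain ⟨a, b, d, e, rfl⟩ : ∃ a b d e, c = qm a b d e := ⟨_, _, _, _, (isQuat_of_mem hc).eq_qm⟩
  obtain ⟨a', b', d', e', rfl⟩ : ∃ a b d e, w = qm a b d e :=
    ⟨_, _, _, _, (isQuat_of_mem hw).eq_qm⟩
  rw [qm_mem_iff] at hc hw
  have hs : segmentTo (qm a b d e) s (qm a' b' d' e') = qm ((1 - s) * a + s * a')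
      ((1 - s) * b + s * b') ((1 - s) * d + s * d') ((1 - s) * e + s * e') := by
    rw [segmentTo, smul_qm, smul_qm]
    ext i j
    fin_cases i <;> fin_cases j <;> apply Complex.ext <;> simp [qm] <;> ring
  rw [hs, det_re_qm]
  by_contra hcon
  apply hne
  have key : ∀ x y z t : ℝ, ¬0 < x ^ 2 + y ^ 2 + z ^ 2 + t ^ 2 → x = 0 ∧ y = 0 ∧ z = 0 ∧ t = 0 := by
    intro x y z t h
    have hx := sq_nonneg x
    have hy := sq_nonneg y
    have hz := sq_nonneg z
    have ht := sq_nonneg t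
    exact ⟨pow_eq_zero_iff two_ne_zero |>.1 (by linarith), pow_eq_zero_iff two_ne_zero |>.1
      (by linarith), pow_eq_zero_iff two_ne_zero |>.1 (by linarith),
      pow_eq_zero_iff two_ne_zero |>.1 (by linarith)⟩
  obtain ⟨h1, h2, h3, h4⟩ := key _ _ _ _ hcon
  have h5 : (1 - s) ^ 2 = s ^ 2 := by
    linear_combination (-(1 - s) ^ 2) * hc + s ^ 2 * hw + ((1 - s) * a - s * a') * h1 +
      ((1 - s) * b - s * b') * h2 + ((1 - s) * d - s * d') * h3 + ((1 - s) * e - s * e') * h4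
  have h6 : s = 1 / 2 := by nlinarith
  subst h6
  have e1 : a' = -a := by linarith
  have e2 : b' = -b := by linarith
  have e3 : d' = -d := by linarith
  have e4 : e' = -e := by linarith
  rw [e1, e2, e3, e4, ← neg_one_smul ℝ (qm a b d e), smul_qm]
  simp

/-- The contraction of `SU(2) ∖ {-c}` to `1` that keeps `1` fixed. -/
def contraction (c : M) (s : ℝ) (w : M) : M :=
  -- Normalized segments contract to c and move 1; the left factor brings the image of 1 back to 1.
  (unitize (segmentTo c s 1))ᴴ * unitize (segmentTo c s w)

lemma unitize_segmentTo_mem {c w : M} (hc : c ∈ specialUnitaryGroup (Fin 2) ℂ)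
    (hw : w ∈ specialUnitaryGroup (Fin 2) ℂ) (hne : w ≠ -c) (s : ℝ) :
    unitize (segmentTo c s w) ∈ specialUnitaryGroup (Fin 2) ℂ :=
  unitize_mem ((isQuat_of_mem hc).smul_add_smul (isQuat_of_mem hw) _ _)
    (det_re_segmentTo_pos hc hw hne s)

lemma contraction_mem {c w : M} (hc : c ∈ specialUnitaryGroup (Fin 2) ℂ) (hc1 : 1 ≠ -c)
    (hw : w ∈ specialUnitaryGroup (Fin 2) ℂ) (hne : w ≠ -c) (s : ℝ) :
    contraction c s w ∈ specialUnitaryGroup (Fin 2) ℂ :=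
  mul_mem (conjTranspose_mem (unitize_segmentTo_mem hc (one_mem _) hc1 s))
    (unitize_segmentTo_mem hc hw hne s)

lemma contraction_one_right {c : M} (hc : c ∈ specialUnitaryGroup (Fin 2) ℂ) (hc1 : 1 ≠ -c)
    (s : ℝ) : contraction c s 1 = 1 :=
  conjTranspose_mul_self_of_mem (unitize_segmentTo_mem hc (one_mem _) hc1 s)

lemma contraction_zero {c : M} (hc : c ∈ specialUnitaryGroup (Fin 2) ℂ) (w : M) :
    contraction c 0 w = 1 := by
  have : ∀ w, segmentTo c 0 w = c := fun w => by simp [segmentTo]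
  rw [contraction, this, this, unitize_of_mem hc, conjTranspose_mul_self_of_mem hc]

lemma contraction_one {c w : M} (hw : w ∈ specialUnitaryGroup (Fin 2) ℂ) :
    contraction c 1 w = w := by
  have : ∀ w, segmentTo c 1 w = w := fun w => by simp [segmentTo]
  rw [contraction, this, this, unitize_of_mem hw, unitize_of_mem (one_mem _)]
  simp

lemma contDiffAt_contraction {V : Type*} [NormedAddCommGroup V] [NormedSpace ℝ V] {c : M}
    (hc : c ∈ specialUnitaryGroup (Fin 2) ℂ) (hc1 : 1 ≠ -c) {χ : V → ℝ} {w : V → M} {x : V}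
    (hχ : ContDiffAt ℝ ∞ χ x) (hw : ContDiffAt ℝ ∞ w x)
    (hwx : w x ∈ specialUnitaryGroup (Fin 2) ℂ) (hne : w x ≠ -c) :
    ContDiffAt ℝ ∞ (fun y => contraction c (χ y) (w y)) x := by
  have hseg : ∀ {v : V → M}, ContDiffAt ℝ ∞ v x →
      ContDiffAt ℝ ∞ (fun y => segmentTo c (χ y) (v y)) x := fun hv =>
    ((contDiffAt_const.sub hχ).smul contDiffAt_const).add (hχ.smul hv)
  have h1 := contDiffAt_unitize (hseg (contDiffAt_const (c := (1 : M))))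
    (det_re_segmentTo_pos hc (one_mem _) hc1 (χ x))
  have h2 := contDiffAt_unitize (hseg hw) (det_re_segmentTo_pos hc hwx hne (χ x))
  exact (contDiff_conjTranspose.contDiffAt.comp x h1).mul h2

/-- A smooth map of the disk to `SU(2)` misses a point. -/
lemma exists_center (g : GDS1) : ∃ c ∈ specialUnitaryGroup (Fin 2) ℂ, (1 : M) ≠ -c ∧
    ∀ x, (((g : GD) : Ball 2 → SU2) x : M) ≠ -c := by
  obtain ⟨F, hF, hg⟩ := (g : GD).2
  have hentry : ∀ i, ContDiff ℝ ∞ fun A : M => A i 0 := fun i =>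
    (LinearMap.toContinuousLinearMap
      { toFun := fun A : M => A i 0
        map_add' := fun _ _ => rfl
        map_smul' := fun _ _ => rfl } : M →L[ℝ] ℂ).contDiff
  -- This is the cone over the image of `F`, with a quaternion recorded by its first column. Its
  -- source has real dimension 3 and its target 4, so it is not onto.
  let f : ℝ × E 2 → ℂ × ℂ := fun z => (z.1 • F z.2 0 0, z.1 • F z.2 1 0)
  have hf : ContDiff ℝ 1 f := by
    have h : ∀ i, ContDiff ℝ ∞ fun z : ℝ × E 2 => z.1 • F z.2 i 0 := fun i =>
      contDiff_fst.smul ((hentry i).comp (hF.comp contDiff_snd))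
    exact ((h 0).prodMk (h 1)).of_le (by simp)
  have hdim : Module.finrank ℝ (ℝ × E 2) < Module.finrank ℝ (ℂ × ℂ) := by
    simp [Module.finrank_prod, Complex.finrank_real_complex]
  obtain ⟨p, hp⟩ := (hf.dense_compl_range_of_finrank_lt_finrank hdim).nonempty
  have hr : 0 < p.1.re ^ 2 + p.1.im ^ 2 + p.2.re ^ 2 + p.2.im ^ 2 := by
    by_contra hcon
    apply hp
    refine ⟨(0, 0), ?_⟩
    have h1 := sq_nonneg p.1.re
    have h2 := sq_nonneg p.1.im
    have h3 := sq_nonneg p.2.re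
    have h4 := sq_nonneg p.2.im
    have e1 : p.1.re = 0 := pow_eq_zero_iff two_ne_zero |>.1 (by linarith)
    have e2 : p.1.im = 0 := pow_eq_zero_iff two_ne_zero |>.1 (by linarith)
    have e3 : p.2.re = 0 := pow_eq_zero_iff two_ne_zero |>.1 (by linarith)
    have e4 : p.2.im = 0 := pow_eq_zero_iff two_ne_zero |>.1 (by linarith)
    have h5 : p.1 = 0 := Complex.ext e1 e2
    have h6 : p.2 = 0 := Complex.ext e3 e4
    exact Prod.ext (by simp [f, h5]) (by simp [f, h6])
  let A := qm p.1.re p.1.im p.2.re p.2.im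
  have hAd : 0 < A.det.re := by rw [det_re_qm]; exact hr
  have hA := unitize_mem (isQuat_qm _ _ _ _) hAd
  have hmiss : ∀ x, (((g : GD) : Ball 2 → SU2) x : M) ≠ unitize A := by
    intro x hx
    apply hp
    have hs := Real.sqrt_pos.2 hAd
    have hsm : Real.sqrt A.det.re • unitize A = A := by
      rw [unitize, smul_smul, mul_inv_cancel₀ hs.ne', one_smul]
    refine ⟨(Real.sqrt A.det.re, x), ?_⟩
    simp only [f]
    rw [hg x, hx]
    have e0 := congrFun (congrFun hsm 0) 0
    have e1 := congrFun (congrFun hsm 1) 0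
    rw [Matrix.smul_apply] at e0 e1
    rw [e0, e1]
    simp [A, qm]
  have hb : (ee 0 : E 2) ∈ Ball 2 := by simp
  have hneg : -unitize A ∈ specialUnitaryGroup (Fin 2) ℂ := by
    have : -unitize A = unitize A * qm (-1) 0 0 0 := by
      have : qm (-1) 0 0 0 = -1 := by
        ext i j; fin_cases i <;> fin_cases j <;> apply Complex.ext <;> simp [qm]
      rw [this, Matrix.mul_neg, Matrix.mul_one]
    rw [this]
    exact mul_mem hA (qm_mem_iff.2 (by norm_num))
  refine ⟨-unitize A, hneg, ?_, fun x => by rw [neg_neg]; exact hmiss x⟩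
  -- The value 1 is attained on the boundary circle, so the missed point is not 1.
  have h1 := g.2 ⟨ee 0, hb⟩ (by simp)
  have h2 := hmiss ⟨ee 0, hb⟩
  rw [h1] at h2
  rw [neg_neg]
  simpa using h2

/-- A cutoff function that is `0` near the origin and `1` near `1`. -/
def cutoff (r : ℝ) : ℝ := Real.smoothTransition (4 * r - 1)

lemma contDiff_cutoff : ContDiff ℝ ∞ cutoff :=
  Real.smoothTransition.contDiff.comp ((contDiff_const.mul contDiff_id).sub contDiff_const)

lemma cutoff_of_le {r : ℝ} (hr : r ≤ 1 / 4) : cutoff r = 0 :=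
  Real.smoothTransition.zero_of_nonpos (by linarith)

lemma cutoff_of_ge {r : ℝ} (hr : 1 / 2 ≤ r) : cutoff r = 1 :=
  Real.smoothTransition.one_of_one_le (by linarith)

/-- The radial extension of the map that is induced by `g` on the sphere. -/
lemma exists_radial_filling {q : E 2 → E 3} (hq : IsCollapse q) (g : GDS1) {c : M}
    (hc : c ∈ specialUnitaryGroup (Fin 2) ℂ) (hc1 : 1 ≠ -c)
    (hcg : ∀ x, (((g : GD) : Ball 2 → SU2) x : M) ≠ -c) :
    ∃ G : E 3 → M, IsGauge G ∧
      (∀ r > 0, ∀ x : Ball 2, ‖(x : E 2)‖ < 1 →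
        G (r • q x) = contraction c (cutoff r) (((g : GD) : Ball 2 → SU2) x)) ∧
      ∀ y, y ≠ 0 → ‖y‖⁻¹ • y ∉ q '' Metric.ball 0 1 → G y = 1 := by
  obtain ⟨u, ⟨F, hF, hFu⟩, hu⟩ := hq.smooth_induced g
  have hune : ∀ y, (u y : M) ≠ -c := by
    intro y
    by_cases hy : (y : E 3) ∈ q '' Metric.ball 0 1
    · obtain ⟨x, hx, hxy⟩ := hy
      rw [(hu y).1 ⟨x, Metric.ball_subset_closedBall hx⟩ (by simpa using hx) hxy]
      exact hcg _
    · rw [(hu y).2 hy]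
      exact hc1
  have hS : ∀ y : E 3, y ≠ 0 → ‖y‖⁻¹ • y ∈ S2 := fun y hy => by
    simp [norm_smul, inv_mul_cancel₀ (norm_ne_zero_iff.2 hy)]
  -- The contraction runs along the radius. The cutoff makes the map 1 near the origin, hence smooth
  -- there, and independent of the radius for ‖y‖ ≥ 1/2.
  let G : E 3 → M := fun y => contraction c (cutoff ‖y‖) (F (‖y‖⁻¹ • y))
  have hG0 : ∀ y, ‖y‖ ≤ 1 / 4 → G y = 1 := fun y hy => by
    simp only [G, cutoff_of_le hy, contraction_zero hc]
  have hGy : ∀ y (hy : y ≠ 0), G y = contraction c (cutoff ‖y‖) (u ⟨_, hS y hy⟩) := fun y hy => by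
    simp only [G]
    rw [← hFu ⟨_, hS y hy⟩]
  refine ⟨G, ⟨?_, ?_⟩, ?_, ?_⟩
  · rw [contDiff_iff_contDiffAt]
    intro y
    rcases lt_or_ge ‖y‖ (1 / 4) with h | h
    · refine (contDiffAt_const (c := (1 : M))).congr_of_eventuallyEq ?_
      filter_upwards [(isOpen_lt continuous_norm continuous_const).mem_nhds h] with z hz
      exact hG0 z (le_of_lt hz)
    · have hy : y ≠ 0 := by
        rintro rfl
        norm_num at h
      have hn : ContDiffAt ℝ ∞ (fun z : E 3 => ‖z‖) y := contDiffAt_norm ℝ hy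
      have hn0 : ‖y‖ ≠ 0 := norm_ne_zero_iff.2 hy
      refine contDiffAt_contraction hc hc1 (contDiff_cutoff.contDiffAt.comp y hn)
        (hF.contDiffAt.comp y ((hn.inv hn0).smul contDiffAt_id)) ?_ ?_
      · rw [hFu ⟨_, hS y hy⟩]; exact (u _).2
      · rw [hFu ⟨_, hS y hy⟩]; exact hune _
  · intro y
    by_cases hy : y = 0
    · rw [hG0 y (by rw [hy]; norm_num)]; exact one_mem _
    · rw [hGy y hy]; exact contraction_mem hc hc1 (u _).2 (hune _) _
  · intro r hr x hx
    have hqx : ‖q x‖ = 1 := by simpa using hq.mapsTo (show (x : E 2) ∈ Metric.ball 0 1 by simpa)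
    have hne : r • q x ≠ 0 := by
      rw [← norm_ne_zero_iff, norm_smul, hqx, Real.norm_eq_abs, abs_of_pos hr]
      simpa using hr.ne'
    have hnr : ‖r • q x‖ = r := by rw [norm_smul, hqx, Real.norm_eq_abs, abs_of_pos hr, mul_one]
    have hval := (hu ⟨_, hS _ hne⟩).1 x hx (by
      simp only [hnr, smul_smul, inv_mul_cancel₀ hr.ne', one_smul])
    rw [hGy _ hne, hval, hnr]
  · intro y hy hyq
    rw [hGy y hy, (hu ⟨_, hS y hy⟩).2 hyq]
    exact contraction_one_right hc hc1 _

/-- A smooth map from `ℝ³` to `SU(2)`, restricted to the ball. -/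
def IsGauge.toGB {G : E 3 → M} (hG : IsGauge G) : GB :=
  ⟨fun x => ⟨G x, hG.mem x⟩, G, hG.smooth, fun _ => rfl⟩

lemma isFilling_toGB {q : E 2 → E 3} {g : GDS1} {G : E 3 → M} (hG : IsGauge G)
    (h1 : ∀ x : Ball 2, ‖(x : E 2)‖ < 1 → G (q x) = (((g : GD) : Ball 2 → SU2) x : M))
    (h2 : ∀ y, ‖y‖ = 1 → y ∉ q '' Metric.ball 0 1 → G y = 1) : IsFilling q g hG.toGB := by
  intro y
  have hy : ‖(y : E 3)‖ = 1 := by simp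
  constructor
  · intro x hx hxy
    apply Subtype.ext
    change G y = _
    rw [← hxy, h1 x hx]
  · intro hyq
    apply Subtype.ext
    exact h2 y hy hyq

/-! ### Cylinder coordinates on the ball. -/

/-- The projection of `ℝ³` to its last two coordinates. -/
def tail : E 3 →L[ℝ] E 2 :=
  LinearMap.toContinuousLinearMap
    { toFun := fun z => !₂[z 1, z 2]
      map_add' := fun a b => by ext i; fin_cases i <;> simp
      map_smul' := fun c a => by ext i; fin_cases i <;> simp }

lemma tail_apply (z : E 3) : tail z = !₂[z 1, z 2] := rfl

@[simp] lemma tail_ee_zero : tail (ee 0) = 0 := by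
  ext i; fin_cases i <;> simp [tail_apply]

@[simp] lemma tail_ee_one : tail (ee 1) = ee 0 := by
  ext i; fin_cases i <;> simp [tail_apply]

@[simp] lemma tail_ee_two : tail (ee 2) = ee 1 := by
  ext i; fin_cases i <;> simp [tail_apply]

/-- The point of `ℝ³` with first coordinate `r` and last coordinates `x`. -/
def cons (r : ℝ) (x : E 2) : E 3 := !₂[r, x 0, x 1]

@[simp] lemma cons_zero (r : ℝ) (x : E 2) : cons r x 0 = r := by simp [cons]

@[simp] lemma tail_cons (r : ℝ) (x : E 2) : tail (cons r x) = x := by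
  ext i; fin_cases i <;> simp [tail_apply, cons]

@[simp] lemma cons_tail (z : E 3) : cons (z 0) (tail z) = z := by
  ext i; fin_cases i <;> simp [tail_apply, cons]

lemma hasDerivAt_cons (x : E 2) (r : ℝ) : HasDerivAt (fun s => cons s x) (ee 0) r := by
  have h : (fun s => cons s x) = fun s => cons 0 x + s • ee 0 := by
    funext s
    ext i; fin_cases i <;> simp [cons]
  rw [h]
  simpa using ((hasDerivAt_id r).smul_const (ee 0 : E 3)).const_add (cons 0 x)

/-- The splitting of `ℝ³` into the first and the last two coordinates. -/
def splitEquiv : E 3 ≃ᵐ ℝ × E 2 :=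
  (MeasurableEquiv.toLp 2 (Fin 3 → ℝ)).symm.trans
    ((MeasurableEquiv.piFinSuccAbove (fun _ : Fin 3 => ℝ) 0).trans
      ((MeasurableEquiv.refl ℝ).prodCongr (MeasurableEquiv.toLp 2 (Fin 2 → ℝ))))

lemma splitEquiv_apply (z : E 3) : splitEquiv z = (z 0, tail z) := by
  refine Prod.ext rfl ?_
  ext i; fin_cases i <;> rfl

lemma measurePreserving_splitEquiv : MeasurePreserving splitEquiv :=
  ((MeasurePreserving.id volume).prod (PiLp.volume_preserving_toLp (Fin 2))).comp
    ((volume_preserving_piFinSuccAbove (fun _ : Fin 3 => ℝ) 0).comp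
      (EuclideanSpace.volume_preserving_symm_measurableEquiv_toLp (Fin 3)))

/-- The cylinder over `core 2`. -/
def cyl : Set (E 3) := {z | 0 < z 0 ∧ z 0 < 1 ∧ tail z ∈ core 2}

lemma cyl_eq : cyl = splitEquiv ⁻¹' (Set.Ioo 0 1 ×ˢ core 2) := by
  ext z
  simp [cyl, splitEquiv_apply, and_assoc]

lemma continuous_apply_zero : Continuous fun z : E 3 => z 0 := by fun_prop

lemma isOpen_cyl : IsOpen cyl :=
  (isOpen_lt continuous_const continuous_apply_zero).inter
    ((isOpen_lt continuous_apply_zero continuous_const).inter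
      (isOpen_core.preimage tail.continuous))

lemma continuous_cons : Continuous fun p : ℝ × E 2 => cons p.1 p.2 := by
  have h : (fun p : ℝ × E 2 => cons p.1 p.2) = fun p =>
      p.1 • ee 0 + (p.2 0 • ee 1 + p.2 1 • ee 2) := by
    funext p
    ext i; fin_cases i <;> simp [cons]
  rw [h]
  fun_prop

/-- A compact box that contains the cylinder. -/
def cylBox : Set (E 3) := (fun p : ℝ × E 2 => cons p.1 p.2) '' (Set.Icc 0 1 ×ˢ closure (core 2))

lemma isCompact_cylBox : IsCompact cylBox :=
  (isCompact_Icc.prod (isCompact_closure_core 2)).image continuous_cons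

lemma cyl_subset_cylBox : cyl ⊆ cylBox := fun z hz =>
  ⟨(z 0, tail z), ⟨⟨hz.1.le, hz.2.1.le⟩, subset_closure hz.2.2⟩, cons_tail z⟩

lemma integrableOn_cyl {f : E 3 → ℝ} (hf : Continuous f) : IntegrableOn f cyl :=
  (hf.continuousOn.integrableOn_compact isCompact_cylBox).mono_set cyl_subset_cylBox

/-- Fubini and the fundamental theorem of calculus along the axis of the cylinder. -/
lemma setIntegral_cyl_pd_zero {f : E 3 → ℝ} (hf : ContDiff ℝ ∞ f) :
    ∫ z in cyl, pd 0 f z = ∫ x in core 2, (f (cons 1 x) - f (cons 0 x)) := by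
  have hc : Continuous (pd 0 f) := (contDiff_pd hf 0).continuous
  have h1 : ∫ z in cyl, pd 0 f z =
      ∫ p in Set.Ioo (0 : ℝ) 1 ×ˢ core 2, pd 0 f (cons p.1 p.2) := by
    rw [cyl_eq, ← measurePreserving_splitEquiv.setIntegral_preimage_emb
      splitEquiv.measurableEmbedding]
    simp only [splitEquiv_apply, cons_tail]
  have hInt : IntegrableOn (fun p : ℝ × E 2 => pd 0 f (cons p.1 p.2))
      (Set.Ioo (0 : ℝ) 1 ×ˢ core 2) :=
    ((hc.comp continuous_cons).continuousOn.integrableOn_compact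
      (isCompact_Icc.prod (isCompact_closure_core 2))).mono_set
      (Set.prod_mono Set.Ioo_subset_Icc_self subset_closure)
  rw [h1]
  rw [IntegrableOn, Measure.volume_eq_prod, ← Measure.prod_restrict] at hInt
  rw [Measure.volume_eq_prod, ← Measure.prod_restrict, integral_prod_symm _ hInt]
  refine integral_congr_ae (Filter.Eventually.of_forall fun x => ?_)
  simp only
  rw [← integral_Ioc_eq_integral_Ioo, ← intervalIntegral.integral_of_le zero_le_one]
  refine intervalIntegral.integral_eq_sub_of_hasDerivAt (f := fun r => f (cons r x))
    (fun r _ => ?_) ?_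
  · exact ((hf.differentiable (by simp)) (cons r x)).hasFDerivAt.comp_hasDerivAt r
      (hasDerivAt_cons x r)
  · exact (hc.comp (continuous_cons.comp (Continuous.prodMk_left x))).intervalIntegrable 0 1

lemma det_of_rows (a b c : Fin 3 → ℝ) : Matrix.det (Matrix.of ![a, b, c]) =
    a 0 * b 1 * c 2 - a 0 * b 2 * c 1 - a 1 * b 0 * c 2 + a 1 * b 2 * c 0 + a 2 * b 0 * c 1 -
      a 2 * b 1 * c 0 := by
  rw [det_fin_three]
  rfl

lemma det_frame (y : Fin 3 → ℝ) (L : E 2 →L[ℝ] E 3) (A : E 2 →L[ℝ] E 2) :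
    Matrix.det (Matrix.of ![y, (L (A (ee 0))).ofLp, (L (A (ee 1))).ofLp]) =
      A.det * Matrix.det (Matrix.of ![y, (L (ee 0)).ofLp, (L (ee 1)).ofLp]) := by
  have h : ∀ v : E 2, v = v 0 • ee 0 + v 1 • ee 1 := fun v => by
    ext i; fin_cases i <;> simp
  have hL : ∀ v : E 2, ∀ i, L v i = v 0 * L (ee 0) i + v 1 * L (ee 1) i := fun v i => by
    conv_lhs => rw [h v]
    simp
  rw [det_eq_toLin, det_of_rows, det_of_rows, det_fin_two]
  simp only [hL (A _), of_apply]
  ring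

/-- Polar coordinates on the cone over the image of `q`. -/
def cone (q : E 2 → E 3) (z : E 3) : E 3 := z 0 • q (flat (tail z))

/-- The derivative of `cone q`. -/
def coneDeriv (q : E 2 → E 3) (z : E 3) : E 3 →L[ℝ] E 3 :=
  z 0 • ((fderiv ℝ q (flat (tail z))).comp ((flatDeriv (tail z)).comp tail)) +
    (EuclideanSpace.proj 0 : E 3 →L[ℝ] ℝ).smulRight (q (flat (tail z)))

section cone

variable {q : E 2 → E 3}

lemma flat_mem_ball {z : E 3} (hz : z ∈ cyl) : flat (tail z) ∈ Metric.ball (0 : E 2) 1 :=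
  mem_ball_zero_iff.2 (flat_mem_ball_iff.2 hz.2.2)

lemma hasFDerivAt_cone (hq : IsCollapse q) {z : E 3} (hz : z ∈ cyl) :
    HasFDerivAt (cone q) (coneDeriv q z) z := by
  have h1 : HasFDerivAt q (fderiv ℝ q (flat (tail z))) (flat (tail z)) :=
    ((hq.smooth.contDiffAt (Metric.isOpen_ball.mem_nhds (flat_mem_ball hz))).differentiableAt
      (by simp)).hasFDerivAt
  have h2 := h1.comp z ((hasFDerivAt_flat (tail z)).comp z tail.hasFDerivAt)
  exact (EuclideanSpace.proj 0 : E 3 →L[ℝ] ℝ).hasFDerivAt.smul h2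

lemma det_coneDeriv (hq : IsCollapse q) {z : E 3} (hz : z ∈ cyl) : 0 < (coneDeriv q z).det := by
  have h1 := hq.oriented _ (flat_mem_ball hz)
  have h2 := det_flatDeriv_two hz.2.2
  -- The Jacobian is r² times that of `flat` times the orientation determinant of `q`.
  have h3 := mul_pos (pow_pos hz.1 2) (mul_pos h2 h1)
  refine h3.trans_eq ?_
  have e0 : coneDeriv q z (ee 0) = q (flat (tail z)) := by
    simp only [coneDeriv, _root_.add_apply, _root_.smul_apply, ContinuousLinearMap.comp_apply,
      tail_ee_zero, map_zero]
    simp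
  have e1 : coneDeriv q z (ee 1) = z 0 • fderiv ℝ q (flat (tail z)) (flatDeriv (tail z) (ee 0)) := by
    simp only [coneDeriv, _root_.add_apply, _root_.smul_apply, ContinuousLinearMap.comp_apply,
      tail_ee_one]
    simp
  have e2 : coneDeriv q z (ee 2) = z 0 • fderiv ℝ q (flat (tail z)) (flatDeriv (tail z) (ee 1)) := by
    simp only [coneDeriv, _root_.add_apply, _root_.smul_apply, ContinuousLinearMap.comp_apply,
      tail_ee_two]
    simp
  rw [← det_frame, det_eq_toLin, det_of_rows, det_fin_three]
  simp only [of_apply, e0, e1, e2, PiLp.smul_apply, smul_eq_mul]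
  ring

lemma norm_cone (hq : IsCollapse q) {z : E 3} (hz : z ∈ cyl) : ‖cone q z‖ = z 0 := by
  have h : ‖q (flat (tail z))‖ = 1 := by simpa using hq.mapsTo (flat_mem_ball hz)
  rw [cone, norm_smul, h, mul_one, Real.norm_eq_abs, abs_of_pos hz.1]

lemma injOn_cone (hq : IsCollapse q) : Set.InjOn (cone q) cyl := by
  intro z hz w hw h
  have h0 : z 0 = w 0 := by rw [← norm_cone hq hz, ← norm_cone hq hw, h]
  rw [cone, cone, h0] at h
  have h1 := hq.injOn (flat_mem_ball hz) (flat_mem_ball hw)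
    (smul_right_injective _ hw.1.ne' h)
  rw [← cons_tail z, ← cons_tail w, h0, injOn_flat hz.2.2 hw.2.2 h1]

lemma image_cone_subset (hq : IsCollapse q) : cone q '' cyl ⊆ Metric.ball 0 1 := by
  rintro _ ⟨z, hz, rfl⟩
  rw [mem_ball_zero_iff, norm_cone hq hz]
  exact hz.2.1

lemma mem_image_cone {y : E 3} (hy : y ≠ 0) (hy1 : ‖y‖ < 1)
    (hyq : ‖y‖⁻¹ • y ∈ q '' Metric.ball 0 1) : y ∈ cone q '' cyl := by
  obtain ⟨x, hx, hxy⟩ := hyq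
  rw [← image_flat] at hx
  obtain ⟨u, hu, rfl⟩ := hx
  refine ⟨cons ‖y‖ u, ⟨by simpa using hy, by simpa using hy1, by simpa using hu⟩, ?_⟩
  rw [cone, tail_cons, cons_zero, hxy, smul_smul, mul_inv_cancel₀ (norm_ne_zero_iff.2 hy), one_smul]

end cone

/-- The set `S` need not have interior: at almost every point of a measurable set on which a map is
constant, the derivative vanishes. This is needed because the complement of the image of a collapse
may have positive measure and empty interior. -/
lemma ae_wz_eq_zero {G : E 3 → M} (hG : IsGauge G) {S : Set (E 3)} (hS : MeasurableSet S)
    (h : ∀ x ∈ S, G x = 1) : ∀ᵐ x ∂volume.restrict S, wz G x = 0 := by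
  have ha : ApproximatesLinearOn (fun y => vecPart (G y)) (0 : E 3 →L[ℝ] E 3) S 0 := by
    intro x hx y hy
    simp [h x hx, h y hy]
  have hd : Differentiable ℝ fun y => vecPart (G y) :=
    vecPart.differentiable.comp hG.differentiable
  filter_upwards [ha.norm_fderiv_sub_le volume hS (fderiv ℝ fun y => vecPart (G y))
    fun x _ => (hd x).hasFDerivAt.hasFDerivWithinAt, ae_restrict_mem hS] with x hx hxS
  have h1 : scalPart (G x) = 1 := by rw [h x hxS, scalPart_apply]; simp
  have h2 := hG.scalPart_mul_wz (x := x) (by rw [h1]; exact one_ne_zero)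
  have h3 : fderiv ℝ (fun y => vecPart (G y)) x = 0 := by simpa using hx
  rw [h1, h3, one_mul] at h2
  rw [h2, det_eq_toLin, det_fin_three]
  simp

/-- The cone covers the ball except for the origin and the rays that miss the image of `q`; on those
rays `G` is 1. -/
lemma setIntegral_ball_wz {q : E 2 → E 3} (hq : IsCollapse q) {G : E 3 → M} (hG : IsGauge G)
    (h1 : ∀ y, y ≠ 0 → ‖y‖⁻¹ • y ∉ q '' Metric.ball 0 1 → G y = 1) {K : E 3 → M}
    (hK : ∀ z ∈ cyl, K z = G (cone q z)) :
    ∫ y in Metric.ball (0 : E 3) 1, wz G y = ∫ z in cyl, wz K z := by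
  rw [← setIntegral_wz_image isOpen_cyl (fun z hz => hasFDerivAt_cone hq hz) (injOn_cone hq)
    (fun z hz => det_coneDeriv hq hz) hG.differentiable hK]
  have hm : MeasurableSet (cone q '' cyl) := measurable_image_of_fderivWithin
    isOpen_cyl.measurableSet (fun z hz => (hasFDerivAt_cone hq hz).hasFDerivWithinAt)
    (injOn_cone hq)
  have hS : MeasurableSet ((Metric.ball (0 : E 3) 1 \ cone q '' cyl) \ {0}) :=
    (Metric.isOpen_ball.measurableSet.diff hm).diff (measurableSet_singleton 0)
  have hz := ae_wz_eq_zero hG hS fun y hy => by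
    by_cases hyq : ‖y‖⁻¹ • y ∈ q '' Metric.ball 0 1
    · exact absurd (mem_image_cone hy.2 (mem_ball_zero_iff.1 hy.1.1) hyq) hy.1.2
    · exact h1 y hy.2 hyq
  rw [ae_restrict_iff' hS] at hz
  refine setIntegral_eq_of_subset_of_ae_sdiff_eq_zero
    Metric.isOpen_ball.measurableSet.nullMeasurableSet (image_cone_subset hq) ?_
  filter_upwards [hz, compl_mem_ae_iff.2 (measure_singleton (μ := volume) (0 : E 3))] with y hy h0 hyd
  exact hy ⟨hyd, h0⟩

/-! ### Stokes' theorem on the cylinder. -/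

/-- The radial extension of a map on the disk, in the coordinates of the cylinder. -/
def cylGauge (c : M) (F : E 2 → M) (z : E 3) : M :=
  contraction c (cutoff (z 0)) (F (flat (tail z)))

lemma cylGauge_of_le {c : M} (hc : c ∈ specialUnitaryGroup (Fin 2) ℂ) (F : E 2 → M) {z : E 3}
    (hz : z 0 ≤ 1 / 4) : cylGauge c F z = 1 := by
  rw [cylGauge, cutoff_of_le hz, contraction_zero hc]

lemma fderiv_eq_zero_of_eventuallyEq_one {G : E 3 → M} {z : E 3} (h : G =ᶠ[𝓝 z] fun _ => 1) :
    fderiv ℝ G z = 0 := by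
  rw [h.fderiv_eq]
  simp

lemma fderiv_cylGauge_of_lt {c : M} (hc : c ∈ specialUnitaryGroup (Fin 2) ℂ) (F : E 2 → M) {z : E 3}
    (hz : z 0 < 1 / 4) : fderiv ℝ (cylGauge c F) z = 0 := by
  refine fderiv_eq_zero_of_eventuallyEq_one ?_
  filter_upwards [(isOpen_lt continuous_apply_zero continuous_const).mem_nhds hz] with w hw
  exact cylGauge_of_le hc F (le_of_lt hw)

section cylGauge

variable {g : GDS1} {F : E 2 → M} {c : M}

lemma apply_flat_mem (hg : ∀ x : Ball 2, F x = (((g : GD) : Ball 2 → SU2) x : M)) (x : E 2) :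
    F (flat x) ∈ specialUnitaryGroup (Fin 2) ℂ := by
  rw [hg ⟨flat x, by simpa using norm_flat_le x⟩]
  exact (((g : GD) : Ball 2 → SU2) _).2

lemma apply_flat_of_notMem_core (hg : ∀ x : Ball 2, F x = (((g : GD) : Ball 2 → SU2) x : M)) {x : E 2}
    (hx : x ∉ core 2) : F (flat x) = 1 := by
  rw [hg ⟨flat x, by simpa using norm_flat_le x⟩, g.2 ⟨flat x, _⟩ (norm_flat_eq_one hx)]
  rfl

lemma isGauge_cylGauge (hF : ContDiff ℝ ∞ F)
    (hg : ∀ x : Ball 2, F x = (((g : GD) : Ball 2 → SU2) x : M))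
    (hc : c ∈ specialUnitaryGroup (Fin 2) ℂ) (hc1 : 1 ≠ -c)
    (hcg : ∀ x, (((g : GD) : Ball 2 → SU2) x : M) ≠ -c) : IsGauge (cylGauge c F) := by
  have hne : ∀ z : E 3, F (flat (tail z)) ≠ -c := fun z => by
    rw [hg ⟨flat (tail z), by simpa using norm_flat_le (tail z)⟩]
    exact hcg _
  refine ⟨contDiff_iff_contDiffAt.2 fun z => ?_, fun z =>
    contraction_mem hc hc1 (apply_flat_mem hg _) (hne z) _⟩
  refine contDiffAt_contraction hc hc1 ?_ ?_ (apply_flat_mem hg _) (hne z)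
  · exact (contDiff_cutoff.comp (EuclideanSpace.proj 0 : E 3 →L[ℝ] ℝ).contDiff).contDiffAt
  · exact (hF.comp (contDiff_flat.comp tail.contDiff)).contDiffAt

lemma fderiv_cylGauge_of_notMem (hg : ∀ x : Ball 2, F x = (((g : GD) : Ball 2 → SU2) x : M))
    (hc : c ∈ specialUnitaryGroup (Fin 2) ℂ) (hc1 : 1 ≠ -c) {z : E 3}
    (hz : tail z ∉ closure (core 2)) : fderiv ℝ (cylGauge c F) z = 0 := by
  refine fderiv_eq_zero_of_eventuallyEq_one ?_
  filter_upwards [(isClosed_closure.isOpen_compl.preimage tail.continuous).mem_nhds hz] with w hw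
  rw [cylGauge, apply_flat_of_notMem_core hg fun h => hw (subset_closure h),
    contraction_one_right hc hc1]

lemma cylGauge_eventuallyEq (hg : ∀ x : Ball 2, F x = (((g : GD) : Ball 2 → SU2) x : M)) (c : M)
    {z : E 3} (hz : 1 / 2 < z 0) : cylGauge c F =ᶠ[𝓝 z] (fun x => F (flat x)) ∘ tail := by
  filter_upwards [(isOpen_lt continuous_const continuous_apply_zero).mem_nhds hz] with w hw
  rw [cylGauge, cutoff_of_ge (le_of_lt hw), contraction_one (apply_flat_mem hg _)]
  rfl

lemma lform_cylGauge (hF : ContDiff ℝ ∞ F)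
    (hg : ∀ x : Ball 2, F x = (((g : GD) : Ball 2 → SU2) x : M)) (c : M) {z : E 3}
    (hz : 1 / 2 < z 0) (v : E 3) :
    lform (cylGauge c F) z v = lform (fun x => F (flat x)) (tail z) (tail v) :=
  lform_comp (((hF.comp contDiff_flat).differentiable (by simp)) _) tail.hasFDerivAt
    (cylGauge_eventuallyEq hg c hz) v

lemma rform_cylGauge (hF : ContDiff ℝ ∞ F)
    (hg : ∀ x : Ball 2, F x = (((g : GD) : Ball 2 → SU2) x : M)) (c : M) {z : E 3}
    (hz : 1 / 2 < z 0) (v : E 3) :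
    rform (cylGauge c F) z v = rform (fun x => F (flat x)) (tail z) (tail v) :=
  rform_comp (((hF.comp contDiff_flat).differentiable (by simp)) _) tail.hasFDerivAt
    (cylGauge_eventuallyEq hg c hz) v

end cylGauge

lemma ae_tail_notMem_sphere : ∀ᵐ z : E 3, tail z ∉ closure (core 2) \ core 2 := by
  have h0 : volume (closure (core 2) \ core 2) = 0 := by
    refine measure_mono_null ?_ (Measure.addHaar_sphere volume (0 : E 2) (Real.sqrt (1 / 2)))
    rw [core_eq_ball, closure_ball (0 : E 2) (by positivity), Metric.closedBall_sdiff_ball]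
  have h1 : volume (splitEquiv ⁻¹' (Set.univ ×ˢ (closure (core 2) \ core 2))) = 0 := by
    rw [measurePreserving_splitEquiv.measure_preimage_equiv, Measure.volume_eq_prod,
      Measure.prod_prod, h0, mul_zero]
  filter_upwards [compl_mem_ae_iff.2 h1] with z hz h
  exact hz (by simpa [splitEquiv_apply] using h)

/-- The hypotheses confine the support of `f` to a compact set over the closure of `core 2`, away
from both ends. Up to the lateral wall, a null set, the integral is that of a derivative over ℝ³. -/
lemma setIntegral_cyl_pd_eq_zero {f : E 3 → ℝ} (hf : ContDiff ℝ ∞ f)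
    (h0 : ∀ z, z 0 < 1 / 4 → f z = 0) (h1 : ∀ z, 1 / 2 < z 0 → f z = 0)
    (h2 : ∀ z, tail z ∉ closure (core 2) → f z = 0) (i : Fin 3) : ∫ z in cyl, pd i f z = 0 := by
  have hlocal : ∀ {U : Set (E 3)}, IsOpen U → (∀ z ∈ U, f z = 0) → ∀ z ∈ U, pd i f z = 0 := by
    intro U hU h z hz
    have : f =ᶠ[𝓝 z] fun _ => 0 := by
      filter_upwards [hU.mem_nhds hz] with w hw using h w hw
    rw [pd, this.fderiv_eq]
    simp
  have hsupp : HasCompactSupport f := HasCompactSupport.intro isCompact_cylBox fun z hz => by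
    by_contra hne
    apply hz
    refine ⟨(z 0, tail z), ⟨⟨?_, ?_⟩, ?_⟩, cons_tail z⟩
    · by_contra h
      exact hne (h0 z (by simp only at h; linarith))
    · by_contra h
      exact hne (h1 z (by simp only at h; linarith))
    · by_contra h
      exact hne (h2 z h)
  rw [← integral_pd_eq_zero (hf.of_le (by simp)) hsupp i]
  refine setIntegral_eq_integral_of_ae_compl_eq_zero ?_
  filter_upwards [ae_tail_notMem_sphere] with z hz hzc
  by_cases hl : z 0 < 1 / 4
  · exact hlocal (isOpen_lt continuous_apply_zero continuous_const) h0 z hl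
  by_cases hu : 1 / 2 < z 0
  · exact hlocal (isOpen_lt continuous_const continuous_apply_zero) h1 z hu
  refine hlocal (isClosed_closure.isOpen_compl.preimage tail.continuous) h2 z fun h => ?_
  exact hzc ⟨by linarith, by linarith, by_contra fun h' => hz ⟨h, h'⟩⟩

/-- In the boundary term the face r = 0 drops out because the first map is 1 near it, and the
lateral wall because that map is 1 beyond it. The components of ω₂ that contain dr vanish for r >
1/2, where neither map depends on r. Only the face r = 1 is left, where ω₂ is the pairing on the
disk. -/
lemma setIntegral_cyl_wz_mul {g h : GDS1} {F K : E 2 → M} {c d : M} (hF : ContDiff ℝ ∞ F)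
    (hK : ContDiff ℝ ∞ K) (hg : ∀ x : Ball 2, F x = (((g : GD) : Ball 2 → SU2) x : M))
    (hh : ∀ x : Ball 2, K x = (((h : GD) : Ball 2 → SU2) x : M))
    (hc : c ∈ specialUnitaryGroup (Fin 2) ℂ) (hc1 : 1 ≠ -c)
    (hG : IsGauge (cylGauge c F)) (hH : IsGauge (cylGauge d K)) :
    ∫ z in cyl, wz (fun y => cylGauge c F y * cylGauge d K y) z =
      (∫ z in cyl, wz (cylGauge c F) z) + (∫ z in cyl, wz (cylGauge d K) z) -
        3 * ∫ x in core 2, pairing (fun y => F (flat y)) (fun y => K (flat y)) x := by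
  have hω := contDiff_omega hG hH
  have hl : ∀ i j, ∀ z : E 3, z 0 < 1 / 4 → omega (cylGauge c F) (cylGauge d K) i j z = 0 := by
    intro i j z hz
    simp [omega, lform, fderiv_cylGauge_of_lt hc F hz]
  have ht : ∀ i j, ∀ z : E 3, tail z ∉ closure (core 2) →
      omega (cylGauge c F) (cylGauge d K) i j z = 0 := by
    intro i j z hz
    simp [omega, lform, fderiv_cylGauge_of_notMem hg hc hc1 hz]
  have lz : ∀ (P : E 2 → M) x, lform P x 0 = 0 := fun P x => by simp [lform]
  have rz : ∀ (P : E 2 → M) x, rform P x 0 = 0 := fun P x => by simp [rform]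
  have e1 : ∫ z in cyl, pd 1 (omega (cylGauge c F) (cylGauge d K) 2 0) z = 0 :=
    setIntegral_cyl_pd_eq_zero (hω 2 0) (hl 2 0) (fun z hz => by
      rw [omega, lform_cylGauge hF hg c hz, lform_cylGauge hF hg c hz, rform_cylGauge hK hh d hz,
        rform_cylGauge hK hh d hz, tail_ee_zero, lz, rz]
      simp) (ht 2 0) 1
  have e2 : ∫ z in cyl, pd 2 (omega (cylGauge c F) (cylGauge d K) 0 1) z = 0 :=
    setIntegral_cyl_pd_eq_zero (hω 0 1) (hl 0 1) (fun z hz => by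
      rw [omega, lform_cylGauge hF hg c hz, lform_cylGauge hF hg c hz, rform_cylGauge hK hh d hz,
        rform_cylGauge hK hh d hz, tail_ee_zero, lz, rz]
      simp) (ht 0 1) 2
  have e0 : ∫ z in cyl, pd 0 (omega (cylGauge c F) (cylGauge d K) 1 2) z =
      ∫ x in core 2, pairing (fun y => F (flat y)) (fun y => K (flat y)) x := by
    rw [setIntegral_cyl_pd_zero (hω 1 2)]
    refine setIntegral_congr_fun isOpen_core.measurableSet fun x _ => ?_
    have hx : (1 / 2 : ℝ) < cons 1 x 0 := by rw [cons_zero]; norm_num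
    change omega (cylGauge c F) (cylGauge d K) 1 2 (cons 1 x) -
      omega (cylGauge c F) (cylGauge d K) 1 2 (cons 0 x) = _
    rw [hl 1 2 (cons 0 x) (by rw [cons_zero]; norm_num), sub_zero, pairing_eq_omega, omega,
      lform_cylGauge hF hg c hx, lform_cylGauge hF hg c hx, rform_cylGauge hK hh d hx,
      rform_cylGauge hK hh d hx, tail_ee_one, tail_ee_two, tail_cons]
    rfl
  have hp : ∀ k i j, IntegrableOn (pd k (omega (cylGauge c F) (cylGauge d K) i j)) cyl :=
    fun k i j => integrableOn_cyl (contDiff_pd (hω i j) k).continuous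
  have hwG := integrableOn_cyl (continuous_wz hG)
  have hwH := integrableOn_cyl (continuous_wz hH)
  simp only [wz_mul hG hH]
  rw [integral_sub (hwG.fun_add hwH)
      ((((hp 0 1 2).fun_add (hp 1 2 0)).fun_add (hp 2 0 1)).const_mul 3),
    integral_add hwG hwH, integral_const_mul,
    integral_add ((hp 0 1 2).fun_add (hp 1 2 0)) (hp 2 0 1),
    integral_add (hp 0 1 2) (hp 1 2 0), e0, e1, e2]
  ring

lemma radial_apply {q : E 2 → E 3} {g : GDS1} {c : M} {G : E 3 → M}
    (h : ∀ r > 0, ∀ x : Ball 2, ‖(x : E 2)‖ < 1 →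
      G (r • q x) = contraction c (cutoff r) (((g : GD) : Ball 2 → SU2) x))
    (x : Ball 2) (hx : ‖(x : E 2)‖ < 1) : G (q x) = (((g : GD) : Ball 2 → SU2) x : M) := by
  rw [← one_smul ℝ (q x), h 1 one_pos x hx, cutoff_of_ge (by norm_num),
    contraction_one (((g : GD) : Ball 2 → SU2) x).2]

lemma radial_eq_one {q : E 2 → E 3} {G : E 3 → M}
    (h : ∀ y, y ≠ 0 → ‖y‖⁻¹ • y ∉ q '' Metric.ball 0 1 → G y = 1) (y : E 3) (hy : ‖y‖ = 1)
    (hyq : y ∉ q '' Metric.ball 0 1) : G y = 1 := by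
  refine h y (fun h0 => by simp [h0] at hy) ?_
  rwa [hy, inv_one, one_smul]

theorem exists_isFilling {q : E 2 → E 3} (hq : IsCollapse q) (g : GDS1) :
    ∃ G : GB, IsFilling q g G := by
  obtain ⟨c, hc, hc1, hcg⟩ := exists_center g
  obtain ⟨G, hG, hGr, hG1⟩ := exists_radial_filling hq g hc hc1 hcg
  exact ⟨hG.toGB, isFilling_toGB hG (radial_apply hGr) (radial_eq_one hG1)⟩

/-- The coboundary of the Wess–Zumino cochain is the Mickelsson cocycle, up to sign. -/
theorem neg_coboundary_wzCochain {q : E 2 → E 3} (hq : IsCollapse q) (g h : GDS1) :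
    -coboundary (wzCochain q) g h = ((cocycle (g : GD) (h : GD) : ℝ) : AddCircle (1 : ℝ)) := by
  obtain ⟨F, hF, hFg⟩ := (g : GD).2
  obtain ⟨K, hK, hKh⟩ := (h : GD).2
  obtain ⟨c, hc, hc1, hcg⟩ := exists_center g
  obtain ⟨d, hd, hd1, hdh⟩ := exists_center h
  obtain ⟨G, hG, hGr, hG1⟩ := exists_radial_filling hq g hc hc1 hcg
  obtain ⟨H, hH, hHr, hH1⟩ := exists_radial_filling hq h hd hd1 hdh
  -- The filling of gh is the product of those of g and h, not a radial filling built from gh, so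
  -- the identity below holds between real numbers. Integers enter only through the choices made in
  -- Λ.
  have hGH := hG.mul hH
  have hGH1 : ∀ y, y ≠ 0 → ‖y‖⁻¹ • y ∉ q '' Metric.ball 0 1 → G y * H y = 1 := fun y hy hyq => by
    rw [hG1 y hy hyq, hH1 y hy hyq, Matrix.mul_one]
  have fG : IsFilling q g hG.toGB := isFilling_toGB hG (radial_apply hGr) (radial_eq_one hG1)
  have fH : IsFilling q h hH.toGB := isFilling_toGB hH (radial_apply hHr) (radial_eq_one hH1)
  have fGH : IsFilling q (g * h) hGH.toGB := isFilling_toGB hGH (fun x hx => by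
    rw [radial_apply hGr x hx, radial_apply hHr x hx]
    rfl) (radial_eq_one hGH1)
  have kG : ∀ z ∈ cyl, cylGauge c F z = G (cone q z) := fun z hz => by
    have hx := mem_ball_zero_iff.1 (flat_mem_ball hz)
    have := hGr (z 0) hz.1 ⟨flat (tail z), by simpa using hx.le⟩ hx
    rw [← hFg] at this
    exact this.symm
  have kH : ∀ z ∈ cyl, cylGauge d K z = H (cone q z) := fun z hz => by
    have hx := mem_ball_zero_iff.1 (flat_mem_ball hz)
    have := hHr (z 0) hz.1 ⟨flat (tail z), by simpa using hx.le⟩ hx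
    rw [← hKh] at this
    exact this.symm
  have key := setIntegral_cyl_wz_mul hF hK hFg hKh hc hc1 (isGauge_cylGauge hF hFg hc hc1 hcg)
    (isGauge_cylGauge hK hKh hd hd1 hdh)
  rw [← setIntegral_ball_wz hq hG hG1 kG, ← setIntegral_ball_wz hq hH hH1 kH,
    ← setIntegral_ball_wz hq hGH hGH1 (K := fun y => cylGauge c F y * cylGauge d K y)
      (fun z hz => by rw [kG z hz, kH z hz]),
    ← setIntegral_pairing_flat (hF.differentiable (by simp)) (hK.differentiable (by simp))] at key
  have hval : cocycle (g : GD) (h : GD) =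
      ballIntegral hGH.toGB - ballIntegral hG.toGB - ballIntegral hH.toGB := by
    rw [cocycle_eq _ _ hFg hKh, ballIntegral_eq hG.toGB (F := G) (fun _ => rfl),
      ballIntegral_eq hH.toGB (F := H) (fun _ => rfl),
      ballIntegral_eq hGH.toGB (F := fun y => G y * H y) (fun _ => rfl), key]
    have := Real.pi_pos
    field_simp
    ring
  rw [coboundary, wzCochain_eq fG, wzCochain_eq fH, wzCochain_eq fGH, hval, AddCircle.coe_sub,
    AddCircle.coe_sub]
  abel

/-! ### Existence of a collapse. -/

/-- The inverse of `flat` on the open unit disk. -/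
def unflat : E 2 → E 2 := Function.invFunOn flat (core 2)

lemma exists_flat_eq {x : E 2} (hx : x ∈ Metric.ball (0 : E 2) 1) : ∃ u ∈ core 2, flat u = x := by
  rwa [← image_flat] at hx

lemma unflat_mem {x : E 2} (hx : x ∈ Metric.ball (0 : E 2) 1) : unflat x ∈ core 2 :=
  Function.invFunOn_mem (exists_flat_eq hx)

lemma flat_unflat {x : E 2} (hx : x ∈ Metric.ball (0 : E 2) 1) : flat (unflat x) = x :=
  Function.invFunOn_eq (exists_flat_eq hx)

lemma unflat_flat {u : E 2} (hu : u ∈ core 2) : unflat (flat u) = u := by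
  have hx : flat u ∈ Metric.ball (0 : E 2) 1 := mem_ball_zero_iff.2 (flat_mem_ball_iff.2 hu)
  exact injOn_flat (unflat_mem hx) hu (flat_unflat hx)

/-- By the inverse function theorem `flat` has a smooth local inverse, which agrees with `unflat`
near the point by injectivity on `core 2`. -/
lemma contDiffAt_unflat {x : E 2} (hx : x ∈ Metric.ball (0 : E 2) 1) :
    ContDiffAt ℝ ∞ unflat x := by
  obtain ⟨u, hu, rfl⟩ := exists_flat_eq hx
  have hf : ContDiffAt ℝ ∞ (flat : E 2 → E 2) u := contDiff_flat.contDiffAt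
  have hf' : HasFDerivAt flat ((flatDeriv u).toContinuousLinearEquivOfDetNeZero
      (det_flatDeriv_two hu).ne' : E 2 →L[ℝ] E 2) u :=
    (hasFDerivAt_flat u).congr_fderiv (by ext v; simp)
  have hi := hf.to_localInverse hf' (by simp)
  have hr := (hf.hasStrictFDerivAt' hf' (by simp)).eventually_right_inverse
  have hc : ∀ᶠ y in 𝓝 (flat u), hf.localInverse hf' (by simp) y ∈ core 2 := by
    refine hi.continuousAt.eventually_mem ?_
    rw [hf.localInverse_apply_image]
    exact isOpen_core.mem_nhds hu
  refine hi.congr_of_eventuallyEq ?_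
  filter_upwards [hr, hc] with y hy hyc
  rw [← unflat_flat hyc]
  exact congrArg unflat hy.symm

/-- The inclusion of the plane into `ℝ³`. -/
def planeEmbedding : E 2 →L[ℝ] E 3 :=
  LinearMap.toContinuousLinearMap
    { toFun := fun u => !₂[u 0, u 1, 0]
      map_add' := fun a b => by ext i; fin_cases i <;> simp
      map_smul' := fun c a => by ext i; fin_cases i <;> simp }

lemma planeEmbedding_apply (u : E 2) : planeEmbedding u = !₂[u 0, u 1, 0] := rfl

/-- The projection of `ℝ³` to its first two coordinates. -/
def planeProj : E 3 →L[ℝ] E 2 :=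
  LinearMap.toContinuousLinearMap
    { toFun := fun y => !₂[y 0, y 1]
      map_add' := fun a b => by ext i; fin_cases i <;> simp
      map_smul' := fun c a => by ext i; fin_cases i <;> simp }

lemma planeProj_apply (y : E 3) : planeProj y = !₂[y 0, y 1] := rfl

/-- The upper hemisphere as a graph over the disk. -/
def hemisphere (u : E 2) : E 3 := planeEmbedding u + Real.sqrt (1 - ‖u‖ ^ 2) • ee 2

@[simp] lemma hemisphere_zero (u : E 2) : hemisphere u 0 = u 0 := by
  simp [hemisphere, planeEmbedding_apply]

@[simp] lemma hemisphere_one (u : E 2) : hemisphere u 1 = u 1 := by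
  simp [hemisphere, planeEmbedding_apply]

@[simp] lemma hemisphere_two (u : E 2) : hemisphere u 2 = Real.sqrt (1 - ‖u‖ ^ 2) := by
  simp [hemisphere, planeEmbedding_apply]

lemma planeProj_hemisphere (u : E 2) : planeProj (hemisphere u) = u := by
  ext i; fin_cases i <;> simp [planeProj_apply]

lemma one_sub_norm_sq_pos {u : E 2} (hu : u ∈ core 2) : 1 / 2 < 1 - ‖u‖ ^ 2 := by
  have : ‖u‖ ^ 2 < 1 / 2 := hu
  linarith

lemma norm_hemisphere {u : E 2} (hu : u ∈ core 2) : ‖hemisphere u‖ = 1 := by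
  have h := one_sub_norm_sq_pos hu
  rw [← sq_eq_sq₀ (norm_nonneg _) zero_le_one, EuclideanSpace.norm_sq_eq, Fin.sum_univ_three]
  simp only [Real.norm_eq_abs, sq_abs, hemisphere_zero, hemisphere_one, hemisphere_two]
  rw [Real.sq_sqrt (by linarith), EuclideanSpace.norm_sq_eq, Fin.sum_univ_two]
  simp

lemma contDiffAt_hemisphere {u : E 2} (hu : u ∈ core 2) : ContDiffAt ℝ ∞ hemisphere u := by
  have h := one_sub_norm_sq_pos hu
  have h1 : ContDiffAt ℝ ∞ (fun v : E 2 => 1 - ‖v‖ ^ 2) u :=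
    contDiffAt_const.sub (contDiff_norm_sq ℝ).contDiffAt
  exact planeEmbedding.contDiff.contDiffAt.add
    ((h1.sqrt (by linarith)).smul contDiffAt_const)

/-- The derivative of `hemisphere`. -/
def hemisphereDeriv (u : E 2) : E 2 →L[ℝ] E 3 :=
  planeEmbedding + (-(Real.sqrt (1 - ‖u‖ ^ 2))⁻¹ • innerSL ℝ u).smulRight (ee 2)

lemma hasFDerivAt_hemisphere {u : E 2} (hu : u ∈ core 2) :
    HasFDerivAt hemisphere (hemisphereDeriv u) u := by
  have h := one_sub_norm_sq_pos hu
  have h1 : HasFDerivAt (fun v : E 2 => 1 - ‖v‖ ^ 2) (-(2 • innerSL ℝ u)) u :=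
    (hasStrictFDerivAt_norm_sq u).hasFDerivAt.const_sub 1
  have h2 := (h1.sqrt (by linarith)).smul_const (ee 2 : E 3)
  refine (planeEmbedding.hasFDerivAt.add h2).congr_fderiv ?_
  ext v i
  have hs : Real.sqrt (1 - ‖u‖ ^ 2) ≠ 0 := (Real.sqrt_pos.2 (by linarith)).ne'
  simp [hemisphereDeriv]
  field_simp

lemma det_hemisphereDeriv {u : E 2} (hu : u ∈ core 2) :
    0 < Matrix.det (Matrix.of ![(hemisphere u).ofLp, (hemisphereDeriv u (ee 0)).ofLp,
      (hemisphereDeriv u (ee 1)).ofLp]) := by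
  have h := one_sub_norm_sq_pos hu
  have hs : 0 < Real.sqrt (1 - ‖u‖ ^ 2) := Real.sqrt_pos.2 (by linarith)
  have hn : ‖u‖ ^ 2 = u 0 ^ 2 + u 1 ^ 2 := by
    rw [EuclideanSpace.norm_sq_eq, Fin.sum_univ_two]
    simp
  have hsq : Real.sqrt (1 - ‖u‖ ^ 2) ^ 2 = 1 - (u 0 ^ 2 + u 1 ^ 2) := by
    rw [Real.sq_sqrt (by linarith), hn]
  refine (inv_pos.2 hs).trans_eq ?_
  rw [det_of_rows]
  simp [hemisphereDeriv, planeEmbedding_apply, EuclideanSpace.inner_single_right]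
  field_simp
  linear_combination -hsq

/-- The smooth identification of the open disk with a polar cap of the sphere. -/
def cap (x : E 2) : E 3 := hemisphere (unflat x)

lemma image_cap : cap '' Metric.ball 0 1 = hemisphere '' core 2 := by
  rw [← image_flat, Set.image_image]
  exact Set.image_congr fun u hu => congrArg hemisphere (unflat_flat hu)

/-- The extension to `ℝ³` of the map that `F` induces on the sphere through `cap`. -/
def capExtend (F : E 2 → M) (y : E 3) : M :=
  1 + Real.smoothTransition (2 * y 2) • (F (flat (planeProj y)) - 1)

lemma contDiff_capExtend {F : E 2 → M} (hF : ContDiff ℝ ∞ F) : ContDiff ℝ ∞ (capExtend F) := by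
  have h : ContDiff ℝ ∞ fun y : E 3 => Real.smoothTransition (2 * y 2) :=
    Real.smoothTransition.contDiff.comp
      (contDiff_const.mul (EuclideanSpace.proj 2 : E 3 →L[ℝ] ℝ).contDiff)
  exact contDiff_const.add
    (h.smul ((hF.comp (contDiff_flat.comp planeProj.contDiff)).sub contDiff_const))

/-- On the cap the height is at least 1/√2, so the cutoff in `capExtend` is already 1. -/
lemma capExtend_hemisphere (F : E 2 → M) {u : E 2} (hu : u ∈ core 2) :
    capExtend F (hemisphere u) = F (flat u) := by
  have h := one_sub_norm_sq_pos hu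
  have hs : 1 / 2 ≤ Real.sqrt (1 - ‖u‖ ^ 2) := Real.le_sqrt_of_sq_le (by linarith)
  rw [capExtend, planeProj_hemisphere, hemisphere_two,
    Real.smoothTransition.one_of_one_le (by linarith), one_smul, add_sub_cancel]

/-- For height at most 0 the cutoff vanishes. A point of positive height off the cap lies over the
complement of `core 2`, which `flat` sends to the circle, where `g` is 1. -/
lemma capExtend_of_notMem {g : GDS1} {F : E 2 → M}
    (hg : ∀ x : Ball 2, F x = (((g : GD) : Ball 2 → SU2) x : M)) {y : E 3} (hy : ‖y‖ = 1)
    (hyq : y ∉ hemisphere '' core 2) : capExtend F y = 1 := by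
  rcases le_or_gt (y 2) 0 with h | h
  · rw [capExtend, Real.smoothTransition.zero_of_nonpos (by linarith), zero_smul, add_zero]
  · have hn : ‖planeProj y‖ ^ 2 = 1 - y 2 ^ 2 := by
      have h1 : ‖y‖ ^ 2 = 1 := by rw [hy, one_pow]
      rw [EuclideanSpace.norm_sq_eq, Fin.sum_univ_three] at h1
      rw [EuclideanSpace.norm_sq_eq, Fin.sum_univ_two]
      simp only [Real.norm_eq_abs, sq_abs, planeProj_apply] at h1 ⊢
      simp
      linarith
    have hyh : hemisphere (planeProj y) = y := by
      ext i
      fin_cases i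
      · simp [planeProj_apply]
      · simp [planeProj_apply]
      · simp [hn, Real.sqrt_sq h.le]
    have hc : planeProj y ∉ core 2 := fun hc => hyq ⟨_, hc, hyh⟩
    rw [capExtend, apply_flat_of_notMem_core hg hc, sub_self, smul_zero, add_zero]

/-- Collapses exist. -/
theorem isCollapse_cap : IsCollapse cap where
  smooth x hx := ((contDiffAt_hemisphere (unflat_mem hx)).comp x
    (contDiffAt_unflat hx)).contDiffWithinAt
  mapsTo x hx := mem_sphere_zero_iff_norm.2 (norm_hemisphere (unflat_mem hx))
  injOn x hx y hy h := by
    have h1 : unflat x = unflat y := by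
      rw [← planeProj_hemisphere (unflat x), ← planeProj_hemisphere (unflat y)]
      exact congrArg planeProj h
    rw [← flat_unflat hx, ← flat_unflat hy, h1]
  oriented x hx := by
    obtain ⟨u, hu, rfl⟩ := exists_flat_eq hx
    have hq : HasFDerivAt cap (fderiv ℝ cap (flat u)) (flat u) :=
      (((contDiffAt_hemisphere (unflat_mem hx)).comp (flat u)
        (contDiffAt_unflat hx)).differentiableAt (by simp)).hasFDerivAt
    have h1 := hq.comp u (hasFDerivAt_flat u)
    have h2 : HasFDerivAt hemisphere ((fderiv ℝ cap (flat u)).comp (flatDeriv u)) u := by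
      refine h1.congr_of_eventuallyEq ?_
      filter_upwards [isOpen_core.mem_nhds hu] with v hv
      exact congrArg hemisphere (unflat_flat hv).symm
    -- Since `hemisphere` is locally `cap ∘ flat` and `flat` preserves orientation, `cap` inherits
    -- the orientation of the graph.
    have h3 := det_hemisphereDeriv hu
    rw [(hasFDerivAt_hemisphere hu).unique h2, ContinuousLinearMap.comp_apply,
      ContinuousLinearMap.comp_apply, det_frame] at h3
    rw [cap, unflat_flat hu]
    exact (mul_pos_iff_of_pos_left (det_flatDeriv_two hu)).1 h3
  smooth_induced g := by
    obtain ⟨F, hF, hg⟩ := (g : GD).2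
    have hmem : ∀ y : S2, capExtend F y ∈ specialUnitaryGroup (Fin 2) ℂ := by
      intro y
      by_cases hy : (y : E 3) ∈ hemisphere '' core 2
      · obtain ⟨u, hu, huy⟩ := hy
        rw [← huy, capExtend_hemisphere F hu]
        exact apply_flat_mem hg u
      · rw [capExtend_of_notMem hg (by simp) hy]
        exact one_mem _
    refine ⟨fun y => ⟨capExtend F y, hmem y⟩, ⟨capExtend F, contDiff_capExtend hF, fun _ => rfl⟩,
      fun y => ⟨fun x hx hxy => Subtype.ext ?_, fun hy => Subtype.ext ?_⟩⟩
    · have hxb : (x : E 2) ∈ Metric.ball (0 : E 2) 1 := mem_ball_zero_iff.2 hx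
      change capExtend F y = _
      rw [← hxy, cap, capExtend_hemisphere F (unflat_mem hxb), flat_unflat hxb, hg]
    · rw [image_cap] at hy
      exact capExtend_of_notMem hg (by simp) hy

end

end Mickelsson

open Mickelsson in
theorem mainTheorem2 :
    (∃ q : E 2 → E 3, IsCollapse q) ∧
    ∀ q : E 2 → E 3, IsCollapse q →
      (∀ g : GDS1, ∃ G : GB, IsFilling q g G) ∧
      (∀ (g : GDS1) (G : GB), IsFilling q g G →
        wzCochain q g = ((ballIntegral G : ℝ) : AddCircle (1 : ℝ))) ∧
      ∀ g h : GDS1,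
        -coboundary (wzCochain q) g h = ((cocycle (g : GD) (h : GD) : ℝ) : AddCircle (1 : ℝ)) :=
  ⟨⟨cap, isCollapse_cap⟩, fun _ hq =>
    ⟨exists_isFilling hq, fun _ _ hG => wzCochain_eq hG, neg_coboundary_wzCochain hq⟩⟩
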